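/- Let $a,b>0$ with $ab\le 1$ and let $g\in L^2(\mathbb R)$ (complex valued). For $m,n\in\mathbb Z$ let $E_{mb}T_{na}g(t)=e^{2\pi i mbt}g(t-na)$, and for $k\in\mathbb Z$ let $$G_k(t)=\sum_{n\in\mathbb Z} g(t-na)\,\overline{g(t-na-k/b)}$$ (absolutely convergent for a.e. $t$). Let $S$ be the Weyl–Heisenberg frame operator $Sf=\sum_{m,n\in\mathbb Z}\langle f,E_{mb}T_{na}g\rangle E_{mb}T_{na}g$. Let $L_0^\infty$ be the closure in $L^\infty(\mathbb R)$ of the compactly supported functions. For a space $X\subseteq L^p(\mathbb R)$ we say that $S$ extends to a map $T:X\to L^p(\mathbb R)$ if for every $f\in X\cap L^2(\mathbb R)$ the series $Sf$ converges unconditionally in $L^2(\mathbb R)$ and $Tf=Sf$ a.e. **Theorem 7.1.** The following are equivalent: 1. (CC-condition) There is a constant $B>0$ such that $\sum_{k\in\mathbb Z}|G_k(t)|\le B$ for a.e. $t\in\mathbb R$. 2. $S$ extends to a bounded linear operator $L^p(\mathbb R)\to L^p(\mathbb R)$ for every $1\le p<\infty$, and to a bounded linear operator $L_0^\infty\to L^\infty(\mathbb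 R)$. Moreover, suppose that $ab$ is rational, that $(E_{mb}T_{na}g)_{m,n\in\mathbb Z}$ is a frame for $L^2(\mathbb R)$, i.e. there are $A>0$ and $B<\infty$ with $A\|f\|^2\le\sum_{m,n}|\langle f,E_{mb}T_{na}g\rangle|^2\le B\|f\|^2$ for all $f\in L^2(\mathbb R)$, and that $g$ satisfies the uniform CC-condition: for every $\varepsilon>0$ there is $K>0$ such that $\sum_{|k|\ge K}|G_k(t)|<\varepsilon$ for a.e. $t$. Then $S$ extends to an isomorphism (a bounded linear bijection with bounded inverse) of $L^p(\mathbb R)$ onto $L^p(\mathbb R)$ for every $1\le p<\infty$, and of $L_0^\infty$ onto $L_0^\infty$. -/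

import Mathlib

open MeasureTheory Filter Topology
open scoped ENNReal

namespace WeylHeisenberg

noncomputable section

/-- The function `E_{mb} T_{na} g`, that is `t ↦ exp (2 π i m b t) g (t - n a)`. -/
def whFun (a b : ℝ) (g : ℝ → ℂ) (m n : ℤ) (t : ℝ) : ℂ :=
  Complex.exp (2 * Real.pi * Complex.I * (m * b * t : ℝ)) * g (t - n * a)

theorem memLp_whFun (a b : ℝ) {g : ℝ → ℂ} (hg : MemLp g 2 volume) (m n : ℤ) :
    MemLp (whFun a b g m n) 2 volume := by
  have h1 : MemLp (fun t : ℝ => g (t - n * a)) 2 volume :=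
    hg.comp_measurePreserving (measurePreserving_sub_right volume (n * a : ℝ))
  have hc : Continuous fun t : ℝ =>
      Complex.exp (2 * Real.pi * Complex.I * (m * b * t : ℝ)) := by fun_prop
  refine h1.of_le (hc.aestronglyMeasurable.mul h1.aestronglyMeasurable) (ae_of_all _ fun t => ?_)
  have : (2 * Real.pi * Complex.I * (m * b * t : ℝ) : ℂ)
      = ((2 * Real.pi * (m * b * t) : ℝ) : ℂ) * Complex.I := by
    push_cast; ring
  rw [whFun, norm_mul, this, Complex.norm_exp_ofReal_mul_I, one_mul]

/-- The Weyl-Heisenberg system `(E_{mb} T_{na} g)_{m,n}` in `L²(ℝ)`, indexed by the pairs `(m, n)`. -/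
def whSystem (a b : ℝ) (g : Lp ℂ 2 (volume : Measure ℝ)) (i : ℤ × ℤ) :
    Lp ℂ 2 (volume : Measure ℝ) :=
  (memLp_whFun a b (Lp.memLp g) i.1 i.2).toLp (whFun a b g i.1 i.2)

/-- A family `v` in a Hilbert space is a frame: there are `A > 0` and `B < ∞` with
`A ‖f‖² ≤ ∑ |⟨f, v i⟩|² ≤ B ‖f‖²` for all `f`. -/
def IsFrame {ι H : Type*} [NormedAddCommGroup H] [InnerProductSpace ℂ H] (v : ι → H) : Prop :=
  ∃ A B : ℝ, 0 < A ∧ ∀ f : H, Summable (fun i => ‖inner ℂ (v i) f‖ ^ 2) ∧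
    A * ‖f‖ ^ 2 ≤ ∑' i, ‖inner ℂ (v i) f‖ ^ 2 ∧ ∑' i, ‖inner ℂ (v i) f‖ ^ 2 ≤ B * ‖f‖ ^ 2

/-- `G_k(t) = ∑_n g(t - na) conj (g(t - na - k/b))`. For `g ∈ L²(ℝ)` and `a ≠ 0` the series
converges absolutely for almost every `t`. -/
def autoCorr (a b : ℝ) (g : ℝ → ℂ) (k : ℤ) (t : ℝ) : ℂ :=
  ∑' n : ℤ, g (t - n * a) * starRingEnd ℂ (g (t - n * a - k / b))

/-- The CC-condition: `∑_k |G_k(t)| ≤ B` for a.e. `t`, for some constant `B > 0`. -/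
def CCCondition (a b : ℝ) (g : ℝ → ℂ) : Prop :=
  ∃ B : ℝ, 0 < B ∧ ∀ᵐ t : ℝ, ∑' k : ℤ, ‖autoCorr a b g k t‖ₑ ≤ ENNReal.ofReal B

/-- The uniform CC-condition: for every `ε > 0` there is `K > 0` such that
`∑_{|k| ≥ K} |G_k(t)| < ε` for a.e. `t`. -/
def UniformCCCondition (a b : ℝ) (g : ℝ → ℂ) : Prop :=
  ∀ ε : ℝ, 0 < ε → ∃ K : ℕ, 0 < K ∧
    ∀ᵐ t : ℝ, ∑' k : {k : ℤ // (K : ℤ) ≤ |k|}, ‖autoCorr a b g k t‖ₑ < ENNReal.ofReal ε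

/-- `v` is the value at `u ∈ L²(ℝ)` of the frame operator: the series
`∑_{m,n} ⟨u, E_{mb} T_{na} g⟩ E_{mb} T_{na} g` converges unconditionally in `L²(ℝ)` with sum `v`.
(Mathlib's inner product is linear in the second variable.) -/
def IsFrameOpValue (a b : ℝ) (g u v : Lp ℂ 2 (volume : Measure ℝ)) : Prop :=
  HasSum (fun i : ℤ × ℤ => (inner ℂ (whSystem a b g i) u : ℂ) • whSystem a b g i) v

/-- A map `T`, defined on a space `X` of classes of functions in `L^p(ℝ)`, extends the frame
operator: for every `f ∈ X` that also lies in `L²(ℝ)` (as the class `u`), the series of the frame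
operator at `f` converges in `L²(ℝ)` and its sum equals `T f` almost everywhere. -/
def ExtendsFrameOp (a b : ℝ) (g : Lp ℂ 2 (volume : Measure ℝ)) {p : ℝ≥0∞}
    {X : Type*} (incl : X → Lp ℂ p (volume : Measure ℝ)) (T : X → Lp ℂ p (volume : Measure ℝ)) :
    Prop :=
  ∀ (f : X) (u : Lp ℂ 2 (volume : Measure ℝ)), (incl f : ℝ → ℂ) =ᵐ[volume] u →
    ∃ v : Lp ℂ 2 (volume : Measure ℝ), IsFrameOpValue a b g u v ∧ (T f : ℝ → ℂ) =ᵐ[volume] v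

/-- The classes in `L^∞(ℝ)` of functions that vanish a.e. outside a compact set. -/
def compactlySupportedLInfty : Submodule ℂ (Lp ℂ ∞ (volume : Measure ℝ)) where
  carrier := {f | ∃ K : Set ℝ, IsCompact K ∧ ∀ᵐ t : ℝ, t ∉ K → f t = 0}
  zero_mem' := ⟨∅, isCompact_empty, by
    filter_upwards [Lp.coeFn_zero ℂ ∞ (volume : Measure ℝ)] with t ht _
    simp [ht]⟩
  add_mem' := by
    rintro f h ⟨K, hK, hf⟩ ⟨L, hL, hh⟩
    refine ⟨K ∪ L, hK.union hL, ?_⟩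
    filter_upwards [hf, hh, Lp.coeFn_add f h] with t h1 h2 h3 ht
    rw [Set.mem_union, not_or] at ht
    rw [h3, Pi.add_apply, h1 ht.1, h2 ht.2, add_zero]
  smul_mem' := by
    rintro c f ⟨K, hK, hf⟩
    refine ⟨K, hK, ?_⟩
    filter_upwards [hf, Lp.coeFn_smul c f] with t h1 h2 ht
    rw [h2, Pi.smul_apply, h1 ht, smul_zero]

/-- `L_0^∞(ℝ)`: the closure in `L^∞(ℝ)` of the compactly supported functions. -/
def LInftyZero : Submodule ℂ (Lp ℂ ∞ (volume : Measure ℝ)) :=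
  compactlySupportedLInfty.topologicalClosure

end

end WeylHeisenberg

/-! Write `s = 1/b`. Everything rests on Walnut's representation `b · S f(t) = ∑ₖ G_k(t) f(t - k s)`
(`hasSum_whFun_coeff`): for fixed `n`, summing over the modulations `m` is Poisson summation with
period `s`, and summing over `n` afterwards assembles the functions `G_k`. Thus `S` acts along each
fibre `t - sℤ` as the matrix with entries `G_{i-j}(t - j s)` in row `j` and column `i`, up to the
factor `1/b`.

The CC-condition bounds the rows of this matrix. Since `G_{-k}(t)` is the conjugate of `G_k(t + k
s)`, it bounds the columns as well, and Schur's test (`eLpNorm_kerAbs_le`) gives boundedness on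
every `L^p`. Conversely, the numbers `f(t - k s)` can be prescribed independently for `t` in one
cell of length `s`. Choosing them as the phases that turn `G_k(t)` into `|G_k(t)|` for `k` in a
finite set shows that a bound from `L_0^∞` to `L^∞` forces the CC-condition
(`ae_sum_norm_autoCorr_le`).

For invertibility, step functions carry the frame bounds to almost every fibre matrix
(`ae_gramForm_bounds`). Each `G_k` is `a`-periodic, so when `ab` is rational the fibre matrix is
block Laurent, with a finite matrix symbol on the circle whose entries have absolutely convergent
Fourier series. The uniform CC-condition makes the tails of these series small uniformly in `t`.
Fejér averages carry the lower frame bound to the symbol (`IsPosKernel.lower_block`), so its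
determinant stays away from zero. A Wiener lemma uniform in the parameter (`IsTight.inv`) and
Cramer's rule then invert the symbol among series of the same kind.

The coefficients of the inverse form a kernel that again passes Schur's test, inverts the fibre
matrices on both sides, and has uniformly small tails. It therefore inverts `S` on all `L^p` at
once, and the small tails keep `L_0^∞` invariant in both directions
(`IsSchurKernel.toCLM_mem_LInftyZero`). -/

namespace WeylHeisenberg

open scoped NNReal ComplexConjugate

/-! ### Schur's test for kernels carried by the translates by `s ℤ` -/

/-- The sum `∑ₖ w k t * F (t - k s)` with values in `[0, ∞]`. -/
noncomputable def kerAbs (s : ℝ) (w : ℤ → ℝ → ℝ≥0∞) (F : ℝ → ℝ≥0∞) (t : ℝ) : ℝ≥0∞ :=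
  ∑' k : ℤ, w k t * F (t - k * s)

/-- The function `∑ₖ Γ k t * f (t - k s)`. -/
noncomputable def kerSum (s : ℝ) (Γ : ℤ → ℝ → ℂ) (f : ℝ → ℂ) (t : ℝ) : ℂ :=
  ∑' k : ℤ, Γ k t * f (t - k * s)

/-- A kernel supported on the translates by `s ℤ`, with rows and columns bounded by `C`. -/
structure IsSchurKernel (s : ℝ) (Γ : ℤ → ℝ → ℂ) (C : ℝ≥0) : Prop where
  meas : ∀ k, Measurable (Γ k)
  row : ∀ᵐ t : ℝ, ∑' k : ℤ, ‖Γ k t‖ₑ ≤ C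
  col : ∀ᵐ t : ℝ, ∑' k : ℤ, ‖Γ k (t + k * s)‖ₑ ≤ C

theorem ae_sub_const {q : ℝ → Prop} (h : ∀ᵐ t : ℝ, q t) (c : ℝ) : ∀ᵐ t : ℝ, q (t - c) :=
  (measurePreserving_sub_right volume c).quasiMeasurePreserving.ae h

theorem ae_forall_sub {q : ℝ → Prop} (h : ∀ᵐ t : ℝ, q t) (s : ℝ) :
    ∀ᵐ t : ℝ, ∀ k : ℤ, q (t - k * s) :=
  ae_all_iff.2 fun _ => ae_sub_const h _

theorem aemeasurable_comp_sub {β : Type*} [MeasurableSpace β] {F : ℝ → β}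
    (hF : AEMeasurable F) (c : ℝ) :
    AEMeasurable fun t => F (t - c) :=
  hF.comp_quasiMeasurePreserving (measurePreserving_sub_right volume c).quasiMeasurePreserving

theorem aemeasurable_kerAbs {s : ℝ} {w : ℤ → ℝ → ℝ≥0∞} {F : ℝ → ℝ≥0∞}
    (hw : ∀ k, Measurable (w k)) (hF : AEMeasurable F) : AEMeasurable (kerAbs s w F) :=
  AEMeasurable.tsum fun k => (hw k).aemeasurable.mul (aemeasurable_comp_sub hF _)

/-- Jensen's inequality for countable sums. -/
theorem tsum_mul_rpow_le {ι : Type*} (w F : ι → ℝ≥0∞) {C : ℝ≥0∞} {r : ℝ} (hr : 1 ≤ r)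
    (hw : ∑' k, w k ≤ C) : (∑' k, w k * F k) ^ r ≤ C ^ (r - 1) * ∑' k, w k * F k ^ r := by
  have hr0 : 0 < r := by linarith
  have h1 : ∑' k, w k * F k ≤ C ^ (1 - r⁻¹) * (∑' k, w k * F k ^ r) ^ r⁻¹ := by
    rw [ENNReal.tsum_eq_iSup_sum]
    refine iSup_le fun u => (ENNReal.inner_le_weight_mul_Lp_of_nonneg u hr w F).trans ?_
    have h2 : 0 ≤ 1 - r⁻¹ := sub_nonneg.2 (inv_le_one_of_one_le₀ hr)
    gcongr
    · exact (ENNReal.sum_le_tsum u).trans hw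
    · exact ENNReal.sum_le_tsum u
  calc (∑' k, w k * F k) ^ r ≤ (C ^ (1 - r⁻¹) * (∑' k, w k * F k ^ r) ^ r⁻¹) ^ r := by gcongr
    _ = C ^ (r - 1) * ∑' k, w k * F k ^ r := by
      rw [ENNReal.mul_rpow_of_nonneg _ _ hr0.le, ← ENNReal.rpow_mul, ← ENNReal.rpow_mul,
        inv_mul_cancel₀ hr0.ne', ENNReal.rpow_one]
      congr 2
      field_simp

/-- By Tonelli and the substitution `t ↦ t + k s` in the `k`-th term, `F` loses its shift and
factors out of a column sum. This is the `L¹` endpoint of Schur's test; Jensen's inequality reduces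
finite exponents to it. -/
theorem lintegral_kerAbs_le {s : ℝ} {w : ℤ → ℝ → ℝ≥0∞} {F : ℝ → ℝ≥0∞} {C : ℝ≥0∞}
    (hw : ∀ k, Measurable (w k)) (col : ∀ᵐ t : ℝ, ∑' k : ℤ, w k (t + k * s) ≤ C)
    (hF : AEMeasurable F) : ∫⁻ t, kerAbs s w F t ≤ C * ∫⁻ t, F t := by
  have h1 : ∫⁻ t, kerAbs s w F t = ∫⁻ t, ∑' k : ℤ, w k (t + k * s) * F t := by
    unfold kerAbs
    rw [lintegral_tsum (f := fun (k : ℤ) t => w k t * F (t - k * s))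
        fun k => (hw k).aemeasurable.mul (aemeasurable_comp_sub hF _),
      lintegral_tsum (f := fun (k : ℤ) t => w k (t + k * s) * F t) fun k =>
        ((hw k).comp (measurable_add_const _)).aemeasurable.mul hF]
    congr 1 with k
    rw [← lintegral_sub_right_eq_self (fun t => w k (t + k * s) * F t) (k * s)]
    simp
  rw [h1]
  simp_rw [ENNReal.tsum_mul_right]
  rw [← lintegral_const_mul'' _ hF]
  refine lintegral_mono_ae ?_
  filter_upwards [col] with t ht
  gcongr

/-- Schur's test on `L^p`, `1 ≤ p ≤ ∞`. -/
theorem eLpNorm_kerAbs_le {s : ℝ} {w : ℤ → ℝ → ℝ≥0∞} {F : ℝ → ℝ≥0∞} {C : ℝ≥0} {p : ℝ≥0∞}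
    (hp : 1 ≤ p) (hw : ∀ k, Measurable (w k)) (row : ∀ᵐ t : ℝ, ∑' k : ℤ, w k t ≤ C)
    (col : ∀ᵐ t : ℝ, ∑' k : ℤ, w k (t + k * s) ≤ C) (hF : AEMeasurable F) :
    eLpNorm (kerAbs s w F) p ≤ C * eLpNorm F p := by
  rcases eq_or_ne p ∞ with rfl | hp'
  · rw [eLpNorm_exponent_top, eLpNorm_exponent_top]
    refine eLpNormEssSup_le_of_ae_enorm_bound ?_
    filter_upwards [row, ae_forall_sub (enorm_ae_le_eLpNormEssSup F volume) s] with t h1 h2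
    simp only [enorm_eq_self] at h2 ⊢
    calc kerAbs s w F t ≤ ∑' k : ℤ, w k t * eLpNormEssSup F volume := by
          unfold kerAbs; gcongr with k; exact h2 k
      _ = (∑' k : ℤ, w k t) * eLpNormEssSup F volume := ENNReal.tsum_mul_right
      _ ≤ _ := by gcongr
  · have hp0 : p ≠ 0 := (zero_lt_one.trans_le hp).ne'
    have hr : 1 ≤ p.toReal := by
      simpa using ENNReal.toReal_mono hp' hp
    rw [eLpNorm_eq_lintegral_rpow_enorm_toReal hp0 hp', eLpNorm_eq_lintegral_rpow_enorm_toReal hp0 hp']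
    simp only [enorm_eq_self]
    set r := p.toReal with hrdef
    have hr0 : 0 < r := by linarith
    have h1 : ∫⁻ t, kerAbs s w F t ^ r ≤ (C : ℝ≥0∞) ^ r * ∫⁻ t, F t ^ r := by
      calc ∫⁻ t, kerAbs s w F t ^ r
          ≤ ∫⁻ t, (C : ℝ≥0∞) ^ (r - 1) * kerAbs s w (fun u => F u ^ r) t := by
            refine lintegral_mono_ae ?_
            filter_upwards [row] with t ht
            exact tsum_mul_rpow_le _ _ hr ht
        _ = (C : ℝ≥0∞) ^ (r - 1) * ∫⁻ t, kerAbs s w (fun u => F u ^ r) t :=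
            lintegral_const_mul'' _ (aemeasurable_kerAbs hw (hF.pow_const r))
        _ ≤ (C : ℝ≥0∞) ^ (r - 1) * (C * ∫⁻ t, F t ^ r) := by
            gcongr
            exact lintegral_kerAbs_le hw col (hF.pow_const r)
        _ = (C : ℝ≥0∞) ^ r * ∫⁻ t, F t ^ r := by
            rw [← mul_assoc]
            congr 1
            conv_rhs => rw [show r = (r - 1) + 1 by ring,
              ENNReal.rpow_add_of_nonneg _ _ (by linarith) zero_le_one, ENNReal.rpow_one]
    calc (∫⁻ t, kerAbs s w F t ^ r) ^ (1 / r) ≤ ((C : ℝ≥0∞) ^ r * ∫⁻ t, F t ^ r) ^ (1 / r) := by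
          gcongr
      _ = _ := by
        rw [ENNReal.mul_rpow_of_nonneg _ _ (by positivity), ← ENNReal.rpow_mul,
          mul_one_div_cancel hr0.ne', ENNReal.rpow_one]

theorem ae_lt_top_of_eLpNorm_lt_top {F : ℝ → ℝ≥0∞} {p : ℝ≥0∞} (hp : 1 ≤ p)
    (hF : AEMeasurable F) (h : eLpNorm F p < ∞) : ∀ᵐ t : ℝ, F t < ∞ := by
  rcases eq_or_ne p ∞ with rfl | hp'
  · rw [eLpNorm_exponent_top] at h
    filter_upwards [enorm_ae_le_eLpNormEssSup F volume] with t ht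
    exact (by simpa using ht : F t ≤ _).trans_lt h
  · have hp0 : p ≠ 0 := (zero_lt_one.trans_le hp).ne'
    have hr : 0 < p.toReal := ENNReal.toReal_pos hp0 hp'
    have h1 := lintegral_rpow_enorm_lt_top_of_eLpNorm_lt_top hp0 hp' h
    simp only [enorm_eq_self] at h1
    filter_upwards [ae_lt_top' (hF.pow_const _) h1.ne] with t ht
    simpa [hr] using (ENNReal.rpow_lt_top_iff_of_pos hr).1 ht

section kerSum

variable {s : ℝ} {Γ : ℤ → ℝ → ℂ} {C : ℝ≥0} {f h : ℝ → ℂ} {p : ℝ≥0∞}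

theorem enorm_tsum_le {ι : Type*} (u : ι → ℂ) : ‖∑' i, u i‖ₑ ≤ ∑' i, ‖u i‖ₑ := by
  by_cases hu : ∑' i, ‖u i‖ₑ = ∞
  · simp [hu]
  · have hs : Summable fun i => ‖u i‖ := tsum_enorm_ne_top_iff_summable_norm.1 hu
    rw [← ofReal_norm]
    refine (ENNReal.ofReal_le_ofReal (norm_tsum_le_tsum_norm hs)).trans ?_
    rw [ENNReal.ofReal_tsum_of_nonneg (fun _ => norm_nonneg _) hs]
    simp

theorem enorm_kerSum_le (t : ℝ) :
    ‖kerSum s Γ f t‖ₑ ≤ kerAbs s (fun k t => ‖Γ k t‖ₑ) (fun t => ‖f t‖ₑ) t := by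
  refine (enorm_tsum_le _).trans (le_of_eq ?_)
  simp [kerAbs]

theorem aestronglyMeasurable_kerSum (hΓ : ∀ k, Measurable (Γ k))
    (hf : AEStronglyMeasurable f) : AEStronglyMeasurable (kerSum s Γ f) := by
  refine AEMeasurable.aestronglyMeasurable ?_
  exact AEMeasurable.tsum fun k => (hΓ k).aemeasurable.mul (aemeasurable_comp_sub hf.aemeasurable _)

theorem kerSum_congr_ae (hfh : f =ᵐ[volume] h) : kerSum s Γ f =ᵐ[volume] kerSum s Γ h := by
  filter_upwards [ae_forall_sub hfh s] with t ht
  simp only [kerSum, ht]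

theorem IsSchurKernel.eLpNorm_kerAbs_lt_top (hΓ : IsSchurKernel s Γ C) (hp : 1 ≤ p)
    {F : ℝ → ℝ≥0∞} (hF : AEMeasurable F) (hF' : eLpNorm F p < ∞) :
    eLpNorm (kerAbs s (fun k t => ‖Γ k t‖ₑ) F) p < ∞ := by
  have hm : ∀ k, Measurable fun t => ‖Γ k t‖ₑ := fun k => (hΓ.meas k).enorm
  have h1 := eLpNorm_kerAbs_le hp hm hΓ.row hΓ.col hF
  exact lt_of_le_of_lt h1 (ENNReal.mul_lt_top ENNReal.coe_lt_top hF')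

theorem IsSchurKernel.eLpNorm_kerSum_le (hΓ : IsSchurKernel s Γ C) (hp : 1 ≤ p)
    (hf : AEStronglyMeasurable f) : eLpNorm (kerSum s Γ f) p ≤ C * eLpNorm f p := by
  have h0 : eLpNorm (kerSum s Γ f) p
      ≤ eLpNorm (kerAbs s (fun k t => ‖Γ k t‖ₑ) (fun t => ‖f t‖ₑ)) p := by
    refine eLpNorm_mono_enorm fun t => ?_
    exact (enorm_kerSum_le t).trans_eq (enorm_eq_self _).symm
  have hm : ∀ k, Measurable fun t => ‖Γ k t‖ₑ := fun k => (hΓ.meas k).enorm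
  have h1 := eLpNorm_kerAbs_le (F := fun t => ‖f t‖ₑ) hp hm hΓ.row hΓ.col hf.enorm
  rw [eLpNorm_enorm] at h1
  exact le_trans h0 h1

theorem IsSchurKernel.memLp_kerSum (hΓ : IsSchurKernel s Γ C) (hp : 1 ≤ p)
    (hf : MemLp f p) : MemLp (kerSum s Γ f) p :=
  ⟨aestronglyMeasurable_kerSum hΓ.meas hf.1,
    (hΓ.eLpNorm_kerSum_le hp hf.1).trans_lt (ENNReal.mul_lt_top ENNReal.coe_lt_top hf.2)⟩

/-- The sum of absolute values has finite `L^p` norm, hence is finite almost everywhere. Without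
this the unconditional `tsum` in `kerSum` would not be additive in `f`. -/
theorem IsSchurKernel.summable_ae (hΓ : IsSchurKernel s Γ C) (hp : 1 ≤ p)
    (hf : MemLp f p) : ∀ᵐ t : ℝ, Summable fun k : ℤ => Γ k t * f (t - k * s) := by
  have h1 := hΓ.eLpNorm_kerAbs_lt_top hp hf.1.enorm (by rw [eLpNorm_enorm]; exact hf.2)
  filter_upwards [ae_lt_top_of_eLpNorm_lt_top hp
    (aemeasurable_kerAbs (fun k => (hΓ.meas k).enorm) hf.1.enorm) h1] with t ht
  refine Summable.of_norm (tsum_enorm_ne_top_iff_summable_norm.1 ?_)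
  simpa [kerAbs] using ht.ne

/-- The operator on `L^p` given by a Schur kernel. -/
noncomputable def IsSchurKernel.toCLM (hΓ : IsSchurKernel s Γ C) (p : ℝ≥0∞) [hp : Fact (1 ≤ p)] :
    Lp ℂ p (volume : Measure ℝ) →L[ℂ] Lp ℂ p (volume : Measure ℝ) :=
  LinearMap.mkContinuous
    { toFun := fun f => (hΓ.memLp_kerSum hp.out (Lp.memLp f)).toLp
      map_add' := fun f h => by
        rw [← MemLp.toLp_add, MemLp.toLp_eq_toLp_iff]
        filter_upwards [ae_forall_sub (Lp.coeFn_add f h) s,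
          hΓ.summable_ae hp.out (Lp.memLp f), hΓ.summable_ae hp.out (Lp.memLp h)] with t h1 h2 h3
        simp only [kerSum, h1, Pi.add_apply, mul_add, h2.tsum_add h3]
      map_smul' := fun c f => by
        rw [RingHom.id_apply, ← MemLp.toLp_const_smul, MemLp.toLp_eq_toLp_iff]
        filter_upwards [ae_forall_sub (Lp.coeFn_smul c f) s] with t h1
        simp only [kerSum, h1, Pi.smul_apply, smul_eq_mul, ← tsum_mul_left]
        congr 1 with k
        ring }
    C fun f => by
      simp only [LinearMap.coe_mk, AddHom.coe_mk]
      rw [Lp.norm_toLp, Lp.norm_def, ← ENNReal.coe_toReal C, ← ENNReal.toReal_mul]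
      exact ENNReal.toReal_mono (ENNReal.mul_ne_top ENNReal.coe_ne_top (Lp.eLpNorm_ne_top f))
        (hΓ.eLpNorm_kerSum_le hp.out (Lp.aestronglyMeasurable f))

theorem IsSchurKernel.toCLM_ae (hΓ : IsSchurKernel s Γ C) [hp : Fact (1 ≤ p)]
    (f : Lp ℂ p (volume : Measure ℝ)) : hΓ.toCLM p f =ᵐ[volume] kerSum s Γ f :=
  MemLp.coeFn_toLp (hΓ.memLp_kerSum hp.out (Lp.memLp f))

/-- Composition of two Schur operators whose kernels are inverse to each other. -/
theorem kerSum_kerSum_ae {Δ : ℤ → ℝ → ℂ} {D : ℝ≥0} (hΔ : IsSchurKernel s Δ D)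
    (hΓ : IsSchurKernel s Γ C) (hp : 1 ≤ p) (hf : MemLp f p)
    (hinv : ∀ᵐ t : ℝ, ∀ k : ℤ, ∑' j : ℤ, Δ j t * Γ (k - j) (t - j * s) = if k = 0 then 1 else 0) :
    kerSum s Δ (kerSum s Γ f) =ᵐ[volume] f := by
  have m1 : AEMeasurable (kerAbs s (fun k t => ‖Γ k t‖ₑ) (fun t => ‖f t‖ₑ)) :=
    aemeasurable_kerAbs (fun k => (hΓ.meas k).enorm) hf.1.enorm
  have h0 : eLpNorm (fun t => ‖f t‖ₑ) p < ∞ := by rw [eLpNorm_enorm]; exact hf.2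
  have h1 := hΓ.eLpNorm_kerAbs_lt_top hp hf.1.enorm h0
  have h2 := hΔ.eLpNorm_kerAbs_lt_top hp m1 h1
  filter_upwards [ae_lt_top_of_eLpNorm_lt_top hp
    (aemeasurable_kerAbs (fun k => (hΔ.meas k).enorm) m1) h2, hinv] with t ht hi
  -- Finiteness at `t` of the two absolute kernels applied in succession is exactly what Fubini
  -- needs to regroup the double sum by the total shift `k`.
  have hsum : Summable fun q : ℤ × ℤ => Δ q.1 t * (Γ (q.2 - q.1) (t - q.1 * s) * f (t - q.2 * s)) := by
    refine Summable.of_norm (tsum_enorm_ne_top_iff_summable_norm.1 ?_)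
    rw [ENNReal.tsum_prod']
    refine ne_of_lt (lt_of_le_of_lt (le_of_eq ?_) ht)
    simp only [kerAbs, ← ENNReal.tsum_mul_left]
    refine tsum_congr fun j => ?_
    rw [← (Equiv.subRight j).tsum_eq fun k : ℤ =>
      ‖Δ j t‖ₑ * (‖Γ k (t - j * s)‖ₑ * ‖f (t - j * s - k * s)‖ₑ)]
    refine tsum_congr fun k => ?_
    simp only [enorm_mul, Equiv.subRight_apply, Int.cast_sub]
    rw [show t - j * s - (k - j) * s = t - k * s by ring]
  have e1 : kerSum s Δ (kerSum s Γ f) t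
      = ∑' j : ℤ, ∑' k : ℤ, Δ j t * (Γ (k - j) (t - j * s) * f (t - k * s)) := by
    simp only [kerSum, ← tsum_mul_left]
    refine tsum_congr fun j => ?_
    rw [← (Equiv.subRight j).tsum_eq fun k : ℤ =>
      Δ j t * (Γ k (t - j * s) * f (t - j * s - k * s))]
    refine tsum_congr fun k => ?_
    simp only [Equiv.subRight_apply, Int.cast_sub]
    rw [show t - j * s - (k - j) * s = t - k * s by ring]
  rw [e1, ← Summable.tsum_comm
    (f := fun j k : ℤ => Δ j t * (Γ (k - j) (t - j * s) * f (t - k * s))) hsum]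
  have e2 : ∀ k : ℤ, ∑' j : ℤ, Δ j t * (Γ (k - j) (t - j * s) * f (t - k * s))
      = if k = 0 then f t else 0 := by
    intro k
    simp only [← mul_assoc]
    rw [tsum_mul_right, hi k]
    split_ifs with hk <;> simp [hk]
  simp [e2]

end kerSum

/-! ### Invariance of `L_0^∞` under kernels with tight rows -/

/-- The rows of the kernel `Γ` have uniformly small tails. -/
def TightRows (Γ : ℤ → ℝ → ℂ) : Prop :=
  ∀ ε : ℝ, 0 < ε → ∃ K : ℕ, ∀ᵐ t : ℝ, ∑' k : {k : ℤ // (K : ℤ) ≤ |k|}, ‖Γ k t‖ₑ ≤ ENNReal.ofReal ε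

/-- Cutting the kernel to a band `|k| < K` leaves finitely many translates, so compact support
survives; tightness makes the discarded part small in the `L^∞` operator norm. Continuity then
passes from compactly supported functions to their closure. -/
theorem IsSchurKernel.toCLM_mem_LInftyZero {s : ℝ} {Γ : ℤ → ℝ → ℂ} {C : ℝ≥0}
    (hΓ : IsSchurKernel s Γ C) (ht : TightRows Γ) {f : Lp ℂ ∞ (volume : Measure ℝ)}
    (hf : f ∈ LInftyZero) : hΓ.toCLM ∞ f ∈ LInftyZero := by
  have key : Set.MapsTo (hΓ.toCLM ∞) (compactlySupportedLInfty : Set (Lp ℂ ∞ (volume : Measure ℝ)))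
      (closure (compactlySupportedLInfty : Set (Lp ℂ ∞ (volume : Measure ℝ)))) := by
    rintro f ⟨K₀, hK₀, hf⟩
    rw [Metric.mem_closure_iff]
    intro ε hε
    obtain ⟨δ, hδ, hδε⟩ : ∃ δ : ℝ, 0 < δ ∧ δ * ‖f‖ < ε := by
      refine ⟨ε / (‖f‖ + 1), by positivity, ?_⟩
      rw [div_mul_eq_mul_div, div_lt_iff₀ (by positivity)]
      nlinarith [norm_nonneg f]
    obtain ⟨K, hK⟩ := ht δ hδ
    let Γ' : ℤ → ℝ → ℂ := fun k t => if (K : ℤ) ≤ |k| then 0 else Γ k t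
    have hle : ∀ k t, ‖Γ' k t‖ₑ ≤ ‖Γ k t‖ₑ := fun k t => by
      simp only [Γ']; split_ifs <;> simp
    have hΓ' : IsSchurKernel s Γ' C := by
      refine ⟨fun k => ?_, ?_, ?_⟩
      · simp only [Γ']; split_ifs
        · exact measurable_const
        · exact hΓ.meas k
      · filter_upwards [hΓ.row] with t ht using (ENNReal.tsum_le_tsum fun k => hle k t).trans ht
      · filter_upwards [hΓ.col] with t ht using (ENNReal.tsum_le_tsum fun k => hle k _).trans ht
    refine ⟨hΓ'.toCLM ∞ f, ?_, ?_⟩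
    · refine ⟨⋃ k ∈ Finset.Icc (-(K : ℤ)) K, (fun x : ℝ => x + k * s) '' K₀,
        Finset.isCompact_biUnion _ fun k _ => hK₀.image (by fun_prop), ?_⟩
      filter_upwards [hΓ'.toCLM_ae f, ae_forall_sub hf s] with t h1 h2 h3
      rw [h1]
      simp only [kerSum]
      convert tsum_zero with k
      by_cases hk : (K : ℤ) ≤ |k|
      · simp [Γ', hk]
      · rw [h2 k, mul_zero]
        intro h4
        refine h3 ?_
        simp only [Set.mem_iUnion]
        refine ⟨k, ?_, t - k * s, h4, by ring⟩
        rw [not_le, abs_lt] at hk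
        rw [Finset.mem_Icc]
        omega
    · rw [dist_eq_norm]
      refine lt_of_le_of_lt ?_ hδε
      rw [Lp.norm_def, Lp.norm_def]
      rw [← ENNReal.toReal_ofReal hδ.le, ← ENNReal.toReal_mul]
      refine ENNReal.toReal_mono (ENNReal.mul_ne_top ENNReal.ofReal_ne_top (Lp.eLpNorm_ne_top f)) ?_
      rw [eLpNorm_exponent_top]
      refine eLpNormEssSup_le_of_ae_enorm_bound ?_
      filter_upwards [hK, hΓ.toCLM_ae f, hΓ'.toCLM_ae f, Lp.coeFn_sub (hΓ.toCLM ∞ f) (hΓ'.toCLM ∞ f),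
        hΓ.summable_ae le_top (Lp.memLp f), hΓ'.summable_ae le_top (Lp.memLp f),
        ae_forall_sub (enorm_ae_le_eLpNormEssSup f volume) s] with t h1 h2 h3 h4 h5 h6 h7
      rw [h4, Pi.sub_apply, h2, h3]
      simp only [kerSum]
      rw [← h5.tsum_sub h6]
      refine (enorm_tsum_le _).trans ?_
      calc ∑' k : ℤ, ‖Γ k t * f (t - k * s) - Γ' k t * f (t - k * s)‖ₑ
          ≤ ∑' k : ℤ, Set.indicator {k : ℤ | (K : ℤ) ≤ |k|}
              (fun k => ‖Γ k t‖ₑ * eLpNormEssSup f volume) k := by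
            refine ENNReal.tsum_le_tsum fun k => ?_
            by_cases hk : (K : ℤ) ≤ |k|
            · simp only [Γ', hk, Set.indicator, Set.mem_ofPred_eq, if_true, zero_mul, sub_zero,
                enorm_mul]
              gcongr
              exact h7 k
            · simp [Γ', hk]
        _ = (∑' k : {k : ℤ // (K : ℤ) ≤ |k|}, ‖Γ k t‖ₑ) * eLpNormEssSup f volume := by
            rw [← tsum_subtype, ENNReal.tsum_mul_right]
            rfl
        _ ≤ _ := by rw [eLpNorm_exponent_top]; gcongr
  have h2 := map_mem_closure (hΓ.toCLM ∞).continuous hf key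
  rwa [closure_closure] at h2

/-! ### Parseval, periodization and Poisson summation -/

theorem hasSum_fourierCoeff_mul_conj {T : ℝ} [hT : Fact (0 < T)]
    (f h : Lp ℂ 2 (@AddCircle.haarAddCircle T hT)) :
    HasSum (fun i => fourierCoeff f i * conj (fourierCoeff h i))
      (∫ t : AddCircle T, f t * conj (h t) ∂AddCircle.haarAddCircle) := by
  have h1 := (fourierBasis (T := T)).hasSum_inner_mul_inner h f
  have e : ∀ (x : Lp ℂ 2 (@AddCircle.haarAddCircle T hT)) i,
      inner ℂ ((fourierBasis (T := T)) i) x = fourierCoeff x i := fun x i => by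
    rw [← HilbertBasis.repr_apply_apply, fourierBasis_repr]
  convert! h1 using 1
  · ext i
    rw [e, ← inner_conj_symm h, e, mul_comm]

/-- Parseval's identity for two square integrable functions on an interval. -/
theorem hasSum_fourierCoeffOn_mul_conj {a b : ℝ} {f h : ℝ → ℂ} (hab : a < b)
    (hf : MemLp f 2 (volume.restrict (Set.Ioc a b))) (hh : MemLp h 2 (volume.restrict (Set.Ioc a b))) :
    HasSum (fun i => fourierCoeffOn hab f i * conj (fourierCoeffOn hab h i))
      ((b - a)⁻¹ • ∫ x in a..b, f x * conj (h x)) := by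
  have := Fact.mk (by linarith : 0 < b - a)
  rw [← add_sub_cancel a b] at hf hh
  have h1 := hf.memLp_liftIoc.haarAddCircle
  have h2 := hh.memLp_liftIoc.haarAddCircle
  convert hasSum_fourierCoeff_mul_conj h1.toLp h2.toLp using 1
  · ext i
    simp [fourierCoeff_congr_ae h1.coeFn_toLp, fourierCoeff_congr_ae h2.coeFn_toLp,
      fourierCoeff_liftIoc_eq]
  · nth_rw 2 [← add_sub_cancel a b]
    rw [← AddCircle.integral_liftIoc_eq_intervalIntegral,
      ← AddCircle.integral_haarAddCircle]
    apply integral_congr_ae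
    filter_upwards [h1.coeFn_toLp, h2.coeFn_toLp] with x hx hx'
    rw [hx, hx']
    rfl

/-- The integral over the line as a sum of integrals over a period. -/
theorem hasSum_integral_Ioc_sub {s : ℝ} (hs : 0 < s) {F : ℝ → ℂ} (hF : Integrable F) :
    HasSum (fun k : ℤ => ∫ t in Set.Ioc 0 s, F (t - k * s)) (∫ t, F t) := by
  have h1 := hasSum_integral_iUnion (μ := volume) (f := F)
    (fun i : ℤ => measurableSet_Ioc (a := i • s) (b := (i + 1) • s))
    (Set.pairwise_disjoint_Ioc_zsmul s) hF.integrableOn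
  rw [iUnion_Ioc_zsmul hs, setIntegral_univ] at h1
  -- As `t` runs over `(0, s]`, the point `t - k s` runs over the cell with index `-k`.
  rw [← (Equiv.neg ℤ).hasSum_iff] at h1
  convert! h1 using 1
  ext k
  simp only [Function.comp, Equiv.neg_apply]
  rw [← (measurePreserving_sub_right volume (k * s : ℝ)).setIntegral_preimage_emb
    (measurableEmbedding_subRight _) F (Set.Ioc ((-k) • s) ((-k + 1) • s))]
  congr 2
  ext t
  simp only [zsmul_eq_mul, Set.mem_preimage, Set.mem_Ioc, Int.cast_neg, Int.cast_add, Int.cast_one]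
  constructor
  · rintro ⟨h1, h2⟩; constructor <;> linarith
  · rintro ⟨h1, h2⟩; constructor <;> linarith

/-- The character `t ↦ exp (-2 π i m t / s)`. -/
noncomputable def chr (s : ℝ) (m : ℤ) (t : ℝ) : ℂ := Complex.exp (-(2 * Real.pi * Complex.I * (m * t / s : ℝ)))

theorem norm_chr (s : ℝ) (m : ℤ) (t : ℝ) : ‖chr s m t‖ = 1 := by
  have : (-(2 * Real.pi * Complex.I * (m * t / s : ℝ)) : ℂ)
      = ((-(2 * Real.pi * (m * t / s)) : ℝ) : ℂ) * Complex.I := by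
    push_cast; ring
  rw [chr, this, Complex.norm_exp_ofReal_mul_I]

theorem continuous_chr (s : ℝ) (m : ℤ) : Continuous (chr s m) := by
  unfold chr; fun_prop

theorem chr_sub {s : ℝ} (hs : 0 < s) (m k : ℤ) (t : ℝ) : chr s m (t - k * s) = chr s m t := by
  unfold chr
  rw [Complex.exp_eq_exp_iff_exists_int]
  refine ⟨m * k, ?_⟩
  have : (s : ℂ) ≠ 0 := by exact_mod_cast hs.ne'
  push_cast
  field_simp
  ring

theorem fourierCoeffOn_eq_chr {s : ℝ} (hs : 0 < s) (f : ℝ → ℂ) (m : ℤ) :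
    fourierCoeffOn hs f m = (s : ℂ)⁻¹ * ∫ t in Set.Ioc 0 s, f t * chr s m t := by
  rw [fourierCoeffOn_eq_integral, intervalIntegral.integral_of_le hs.le]
  simp only [sub_zero, one_div, Complex.real_smul, Complex.ofReal_inv]
  congr 2
  ext t
  rw [fourier_coe_apply, smul_eq_mul, mul_comm]
  congr 1
  unfold chr
  congr 1
  push_cast
  ring

section Periodization

variable {s R : ℝ} {φ ψ : ℝ → ℂ}

/-- The finitely many translates by `s ℤ` of `[-R, R]` that meet `[0, s]`. -/
noncomputable def meetSet (s R : ℝ) : Finset ℤ := Finset.Icc (-⌈R / s + 1⌉) ⌈R / s + 1⌉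

theorem lt_abs_of_notMem_meetSet (hs : 0 < s) {k : ℤ} (hk : k ∉ meetSet s R) :
    R + s < |k * s| := by
  have h1 : R / s + 1 < |(k : ℝ)| := by
    by_contra hcon
    push Not at hcon
    apply hk
    rw [abs_le] at hcon
    have h3 := Int.le_ceil (R / s + 1)
    rw [meetSet, Finset.mem_Icc]
    constructor
    · exact_mod_cast (by linarith : (-⌈R / s + 1⌉ : ℝ) ≤ k)
    · exact_mod_cast (by linarith : (k : ℝ) ≤ ⌈R / s + 1⌉)
  rw [abs_mul, abs_of_pos hs]
  have : (R / s + 1) * s = R + s := by field_simp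
  nlinarith

theorem abs_sub_ge_of_notMem_meetSet (hs : 0 < s) {k : ℤ} (hk : k ∉ meetSet s R) (t : ℝ) :
    R + s < |t - k * s| + |t| := by
  have h4 := abs_sub_abs_le_abs_sub (k * s) t
  rw [abs_sub_comm] at h4
  linarith [lt_abs_of_notMem_meetSet hs hk]

theorem eq_zero_of_notMem_meetSet (hs : 0 < s) (hφ : ∀ t, R < |t| → φ t = 0) {t : ℝ}
    (ht : t ∈ Set.Ioc 0 s) {k : ℤ} (hk : k ∉ meetSet s R) : φ (t - k * s) = 0 := by
  apply hφ
  have h5 : |t| ≤ s := by rw [abs_of_pos ht.1]; exact ht.2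
  linarith [abs_sub_ge_of_notMem_meetSet hs hk t]

theorem eq_zero_of_notMem_meetSet_add (hs : 0 < s) (hφ : ∀ t, R < |t| → φ t = 0) {R' t : ℝ}
    (ht : |t| ≤ R') {k : ℤ} (hk : k ∉ meetSet s (R + R')) : φ (t - k * s) = 0 := by
  apply hφ
  linarith [abs_sub_ge_of_notMem_meetSet hs hk t]

theorem tsum_sub_eq_sum (hs : 0 < s) (hφ : ∀ t, R < |t| → φ t = 0) {t : ℝ}
    (ht : t ∈ Set.Ioc 0 s) : ∑' k : ℤ, φ (t - k * s) = ∑ k ∈ meetSet s R, φ (t - k * s) :=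
  tsum_eq_sum fun _ hk => eq_zero_of_notMem_meetSet hs hφ ht hk

theorem tsum_sub_periodic (j : ℤ) (t : ℝ) :
    ∑' k : ℤ, φ (t - j * s - k * s) = ∑' k : ℤ, φ (t - k * s) := by
  rw [← (Equiv.addLeft j).tsum_eq fun k : ℤ => φ (t - k * s)]
  refine tsum_congr fun k => ?_
  simp only [Equiv.coe_addLeft, Int.cast_add]
  ring_nf

/-- On one period, bounded support reduces the periodization to a fixed finite sum of translates. -/
theorem memLp_tsum_sub (hs : 0 < s) (hφ : ∀ t, R < |t| → φ t = 0) (h2 : MemLp φ 2) :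
    MemLp (fun t => ∑' k : ℤ, φ (t - k * s)) 2 (volume.restrict (Set.Ioc 0 s)) := by
  have h1 : MemLp (fun t => ∑ k ∈ meetSet s R, φ (t - k * s)) 2
      (volume.restrict (Set.Ioc 0 s)) :=
    (memLp_finsetSum (f := fun (k : ℤ) t => φ (t - k * s)) _ fun k _ =>
      h2.comp_measurePreserving (measurePreserving_sub_right volume (k * s : ℝ))).restrict _
  refine h1.ae_eq ?_
  filter_upwards [ae_restrict_mem measurableSet_Ioc] with t ht
  exact (tsum_sub_eq_sum hs hφ ht).symm

theorem integrable_of_support (hφ : ∀ t, R < |t| → φ t = 0) (h2 : MemLp φ 2) : Integrable φ := by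
  have h3 : MemLp φ 1 (volume.restrict (Set.Icc (-R) R)) :=
    (h2.restrict _).mono_exponent (by norm_num)
  rw [memLp_one_iff_integrable] at h3
  refine (integrableOn_iff_integrable_of_support_subset ?_).1 h3
  intro t ht
  by_contra hcon
  refine ht (hφ t ?_)
  by_contra h4
  exact hcon (abs_le.1 (not_lt.1 h4))

/-- The Fourier coefficients of the periodization. -/
theorem setIntegral_tsum_sub_mul_chr (hs : 0 < s) (hφ : ∀ t, R < |t| → φ t = 0) (h2 : MemLp φ 2)
    (m : ℤ) : ∫ t in Set.Ioc 0 s, (∑' k : ℤ, φ (t - k * s)) * chr s m t = ∫ t, φ t * chr s m t := by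
  have hi := integrable_of_support hφ h2
  have hi2 : Integrable fun t => φ t * chr s m t :=
    hi.mul_bdd (continuous_chr s m).aestronglyMeasurable (c := 1)
      (ae_of_all _ fun t => (norm_chr s m t).le)
  rw [← (hasSum_integral_Ioc_sub hs hi2).tsum_eq, tsum_eq_sum (s := meetSet s R),
    ← integral_finsetSum]
  · refine setIntegral_congr_fun measurableSet_Ioc fun t ht => ?_
    simp only [chr_sub hs, tsum_sub_eq_sum hs hφ ht, Finset.sum_mul]
  · intro k _
    exact (hi2.comp_sub_right _).integrableOn
  · intro k hk
    rw [← integral_zero (μ := volume.restrict (Set.Ioc 0 s)) (α := ℝ) (G := ℂ)]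
    refine setIntegral_congr_fun measurableSet_Ioc fun t ht => ?_
    simp only [eq_zero_of_notMem_meetSet hs hφ ht hk, zero_mul]

/-- Poisson summation for compactly supported square integrable functions. -/
theorem hasSum_integral_chr_mul_conj (hs : 0 < s) (hφ : ∀ t, R < |t| → φ t = 0) (h2 : MemLp φ 2)
    (hψ : ∀ t, R < |t| → ψ t = 0) (h2' : MemLp ψ 2) :
    HasSum (fun m : ℤ => (∫ t, φ t * chr s m t) * conj (∫ t, ψ t * chr s m t))
      (s * ∫ t, (∑' k : ℤ, φ (t - k * s)) * conj (ψ t)) := by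
  have hs' : (s : ℂ) ≠ 0 := by exact_mod_cast hs.ne'
  have h1 := hasSum_fourierCoeffOn_mul_conj hs (memLp_tsum_sub hs hφ h2) (memLp_tsum_sub hs hψ h2')
  simp only [fourierCoeffOn_eq_chr, setIntegral_tsum_sub_mul_chr hs hφ h2,
    setIntegral_tsum_sub_mul_chr hs hψ h2', sub_zero, map_mul, map_inv₀, Complex.conj_ofReal] at h1
  have h3 := h1.mul_left ((s : ℂ) ^ 2)
  convert! h3 using 1
  · ext m
    field_simp
  rw [Complex.real_smul, ← mul_assoc, Complex.ofReal_inv, pow_two, mul_assoc (s : ℂ),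
    mul_inv_cancel₀ hs', mul_one]
  congr 1
  rw [intervalIntegral.integral_of_le hs.le]
  have hshift : ∀ k : ℤ, MemLp (fun t => ψ (t - k * s)) 2 := fun k =>
    h2'.comp_measurePreserving (measurePreserving_sub_right volume (k * s : ℝ))
  -- Both factors are square integrable once the periodization is replaced by the finitely many
  -- translates of `φ` that meet the support of `ψ`.
  have hint : Integrable fun t => (∑' k : ℤ, φ (t - k * s)) * conj (ψ t) := by
    have h4 : MemLp (fun t => ∑ k ∈ meetSet s (R + R), φ (t - k * s)) 2 volume :=
      memLp_finsetSum (f := fun (k : ℤ) t => φ (t - k * s)) _ fun k _ =>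
        h2.comp_measurePreserving (measurePreserving_sub_right volume (k * s : ℝ))
    refine (h4.integrable_mul h2'.star).congr (ae_of_all _ fun t => ?_)
    by_cases ht : R < |t|
    · simp [hψ t ht]
    · simp only [Pi.mul_apply, Pi.star_apply, RCLike.star_def]
      rw [tsum_eq_sum fun k hk => eq_zero_of_notMem_meetSet_add hs hφ (not_lt.1 ht) hk]
  -- Unfolding: the periodization of `φ` is `s`-periodic, so cutting the line into cells shifts only
  -- `ψ` and rebuilds the periodization of `ψ` over one period.
  have h5 := hasSum_integral_Ioc_sub hs hint
  simp only [tsum_sub_periodic] at h5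
  rw [← h5.tsum_eq, tsum_eq_sum (s := meetSet s R), ← integral_finsetSum]
  · refine (setIntegral_congr_fun measurableSet_Ioc fun t ht => ?_).symm
    simp only [tsum_sub_eq_sum hs hψ ht, Finset.mul_sum, map_sum]
  · intro k _
    exact (memLp_tsum_sub hs hφ h2).integrable_mul (q := 2) ((hshift k).restrict _).star
  · intro k hk
    rw [← integral_zero (μ := volume.restrict (Set.Ioc 0 s)) (α := ℝ) (G := ℂ)]
    refine setIntegral_congr_fun measurableSet_Ioc fun t ht => ?_
    simp only [eq_zero_of_notMem_meetSet hs hψ ht hk, map_zero, mul_zero]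

end Periodization

/-! ### Walnut's representation in weak form -/

section Walnut

variable {a : ℝ}

/-- The sum counts the points of `t + aℤ` in an interval of length `v - u`. The bound does not
depend on `t` and serves as a column bound below. -/
theorem tsum_indicator_add_le (ha : 0 < a) (u v t : ℝ) :
    ∑' k : ℤ, (Set.Icc u v).indicator (fun _ => (1 : ℝ≥0∞)) (t + k * a)
      ≤ (⌈(v - u) / a + 1⌉₊ : ℝ≥0) := by
  rw [tsum_eq_sum (s := Finset.Icc ⌈(u - t) / a⌉ ⌊(v - t) / a⌋)]
  · have h0 : ∀ k ∈ Finset.Icc ⌈(u - t) / a⌉ ⌊(v - t) / a⌋,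
        (Set.Icc u v).indicator (fun _ => (1 : ℝ≥0∞)) (t + k * a) ≤ 1 := fun k _ =>
      Set.indicator_le_self' (f := fun _ => (1 : ℝ≥0∞)) (by simp) (t + k * a)
    refine (Finset.sum_le_card_nsmul _ _ 1 h0).trans ?_
    rw [Int.card_Icc, nsmul_eq_mul, mul_one]
    norm_cast
    rw [Int.toNat_le]
    have h1 := Int.floor_le ((v - t) / a)
    have h2 := Int.le_ceil ((u - t) / a)
    have h3 := Nat.le_ceil ((v - u) / a + 1)
    have h4 : (v - u) / a = (v - t) / a - (u - t) / a := by ring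
    have h5 : ((⌊(v - t) / a⌋ + 1 - ⌈(u - t) / a⌉ : ℤ) : ℝ) ≤ ((⌈(v - u) / a + 1⌉₊ : ℤ) : ℝ) := by
      push_cast
      linarith
    exact_mod_cast h5
  · intro k hk
    rw [Set.indicator_of_notMem]
    intro hmem
    apply hk
    rw [Finset.mem_Icc, Int.ceil_le, Int.le_floor, div_le_iff₀ ha, le_div_iff₀ ha]
    constructor <;> linarith [hmem.1, hmem.2]

/-- Restricting to `[u, v]` makes every weight the indicator of `[u, v]`, whose column sums count
lattice points; the `L¹` Schur bound applies. -/
theorem setLIntegral_tsum_sub_le (ha : 0 < a) {F : ℝ → ℝ≥0∞} (hF : AEMeasurable F) (u v : ℝ) :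
    ∫⁻ t in Set.Icc u v, ∑' n : ℤ, F (t - n * a) ≤ (⌈(v - u) / a + 1⌉₊ : ℝ≥0) * ∫⁻ t, F t := by
  have h := lintegral_kerAbs_le (s := a) (C := (⌈(v - u) / a + 1⌉₊ : ℝ≥0))
    (w := fun _ t => (Set.Icc u v).indicator (fun _ => (1 : ℝ≥0∞)) t)
    (fun _ => measurable_const.indicator measurableSet_Icc)
    (ae_of_all _ fun t => tsum_indicator_add_le ha u v t) hF
  rw [← lintegral_indicator measurableSet_Icc]
  refine le_trans (le_of_eq ?_) h
  congr 1
  ext t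
  by_cases ht : t ∈ Set.Icc u v <;> simp [kerAbs, ht]

theorem ae_tsum_sub_lt_top (ha : 0 < a) {F : ℝ → ℝ≥0∞} (hF : Measurable F)
    (hF' : ∫⁻ t, F t < ∞) : ∀ᵐ t : ℝ, ∑' n : ℤ, F (t - n * a) < ∞ := by
  have h1 : ∀ N : ℕ, ∀ᵐ t : ℝ, t ∈ Set.Icc (-(N : ℝ)) N → ∑' n : ℤ, F (t - n * a) < ∞ := by
    intro N
    rw [← ae_restrict_iff' measurableSet_Icc]
    refine ae_lt_top (Measurable.tsum fun n => hF.comp (measurable_sub_const _)) ?_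
    exact ((setLIntegral_tsum_sub_le ha hF.aemeasurable _ _).trans_lt
      (ENNReal.mul_lt_top ENNReal.coe_lt_top hF')).ne
  filter_upwards [ae_all_iff.2 h1] with t ht
  obtain ⟨N, hN⟩ := exists_nat_ge |t|
  exact ht N (abs_le.1 hN)

theorem ennreal_mul_le_sq_add_sq (x y : ℝ≥0∞) : x * y ≤ x ^ 2 + y ^ 2 := by
  rcases le_total x y with h | h
  · calc x * y ≤ y * y := by gcongr
      _ = y ^ 2 := by ring
      _ ≤ _ := le_add_self
  · calc x * y ≤ x * x := by gcongr
      _ = x ^ 2 := by ring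
      _ ≤ _ := le_self_add

variable {b : ℝ} {g : ℝ → ℂ}

theorem lintegral_enorm_sq_lt_top {g : ℝ → ℂ} (hg : MemLp g 2) : ∫⁻ t, ‖g t‖ₑ ^ 2 < ∞ := by
  have := lintegral_rpow_enorm_lt_top_of_eLpNorm_lt_top two_ne_zero ENNReal.ofNat_ne_top hg.2
  simpa using this

theorem ae_tsum_enorm_sq_lt_top (ha : 0 < a) (hg : MemLp g 2) (hgm : Measurable g) :
    ∀ᵐ t : ℝ, ∑' n : ℤ, ‖g (t - n * a)‖ₑ ^ 2 < ∞ :=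
  ae_tsum_sub_lt_top ha (hgm.enorm.pow_const 2) (lintegral_enorm_sq_lt_top hg)

theorem summable_mul_conj_of_sq {x y : ℤ → ℂ} (hx : ∑' n, ‖x n‖ₑ ^ 2 < ∞)
    (hy : ∑' n, ‖y n‖ₑ ^ 2 < ∞) : Summable fun n => x n * conj (y n) := by
  refine Summable.of_norm (tsum_enorm_ne_top_iff_summable_norm.1 (ne_of_lt ?_))
  calc ∑' n, ‖x n * conj (y n)‖ₑ ≤ ∑' n, (‖x n‖ₑ ^ 2 + ‖y n‖ₑ ^ 2) := by
        refine ENNReal.tsum_le_tsum fun n => ?_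
        rw [enorm_mul]
        refine le_trans (le_of_eq ?_) (ennreal_mul_le_sq_add_sq _ _)
        congr 1
        exact RCLike.enorm_conj _
    _ < ∞ := by
        rw [ENNReal.tsum_add]
        exact ENNReal.add_lt_top.2 ⟨hx, hy⟩

/-- The series defining `autoCorr` converge absolutely almost everywhere. -/
theorem ae_summable_autoCorr (ha : 0 < a) (hg : MemLp g 2) (hgm : Measurable g) (b : ℝ) :
    ∀ᵐ t : ℝ, ∀ k : ℤ, Summable fun n : ℤ => g (t - n * a) * conj (g (t - n * a - k / b)) := by
  have h := ae_tsum_enorm_sq_lt_top ha hg hgm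
  filter_upwards [h, ae_forall_sub h b⁻¹] with t h1 h2 k
  refine summable_mul_conj_of_sq h1 ?_
  convert h2 k using 6
  ring

theorem measurable_autoCorr (hgm : Measurable g) (k : ℤ) : Measurable (autoCorr a b g k) := by
  unfold autoCorr
  refine Measurable.tsum fun n => ?_
  have h1 : Measurable fun t : ℝ => g (t - n * a) := hgm.comp (measurable_sub_const _)
  have h2 : Measurable fun t : ℝ => g (t - n * a - k / b) :=
    hgm.comp ((measurable_sub_const _).sub_const _)
  exact h1.mul (Complex.continuous_conj.measurable.comp h2)

/-- Modulation by `m b` is a character of period `1/b`. Hence, for fixed `n`, the inner products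
over `m` are the quantities to which Poisson summation applies. -/
theorem conj_whFun (m n : ℤ) (t : ℝ) :
    conj (whFun a b g m n t) = chr b⁻¹ m t * conj (g (t - n * a)) := by
  rw [whFun, map_mul, ← Complex.exp_conj]
  congr 2
  simp only [map_mul, Complex.conj_ofReal, Complex.conj_I, map_ofNat]
  push_cast
  field_simp

/-- A bounded measurable function supported in `[-R, R]`. -/
structure BddSupp (f : ℝ → ℂ) (M : ℝ≥0) (R : ℝ) : Prop where
  meas : Measurable f
  bdd : ∀ t, ‖f t‖ₑ ≤ M
  supp : ∀ t, R < |t| → f t = 0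

variable {f h : ℝ → ℂ} {M R : ℝ}

theorem BddSupp.memLp {f : ℝ → ℂ} {M : ℝ≥0} {R : ℝ} (hf : BddSupp f M R) (p : ℝ≥0∞) :
    MemLp f p := by
  have h1 : MemLp f p (volume.restrict (Set.Icc (-R) R)) :=
    MemLp.of_bound hf.meas.aestronglyMeasurable M (ae_of_all _ fun t => by
      have := hf.bdd t
      rw [← ofReal_norm, ENNReal.ofReal_le_iff_le_toReal ENNReal.coe_ne_top] at this
      simpa using this)
  rw [← memLp_indicator_iff_restrict measurableSet_Icc] at h1
  convert h1 using 1
  ext t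
  by_cases ht : t ∈ Set.Icc (-R) R
  · simp [ht]
  · rw [Set.indicator_of_notMem ht]
    refine hf.supp t ?_
    by_contra hcon
    exact ht (abs_le.1 (not_lt.1 hcon))

theorem BddSupp.memLp_mul_conj {f : ℝ → ℂ} {M : ℝ≥0} {R : ℝ} (hf : BddSupp f M R)
    (hg : MemLp g 2) (c : ℝ) : MemLp (fun t => f t * conj (g (t - c))) 2 := by
  have h1 : MemLp (fun t : ℝ => g (t - c)) 2 volume :=
    hg.comp_measurePreserving (measurePreserving_sub_right volume c)
  exact h1.star.mul (r := 2) (hf.memLp ∞)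

theorem integral_mul_conj_whFun (f : ℝ → ℂ) (m n : ℤ) :
    ∫ t, f t * conj (whFun a b g m n t)
      = ∫ t, f t * conj (g (t - n * a)) * chr b⁻¹ m t := by
  congr 1
  ext t
  rw [conj_whFun]
  ring

/-- The `n`-th term of the integrand in Walnut's representation. -/
noncomputable def walnutTerm (a b : ℝ) (g f h : ℝ → ℂ) (n : ℤ) (t : ℝ) : ℂ :=
  (∑' k : ℤ, f (t - k * b⁻¹) * conj (g (t - k * b⁻¹ - n * a))) * conj (h t * conj (g (t - n * a)))

/-- On a bounded range of `t` only finitely many shifts `k` meet the support of `f`, and the same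
finite set serves every `n`. This is what permits exchanging the sums over `k` and `n`. -/
theorem walnutTerm_eq {f h : ℝ → ℂ} {M : ℝ≥0} {R : ℝ} (hb : 0 < b) (hf : BddSupp f M R)
    {t : ℝ} (ht : |t| ≤ R) (n : ℤ) :
    walnutTerm a b g f h n t = ∑ k ∈ meetSet b⁻¹ (R + R),
      f (t - k * b⁻¹) * conj (h t) * (g (t - n * a) * conj (g (t - n * a - k / b))) := by
  rw [walnutTerm, tsum_eq_sum (s := meetSet b⁻¹ (R + R)), Finset.sum_mul]
  · refine Finset.sum_congr rfl fun k _ => ?_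
    rw [map_mul, Complex.conj_conj, show t - n * a - k / b = t - k * b⁻¹ - n * a by ring]
    ring
  · intro k hk
    rw [eq_zero_of_notMem_meetSet_add (inv_pos.2 hb) hf.supp ht hk, zero_mul]

theorem walnutTerm_eq_zero {f h : ℝ → ℂ} {M : ℝ≥0} {R : ℝ} (hh : BddSupp h M R)
    {t : ℝ} (ht : R < |t|) (n : ℤ) : walnutTerm a b g f h n t = 0 := by
  rw [walnutTerm, hh.supp t ht, zero_mul, map_zero, mul_zero]

theorem measurable_walnutTerm {f h : ℝ → ℂ} (hf : Measurable f) (hh : Measurable h)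
    (hgm : Measurable g) (n : ℤ) : Measurable (walnutTerm a b g f h n) := by
  have h1 : Measurable fun t : ℝ => g (t - n * a) := hgm.comp (measurable_sub_const _)
  refine Measurable.mul (Measurable.tsum fun k => ?_)
    (Complex.continuous_conj.measurable.comp (hh.mul (Complex.continuous_conj.measurable.comp h1)))
  exact (hf.comp (measurable_sub_const _)).mul (Complex.continuous_conj.measurable.comp
    (h1.comp (measurable_sub_const _)))

/-- With finitely many `k` and bounded `f` and `h`, the products of values of `g` are dominated by
sums of squares, and `∑ₙ |g(t - na)|²` is locally integrable because `g` is square integrable. -/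
theorem tsum_lintegral_walnutTerm_lt_top {f h : ℝ → ℂ} {M : ℝ≥0} {R : ℝ} (ha : 0 < a) (hb : 0 < b)
    (hg : MemLp g 2) (hgm : Measurable g) (hf : BddSupp f M R) (hh : BddSupp h M R) :
    ∑' n : ℤ, ∫⁻ t, ‖walnutTerm a b g f h n t‖ₑ < ∞ := by
  rw [← lintegral_tsum fun n => (measurable_walnutTerm hf.meas hh.meas hgm n).enorm.aemeasurable]
  have key : ∀ t, ∑' n : ℤ, ‖walnutTerm a b g f h n t‖ₑ ≤ (Set.Icc (-R) R).indicator (fun t =>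
      ∑ k ∈ meetSet b⁻¹ (R + R), (M * M : ℝ≥0∞) * (∑' n : ℤ, ‖g (t - n * a)‖ₑ ^ 2
        + ∑' n : ℤ, ‖g (t - n * a - k / b)‖ₑ ^ 2)) t := by
    intro t
    by_cases ht : |t| ≤ R
    · rw [Set.indicator_of_mem (Set.mem_Icc.2 (abs_le.1 ht))]
      simp only [walnutTerm_eq hb hf ht, ← ENNReal.tsum_add, ← ENNReal.tsum_mul_left]
      rw [← Summable.tsum_finsetSum fun _ _ => ENNReal.summable]
      refine ENNReal.tsum_le_tsum fun n => (enorm_sum_le _ _).trans (Finset.sum_le_sum fun k _ => ?_)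
      rw [enorm_mul, enorm_mul, enorm_mul, RCLike.enorm_conj, RCLike.enorm_conj]
      gcongr
      · exact hf.bdd _
      · exact hh.bdd _
      · exact ennreal_mul_le_sq_add_sq _ _
    · simp [walnutTerm_eq_zero hh (not_le.1 ht)]
  refine (lintegral_mono key).trans_lt ?_
  rw [lintegral_indicator measurableSet_Icc, lintegral_finsetSum']
  · refine ENNReal.sum_lt_top.2 fun k _ => ?_
    have hm : Measurable fun t => ‖g t‖ₑ ^ 2 := hgm.enorm.pow_const 2
    have hm' : Measurable fun t => ‖g (t - k / b)‖ₑ ^ 2 := hm.comp (measurable_sub_const _)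
    rw [lintegral_const_mul', lintegral_add_left]
    · refine ENNReal.mul_lt_top (ENNReal.mul_lt_top ENNReal.coe_lt_top ENNReal.coe_lt_top)
        (ENNReal.add_lt_top.2 ⟨?_, ?_⟩)
      · exact (setLIntegral_tsum_sub_le ha hm.aemeasurable _ _).trans_lt
          (ENNReal.mul_lt_top ENNReal.coe_lt_top (lintegral_enorm_sq_lt_top hg))
      · refine (setLIntegral_tsum_sub_le ha hm'.aemeasurable _ _).trans_lt
          (ENNReal.mul_lt_top ENNReal.coe_lt_top ?_)
        rw [lintegral_sub_right_eq_self (fun t => ‖g t‖ₑ ^ 2)]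
        exact lintegral_enorm_sq_lt_top hg
    · exact Measurable.tsum fun n => hm.comp (measurable_sub_const _)
    · exact ENNReal.mul_ne_top ENNReal.coe_ne_top ENNReal.coe_ne_top
  · intro k _
    refine AEMeasurable.const_mul (Measurable.aemeasurable ?_) _
    have hm : Measurable fun t => ‖g t‖ₑ ^ 2 := hgm.enorm.pow_const 2
    exact (Measurable.tsum fun n => hm.comp (measurable_sub_const _)).add
      (Measurable.tsum fun n => hm.comp ((measurable_sub_const _).sub_const _))

theorem tsum_walnutTerm_ae {f h : ℝ → ℂ} {M : ℝ≥0} {R : ℝ} (ha : 0 < a) (hb : 0 < b)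
    (hg : MemLp g 2) (hgm : Measurable g) (hf : BddSupp f M R) (hh : BddSupp h M R) :
    ∀ᵐ t : ℝ, ∑' n : ℤ, walnutTerm a b g f h n t
      = kerSum b⁻¹ (autoCorr a b g) f t * conj (h t) := by
  filter_upwards [ae_summable_autoCorr ha hg hgm b] with t hs
  by_cases ht : |t| ≤ R
  · simp only [walnutTerm_eq hb hf ht]
    rw [Summable.tsum_finsetSum fun k _ => (hs k).mul_left _, kerSum,
      tsum_eq_sum (s := meetSet b⁻¹ (R + R)), Finset.sum_mul]
    · refine Finset.sum_congr rfl fun k _ => ?_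
      rw [tsum_mul_left, autoCorr]
      ring
    · intro k hk
      rw [eq_zero_of_notMem_meetSet_add (inv_pos.2 hb) hf.supp ht hk, mul_zero]
  · simp [walnutTerm_eq_zero hh (not_le.1 ht), hh.supp t (not_le.1 ht)]

theorem hasSum_integral_walnutTerm {f h : ℝ → ℂ} {M : ℝ≥0} {R : ℝ} (ha : 0 < a) (hb : 0 < b)
    (hg : MemLp g 2) (hgm : Measurable g) (hf : BddSupp f M R) (hh : BddSupp h M R) :
    HasSum (fun n : ℤ => ∫ t, walnutTerm a b g f h n t)
      (∫ t, kerSum b⁻¹ (autoCorr a b g) f t * conj (h t)) := by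
  have hfin := tsum_lintegral_walnutTerm_lt_top ha hb hg hgm hf hh
  have hm := fun n => (measurable_walnutTerm (a := a) (b := b) hf.meas hh.meas hgm n)
  rw [← integral_congr_ae (tsum_walnutTerm_ae ha hb hg hgm hf hh)]
  refine hasSum_integral_of_summable_integral_norm (fun n => ?_) ?_
  · exact ⟨(hm n).aestronglyMeasurable, (ENNReal.le_tsum n).trans_lt hfin⟩
  · simp only [integral_norm_eq_lintegral_enorm (hm _).aestronglyMeasurable]
    exact ENNReal.summable_toReal hfin.ne

/-- Walnut's representation of the frame operator, in weak form. -/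
theorem hasSum_whFun_coeff {f h : ℝ → ℂ} {M : ℝ≥0} {R : ℝ} (ha : 0 < a) (hb : 0 < b)
    (hg : MemLp g 2) (hgm : Measurable g) (hf : BddSupp f M R) (hh : BddSupp h M R) :
    HasSum (fun i : ℤ × ℤ => (∫ t, f t * conj (whFun a b g i.1 i.2 t))
        * conj (∫ t, h t * conj (whFun a b g i.1 i.2 t)))
      ((b : ℂ)⁻¹ * ∫ t, kerSum b⁻¹ (autoCorr a b g) f t * conj (h t)) := by
  have hfib : ∀ {f h : ℝ → ℂ}, BddSupp f M R → BddSupp h M R → ∀ n : ℤ,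
      HasSum (fun m : ℤ => (∫ t, f t * conj (whFun a b g m n t))
        * conj (∫ t, h t * conj (whFun a b g m n t)))
      ((b : ℂ)⁻¹ * ∫ t, walnutTerm a b g f h n t) := by
    intro f h hf hh n
    simp only [integral_mul_conj_whFun]
    have := hasSum_integral_chr_mul_conj (inv_pos.2 hb) (R := R)
      (φ := fun t => f t * conj (g (t - n * a))) (ψ := fun t => h t * conj (g (t - n * a)))
      (fun t ht => by simp [hf.supp t ht]) (hf.memLp_mul_conj hg _)
      (fun t ht => by simp [hh.supp t ht]) (hh.memLp_mul_conj hg _)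
    rw [Complex.ofReal_inv] at this
    exact this
  -- On the diagonal the terms are nonnegative, so summability of the iterated sums gives
  -- summability over pairs. The off-diagonal case follows from `xy ≤ x² + y²`; only then may the
  -- iterated sum be read as an unconditional one.
  have hsq : ∀ {f : ℝ → ℂ}, BddSupp f M R → Summable fun i : ℤ × ℤ =>
      ‖∫ t, f t * conj (whFun a b g i.2 i.1 t)‖ ^ 2 := by
    intro f hf
    have e : ∀ n : ℤ, HasSum (fun m : ℤ => ‖∫ t, f t * conj (whFun a b g m n t)‖ ^ 2)
        ((b : ℂ)⁻¹ * ∫ t, walnutTerm a b g f f n t).re := fun n => by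
      have := Complex.hasSum_re (hfib hf hf n)
      simpa only [Complex.mul_conj, Complex.normSq_eq_norm_sq, Complex.ofReal_re] using this
    rw [summable_prod_of_nonneg fun _ => by positivity]
    refine ⟨fun n => (e n).summable, ?_⟩
    simp only [(e _).tsum_eq]
    exact (Complex.hasSum_re
      ((hasSum_integral_walnutTerm ha hb hg hgm hf hf).mul_left _)).summable
  have hsum : Summable fun i : ℤ × ℤ => (∫ t, f t * conj (whFun a b g i.2 i.1 t))
        * conj (∫ t, h t * conj (whFun a b g i.2 i.1 t)) := by
    refine Summable.of_norm_bounded ((hsq hf).add (hsq hh)) fun i => ?_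
    rw [norm_mul, RCLike.norm_conj]
    nlinarith [sq_nonneg (‖∫ t, f t * conj (whFun a b g i.2 i.1 t)‖
      - ‖∫ t, h t * conj (whFun a b g i.2 i.1 t)‖),
      sq_nonneg ‖∫ t, f t * conj (whFun a b g i.2 i.1 t)‖,
      sq_nonneg ‖∫ t, h t * conj (whFun a b g i.2 i.1 t)‖]
  have h1 := hsum.hasSum.prod_fiberwise fun n => hfib hf hh n
  have h2 := h1.unique ((hasSum_integral_walnutTerm ha hb hg hgm hf hh).mul_left _)
  rw [← (Equiv.prodComm ℤ ℤ).hasSum_iff, ← h2]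
  exact hsum.hasSum

end Walnut

/-! ### Bessel sequences and their frame operators -/

section Bessel

variable {ι H : Type*} [NormedAddCommGroup H] [InnerProductSpace ℂ H] {v : ι → H} {B : ℝ}

/-- `v` is a Bessel sequence with bound `B`. -/
def IsBessel (v : ι → H) (B : ℝ) : Prop :=
  ∀ (f : H) (F : Finset ι), ∑ i ∈ F, ‖inner ℂ (v i) f‖ ^ 2 ≤ B * ‖f‖ ^ 2

/-- The synthesis operator is the adjoint of the analysis operator: expand `‖y‖² = ⟨y, y⟩` for the
finite sum `y`, apply Cauchy–Schwarz and the Bessel bound at `y`, and cancel `‖y‖²`. -/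
theorem IsBessel.norm_sum_smul_sq_le (hB0 : 0 ≤ B) (hB : IsBessel v B)
    (c : ι → ℂ) (F : Finset ι) : ‖∑ i ∈ F, c i • v i‖ ^ 2 ≤ B * ∑ i ∈ F, ‖c i‖ ^ 2 := by
  obtain ⟨y, hy⟩ : ∃ y, y = ∑ i ∈ F, c i • v i := ⟨_, rfl⟩
  rw [← hy]
  have h1 : ‖y‖ ^ 2 ≤ ∑ i ∈ F, ‖c i‖ * ‖inner ℂ (v i) y‖ := by
    have h2 : inner ℂ y y = ∑ i ∈ F, conj (c i) * inner ℂ (v i) y := by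
      conv_lhs => arg 2; rw [hy]
      rw [sum_inner]
      simp only [inner_smul_left]
    have h3 : ‖y‖ ^ 2 = ‖inner ℂ y y‖ := by
      rw [inner_self_eq_norm_sq_to_K]; simp
    rw [h3, h2]
    refine (norm_sum_le _ _).trans (le_of_eq ?_)
    simp
  have h4 := Finset.sum_mul_sq_le_sq_mul_sq F (fun i => ‖c i‖) (fun i => ‖inner ℂ (v i) y‖)
  have h5 := hB y F
  have h6 : (0 : ℝ) ≤ ∑ i ∈ F, ‖c i‖ ^ 2 := Finset.sum_nonneg fun _ _ => by positivity
  rcases (norm_nonneg y).eq_or_lt with h0 | h0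
  · rw [← h0, zero_pow two_ne_zero]
    exact mul_nonneg hB0 h6
  · have h7 : (‖y‖ ^ 2) ^ 2 ≤ (∑ i ∈ F, ‖c i‖ ^ 2) * (B * ‖y‖ ^ 2) :=
      calc (‖y‖ ^ 2) ^ 2 ≤ (∑ i ∈ F, ‖c i‖ * ‖inner ℂ (v i) y‖) ^ 2 := by gcongr
        _ ≤ _ := h4.trans (by gcongr)
    have h8 : 0 < ‖y‖ ^ 2 := by positivity
    nlinarith

theorem IsBessel.norm_sum_inner_smul_le (hB0 : 0 ≤ B) (hB : IsBessel v B) (f : H) (F : Finset ι) :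
    ‖∑ i ∈ F, inner ℂ (v i) f • v i‖ ≤ B * ‖f‖ := by
  have h1 := hB.norm_sum_smul_sq_le hB0 (fun i => inner ℂ (v i) f) F
  have h2 : B * ∑ i ∈ F, ‖inner ℂ (v i) f‖ ^ 2 ≤ B * (B * ‖f‖ ^ 2) := by gcongr; exact hB f F
  refine le_of_sq_le_sq (b := B * ‖f‖) ?_ (by positivity)
  nlinarith

/-- The synthesis bound makes finite subsums small as soon as the tails of the square summable
coefficients are, so unconditional convergence follows from completeness. -/
theorem IsBessel.summable [CompleteSpace H] (hB0 : 0 ≤ B) (hB : IsBessel v B) (f : H) :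
    Summable fun i => (inner ℂ (v i) f : ℂ) • v i := by
  have hs : Summable fun i => ‖inner ℂ (v i) f‖ ^ 2 :=
    summable_of_sum_le (fun _ => by positivity) (hB f)
  rw [summable_iff_vanishing_norm] at hs ⊢
  intro ε hε
  obtain ⟨s, hs⟩ := hs (ε ^ 2 / (B + 1)) (by positivity)
  refine ⟨s, fun t ht => ?_⟩
  have h1 := hs t ht
  rw [Real.norm_of_nonneg (Finset.sum_nonneg fun _ _ => by positivity), lt_div_iff₀ (by positivity)] at h1
  have h2 := hB.norm_sum_smul_sq_le hB0 (fun i => inner ℂ (v i) f) t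
  have h3 : 0 ≤ ∑ i ∈ t, ‖inner ℂ (v i) f‖ ^ 2 := Finset.sum_nonneg fun _ _ => by positivity
  refine lt_of_pow_lt_pow_left₀ 2 hε.le ?_
  nlinarith

/-- The frame operator of a Bessel sequence. -/
theorem IsBessel.exists_frameOp [CompleteSpace H] (hB0 : 0 ≤ B) (hB : IsBessel v B) :
    ∃ S : H →L[ℂ] H, ∀ f, HasSum (fun i => (inner ℂ (v i) f : ℂ) • v i) (S f) := by
  refine ⟨LinearMap.mkContinuous
    { toFun := fun f => ∑' i, (inner ℂ (v i) f : ℂ) • v i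
      map_add' := fun f h => ?_
      map_smul' := fun c f => ?_ } B fun f => ?_, fun f => (hB.summable hB0 f).hasSum⟩
  · rw [← (hB.summable hB0 f).tsum_add (hB.summable hB0 h)]
    simp only [inner_add_right, add_smul]
  · rw [RingHom.id_apply, ← (hB.summable hB0 f).tsum_const_smul]
    simp only [inner_smul_right, mul_smul]
  · exact le_of_tendsto (hB.summable hB0 f).hasSum.norm
      (Eventually.of_forall fun F => hB.norm_sum_inner_smul_le hB0 f F)

theorem isBessel_of_dense {D : Set H} (hD : Dense D)
    (h : ∀ f ∈ D, ∀ F : Finset ι, ∑ i ∈ F, ‖inner ℂ (v i) f‖ ^ 2 ≤ B * ‖f‖ ^ 2) : IsBessel v B := by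
  intro f F
  refine hD.induction (P := fun f => ∑ i ∈ F, ‖inner ℂ (v i) f‖ ^ 2 ≤ B * ‖f‖ ^ 2)
    (fun f hf => h f hf F) ?_ f
  exact isClosed_le (by fun_prop) (by fun_prop)

end Bessel

/-! ### The CC-condition makes the frame operator a Schur operator -/

section FrameOperator

variable {a b : ℝ}

/-- The Hilbert space `L²(ℝ)`. -/
abbrev LTwo : Type := Lp ℂ 2 (volume : Measure ℝ)

variable {g : LTwo}

theorem measurable_coeFn (g : LTwo) : Measurable (g : ℝ → ℂ) := (Lp.stronglyMeasurable g).measurable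

theorem inner_eq_integral (u w : LTwo) : inner ℂ u w = ∫ t, w t * conj (u t) := by
  rw [L2.inner_def]
  simp only [RCLike.inner_apply]

theorem inner_whSystem {u : LTwo} {f : ℝ → ℂ} (huf : u =ᵐ[volume] f) (i : ℤ × ℤ) :
    inner ℂ (whSystem a b g i) u = ∫ t, f t * conj (whFun a b g i.1 i.2 t) := by
  rw [inner_eq_integral]
  refine integral_congr_ae ?_
  filter_upwards [huf, MemLp.coeFn_toLp (memLp_whFun a b (Lp.memLp g) i.1 i.2)] with t h1 h2
  rw [h1, whSystem, h2]

/-- The classes of bounded functions with bounded support. -/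
def bddSuppClasses : Set LTwo := {u | ∃ f M R, BddSupp f M R ∧ u =ᵐ[volume] f}

theorem dense_bddSuppClasses : Dense bddSuppClasses := by
  rw [Metric.dense_iff]
  intro u r hr
  obtain ⟨f, hf1, hf2, hf3, hf4⟩ := (Lp.memLp u).exists_hasCompactSupport_eLpNorm_sub_le
    (by simp) (ε := ENNReal.ofReal (r / 2)) (by simpa using hr)
  refine ⟨hf4.toLp, ?_, ?_⟩
  · rw [Metric.mem_ball, dist_comm, dist_eq_norm, Lp.norm_def]
    have h1 : eLpNorm (u - hf4.toLp : LTwo) 2 volume ≤ ENNReal.ofReal (r / 2) := by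
      refine le_trans (le_of_eq (eLpNorm_congr_ae ?_)) hf2
      filter_upwards [Lp.coeFn_sub u hf4.toLp, hf4.coeFn_toLp] with t h1 h2
      rw [h1, Pi.sub_apply, Pi.sub_apply, h2]
    calc _ ≤ (ENNReal.ofReal (r / 2)).toReal := ENNReal.toReal_mono ENNReal.ofReal_ne_top h1
      _ = r / 2 := ENNReal.toReal_ofReal (by positivity)
      _ < r := by linarith
  · obtain ⟨M, hM⟩ := hf3.norm.bddAbove_range_of_hasCompactSupport hf1.norm
    obtain ⟨R, hR⟩ := hf1.isCompact.isBounded.subset_closedBall 0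
    refine ⟨f, M.toNNReal, R, ⟨hf3.measurable, fun t => ?_, fun t ht => ?_⟩, hf4.coeFn_toLp⟩
    · rw [← ofReal_norm]
      exact ENNReal.ofReal_le_ofReal (hM ⟨t, rfl⟩)
    · by_contra hne
      have := hR (subset_tsupport f hne)
      rw [mem_closedBall_zero_iff, Real.norm_eq_abs] at this
      linarith

theorem BddSupp.mono {f : ℝ → ℂ} {M M' : ℝ≥0} {R R' : ℝ} (hf : BddSupp f M R) (hM : M ≤ M')
    (hR : R ≤ R') : BddSupp f M' R' :=
  ⟨hf.meas, fun t => (hf.bdd t).trans (by exact_mod_cast hM), fun t ht => hf.supp t (hR.trans_lt ht)⟩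

theorem hasSum_inner_whSystem (ha : 0 < a) (hb : 0 < b) {u w : LTwo} {f h : ℝ → ℂ} {M M' : ℝ≥0}
    {R R' : ℝ} (hf : BddSupp f M R) (hh : BddSupp h M' R') (hu : u =ᵐ[volume] f)
    (hw : w =ᵐ[volume] h) :
    HasSum (fun i => inner ℂ (whSystem a b g i) u * inner ℂ w (whSystem a b g i))
      ((b : ℂ)⁻¹ * ∫ t, kerSum b⁻¹ (autoCorr a b g) f t * conj (h t)) := by
  have h1 := hasSum_whFun_coeff ha hb (Lp.memLp g) (measurable_coeFn g)
    (hf.mono (le_max_left M M') (le_max_left R R')) (hh.mono (le_max_right M M') (le_max_right R R'))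
  convert! h1 using 1
  ext i
  rw [← inner_conj_symm w, inner_whSystem hu, inner_whSystem hw]

/-- The value of the frame operator is characterized by Walnut's representation. -/
theorem IsFrameOpValue.inner_eq (ha : 0 < a) (hb : 0 < b) {u v w : LTwo} {f h : ℝ → ℂ} {M M' : ℝ≥0}
    {R R' : ℝ} (hv : IsFrameOpValue a b g u v) (hf : BddSupp f M R) (hh : BddSupp h M' R')
    (hu : u =ᵐ[volume] f) (hw : w =ᵐ[volume] h) :
    inner ℂ w v = (b : ℂ)⁻¹ * ∫ t, kerSum b⁻¹ (autoCorr a b g) f t * conj (h t) := by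
  refine HasSum.unique ?_ (hasSum_inner_whSystem ha hb hf hh hu hw)
  have := hv.mapL (innerSL ℂ w)
  simpa only [innerSL_apply_apply, inner_smul_right] using this

/-- The two factors of each term change places after a shift by `k/b`. This symmetry turns row
bounds into column bounds and makes the fibre matrices hermitian. -/
theorem autoCorr_neg (g : ℝ → ℂ) (k : ℤ) (t : ℝ) :
    autoCorr a b g (-k) t = conj (autoCorr a b g k (t + k / b)) := by
  unfold autoCorr
  rw [Complex.conj_tsum]
  refine tsum_congr fun n => ?_
  rw [map_mul, Complex.conj_conj, mul_comm]
  congr 2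
  · push_cast; ring_nf
  · ring_nf

theorem CCCondition.isSchurKernel {g : ℝ → ℂ} (hgm : Measurable g) {B : ℝ}
    (hB : ∀ᵐ t : ℝ, ∑' k : ℤ, ‖autoCorr a b g k t‖ₑ ≤ ENNReal.ofReal B) :
    IsSchurKernel b⁻¹ (autoCorr a b g) B.toNNReal := by
  refine ⟨measurable_autoCorr hgm, hB, ?_⟩
  filter_upwards [hB] with t ht
  refine le_trans (le_of_eq ?_) ht
  rw [← (Equiv.neg ℤ).tsum_eq]
  refine tsum_congr fun k => ?_
  rw [Equiv.neg_apply, autoCorr_neg, RCLike.enorm_conj]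
  congr 2
  push_cast
  ring

/-- A kernel is the kernel of the frame operator times `b` on all of `L²`. -/
theorem IsSchurKernel.isFrameOpValue (ha : 0 < a) (hb : 0 < b) {C : ℝ≥0}
    (hG : IsSchurKernel b⁻¹ (autoCorr a b g) C) (u : LTwo) :
    IsFrameOpValue a b g u ((b : ℂ)⁻¹ • hG.toCLM 2 u) := by
  have key : ∀ {u w : LTwo} {f h : ℝ → ℂ} {M M' : ℝ≥0} {R R' : ℝ}, BddSupp f M R → BddSupp h M' R' →
      u =ᵐ[volume] f → w =ᵐ[volume] h →
      (b : ℂ)⁻¹ * ∫ t, kerSum b⁻¹ (autoCorr a b g) f t * conj (h t)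
        = inner ℂ w ((b : ℂ)⁻¹ • hG.toCLM 2 u) := by
    intro u w f h M M' R R' hf hh hu hw
    rw [inner_smul_right, inner_eq_integral]
    congr 1
    refine integral_congr_ae ?_
    filter_upwards [hG.toCLM_ae u, hw, kerSum_congr_ae (s := b⁻¹) (Γ := autoCorr a b g) hu]
      with t h1 h2 h3
    rw [h1, h2, h3]
  set T : LTwo →L[ℂ] LTwo := (b : ℂ)⁻¹ • hG.toCLM 2 with hT
  -- No Bessel bound is assumed. For bounded functions of bounded support Walnut's identity equates
  -- the sum of squared coefficients with `⟨u, T u⟩`, and density extends the resulting bound.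
  have hbes : IsBessel (whSystem a b g) ‖T‖ := by
    refine isBessel_of_dense dense_bddSuppClasses ?_
    rintro u ⟨f, M, R, hf, hu⟩ F
    have h1 := hasSum_inner_whSystem (g := g) ha hb hf hf hu hu
    rw [key hf hf hu hu] at h1
    have h2 := Complex.hasSum_re h1
    have h3 : ∀ i, (inner ℂ (whSystem a b g i) u * inner ℂ u (whSystem a b g i)).re
        = ‖inner ℂ (whSystem a b g i) u‖ ^ 2 := by
      intro i
      rw [← inner_conj_symm u, Complex.mul_conj, Complex.normSq_eq_norm_sq, Complex.ofReal_re]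
    simp only [h3] at h2
    calc ∑ i ∈ F, ‖inner ℂ (whSystem a b g i) u‖ ^ 2 ≤ (inner ℂ u (T u)).re :=
          sum_le_hasSum F (fun _ _ => by positivity) h2
      _ ≤ ‖inner ℂ u (T u)‖ := Complex.re_le_norm _
      _ ≤ ‖u‖ * ‖T u‖ := norm_inner_le_norm _ _
      _ ≤ ‖u‖ * (‖T‖ * ‖u‖) := by gcongr; exact T.le_opNorm u
      _ = ‖T‖ * ‖u‖ ^ 2 := by ring
  obtain ⟨S, hS⟩ := hbes.exists_frameOp (norm_nonneg T)
  -- `S` and `T` have the same matrix elements on a dense set, and both are continuous.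
  have hST : S = T := by
    refine ContinuousLinearMap.ext fun u => ?_
    refine congr_fun (Continuous.ext_on dense_bddSuppClasses S.continuous T.continuous ?_) u
    rintro u ⟨f, M, R, hf, hu⟩
    refine dense_bddSuppClasses.eq_of_inner_right (𝕜 := ℂ) ?_
    rintro w ⟨h, M', R', hh, hw⟩
    rw [IsFrameOpValue.inner_eq ha hb (hS u) hf hh hu hw, key hf hh hu hw]
    rfl
  have h1 := hS u
  rw [hST] at h1
  exact h1

/-- The operators for different exponents are given by one pointwise formula, so they agree on
classes lying in both `L^p` and `L²`. -/
theorem IsSchurKernel.extendsFrameOp (ha : 0 < a) (hb : 0 < b) {C : ℝ≥0}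
    (hG : IsSchurKernel b⁻¹ (autoCorr a b g) C) (p : ℝ≥0∞) [Fact (1 ≤ p)]
    {f : Lp ℂ p (volume : Measure ℝ)} {u : LTwo} (hfu : f =ᵐ[volume] u) :
    ∃ v : LTwo, IsFrameOpValue a b g u v ∧ ((b : ℂ)⁻¹ • hG.toCLM p f : Lp ℂ p volume) =ᵐ[volume] v := by
  refine ⟨_, hG.isFrameOpValue ha hb u, ?_⟩
  filter_upwards [hG.toCLM_ae f, hG.toCLM_ae u, Lp.coeFn_smul (b : ℂ)⁻¹ (hG.toCLM p f),
    Lp.coeFn_smul (b : ℂ)⁻¹ (hG.toCLM 2 u), kerSum_congr_ae (s := b⁻¹) (Γ := autoCorr a b g) hfu]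
    with t h1 h2 h3 h4 h5
  rw [h3, h4, Pi.smul_apply, Pi.smul_apply, h1, h2, h5]

end FrameOperator

/-! ### Test functions with independently prescribed values along a fibre -/

section Spread

variable {s : ℝ}

/-- The function that equals `ψ k t` at `t - k s` when `t` lies in the `J`-th cell
`((J - 1) s, J s]`. -/
noncomputable def spread (s : ℝ) (J : ℤ) (ψ : ℤ → ℝ → ℂ) (x : ℝ) : ℂ :=
  ψ (J - ⌈x / s⌉) (x + (J - ⌈x / s⌉ : ℤ) * s)

theorem ceil_sub_mul_div (hs : 0 < s) (t : ℝ) (k : ℤ) : ⌈(t - k * s) / s⌉ = ⌈t / s⌉ - k := by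
  rw [sub_div, mul_div_cancel_right₀ _ hs.ne', Int.ceil_sub_intCast]

/-- For `t` in the `J`-th cell the points `t - k s` lie in distinct cells, one for each `k`; so a
single function can carry an arbitrary measurable family `ψ k t`. -/
theorem spread_sub (hs : 0 < s) {J : ℤ} (ψ : ℤ → ℝ → ℂ) {t : ℝ} (ht : ⌈t / s⌉ = J) (k : ℤ) :
    spread s J ψ (t - k * s) = ψ k t := by
  rw [spread, ceil_sub_mul_div hs, ht]
  simp

theorem measurable_spread (s : ℝ) (J : ℤ) {ψ : ℤ → ℝ → ℂ} (hψ : ∀ k, Measurable (ψ k)) :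
    Measurable (spread s J ψ) := by
  have h1 : Measurable fun q : ℤ × ℝ => ψ (J - q.1) (q.2 + (J - q.1 : ℤ) * s) :=
    measurable_from_prod_countable_right fun k =>
      (hψ (J - k)).comp (measurable_add_const (((J - k : ℤ) : ℝ) * s))
  have h2 : Measurable fun x : ℝ => ((⌈x / s⌉, x) : ℤ × ℝ) :=
    (Int.measurable_ceil.comp (measurable_id.div_const s)).prodMk measurable_id
  exact h1.comp h2

theorem bddSupp_spread (hs : 0 < s) (J : ℤ) {ψ : ℤ → ℝ → ℂ} (hψ : ∀ k, Measurable (ψ k)) {M : ℝ≥0}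
    (hM : ∀ k t, ‖ψ k t‖ₑ ≤ M) (F : Finset ℤ) (hF : ∀ k ∉ F, ∀ t, ψ k t = 0) :
    ∃ R, BddSupp (spread s J ψ) M R := by
  obtain ⟨K, hK⟩ : ∃ K : ℕ, ∀ k ∈ F, |k| ≤ K := by
    refine ⟨∑ k ∈ F, k.natAbs, fun k hk => ?_⟩
    rw [Int.abs_eq_natAbs]
    exact_mod_cast Finset.single_le_sum (f := fun k : ℤ => k.natAbs) (fun _ _ => Nat.zero_le _) hk
  refine ⟨(K + |J| + 1) * s, measurable_spread s J hψ, fun t => hM _ _, fun t ht => ?_⟩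
  refine hF _ (fun hmem => ?_) _
  have h1 := abs_le.1 (hK _ hmem)
  have h2 : (-(K : ℝ)) ≤ J - ⌈t / s⌉ := by exact_mod_cast h1.1
  have h3 : ((J - ⌈t / s⌉ : ℤ) : ℝ) ≤ K := by exact_mod_cast h1.2
  push_cast at h3
  have h4 := Int.le_ceil (t / s)
  have h5 := Int.ceil_lt_add_one (t / s)
  have h6 := le_abs_self (J : ℝ)
  have h7 := neg_abs_le (J : ℝ)
  have h8 : |t / s| ≤ K + |J| + 1 := by
    rw [abs_le]; push_cast; constructor <;> linarith
  rw [abs_div, abs_of_pos hs, div_le_iff₀ hs] at h8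
  linarith

end Spread

/-! ### Boundedness on `L_0^∞` forces the CC-condition -/

section Necessity

variable {a b : ℝ} {g : LTwo}

theorem integrable_kerSum_mul_conj (ha : 0 < a) (hb : 0 < b) {g : ℝ → ℂ} (hg : MemLp g 2)
    (hgm : Measurable g) {f h : ℝ → ℂ} {M M' : ℝ≥0} {R R' : ℝ} (hf : BddSupp f M R)
    (hh : BddSupp h M' R') :
    Integrable fun t => kerSum b⁻¹ (autoCorr a b g) f t * conj (h t) := by
  replace hf := hf.mono (le_max_left M M') (le_max_left R R')
  replace hh := hh.mono (le_max_right M M') (le_max_right R R')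
  refine Integrable.congr ?_ (tsum_walnutTerm_ae ha hb hg hgm hf hh)
  have hm := fun n => measurable_walnutTerm (a := a) (b := b) hf.meas hh.meas hgm n
  refine ⟨(Measurable.tsum hm).aestronglyMeasurable, ?_⟩
  refine lt_of_le_of_lt (lintegral_mono fun t => enorm_tsum_le _) ?_
  rw [lintegral_tsum fun n => (hm n).enorm.aemeasurable]
  exact tsum_lintegral_walnutTerm_lt_top ha hb hg hgm hf hh

theorem BddSupp.toLp_mem {f : ℝ → ℂ} {M : ℝ≥0} {R : ℝ} (hf : BddSupp f M R) :
    (hf.memLp ∞).toLp ∈ LInftyZero := by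
  refine subset_closure ⟨Set.Icc (-R) R, isCompact_Icc, ?_⟩
  filter_upwards [(hf.memLp ∞).coeFn_toLp] with t h1 h2
  rw [h1]
  refine hf.supp t ?_
  by_contra hcon
  exact h2 (abs_le.1 (not_lt.1 hcon))

theorem BddSupp.norm_toLp_le {f : ℝ → ℂ} {M : ℝ≥0} {R : ℝ} (hf : BddSupp f M R) :
    ‖(hf.memLp ∞).toLp‖ ≤ M := by
  rw [Lp.norm_toLp, ← ENNReal.coe_toReal]
  refine ENNReal.toReal_mono ENNReal.coe_ne_top ?_
  rw [eLpNorm_exponent_top]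
  exact eLpNormEssSup_le_of_ae_enorm_bound (ae_of_all _ hf.bdd)

/-- The `L²` value of the frame operator at `f` coincides almost everywhere with `T f`, so it
inherits the `L^∞` bound. Pairing it with `h` gives an estimate in which `T` enters only through its
norm. -/
theorem norm_integral_kerSum_le (ha : 0 < a) (hb : 0 < b)
    {T : LInftyZero →L[ℂ] Lp ℂ ∞ (volume : Measure ℝ)} (hT : ExtendsFrameOp a b g Subtype.val T)
    {f h : ℝ → ℂ} {M M' : ℝ≥0} {R R' : ℝ} (hf : BddSupp f M R) (hh : BddSupp h M' R') :
    ‖∫ t, kerSum b⁻¹ (autoCorr a b g) f t * conj (h t)‖ ≤ b * (‖T‖ * M) * ∫ t, ‖h t‖ := by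
  obtain ⟨v, hv, hTv⟩ := hT ⟨_, hf.toLp_mem⟩ (hf.memLp 2).toLp
    ((hf.memLp ∞).coeFn_toLp.trans (hf.memLp 2).coeFn_toLp.symm)
  have h1 := hv.inner_eq ha hb hf hh (hf.memLp 2).coeFn_toLp (hh.memLp 2).coeFn_toLp
  have hb' : (b : ℂ) ≠ 0 := by exact_mod_cast hb.ne'
  have h2 : ∫ t, kerSum b⁻¹ (autoCorr a b g) f t * conj (h t) = b * ∫ t, v t * conj (h t) := by
    rw [eq_inv_mul_iff_mul_eq₀ hb'] at h1
    rw [← h1, inner_eq_integral]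
    congr 1
    refine integral_congr_ae ?_
    filter_upwards [(hh.memLp 2).coeFn_toLp] with t ht
    rw [ht]
  have h3 : ∀ᵐ t : ℝ, ‖v t‖ ≤ ‖T‖ * M := by
    have h4 := T.le_opNorm ⟨_, hf.toLp_mem⟩
    have h5 : ‖T ⟨_, hf.toLp_mem⟩‖ ≤ ‖T‖ * M := h4.trans (by gcongr; exact hf.norm_toLp_le)
    filter_upwards [hTv, enorm_ae_le_eLpNormEssSup (T ⟨_, hf.toLp_mem⟩) volume] with t h6 h7
    rw [← h6]
    refine le_trans ?_ h5
    rw [Lp.norm_def, eLpNorm_exponent_top, ← toReal_enorm]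
    refine ENNReal.toReal_mono ?_ h7
    rw [← eLpNorm_exponent_top]
    exact Lp.eLpNorm_ne_top _
  rw [h2, norm_mul, Complex.norm_real, Real.norm_of_nonneg hb.le, mul_assoc]
  gcongr
  rw [← integral_const_mul]
  refine norm_integral_le_of_norm_le ?_ ?_
  · exact ((memLp_one_iff_integrable.1 (hh.memLp 1)).norm).const_mul _
  · filter_upwards [h3] with t ht
    rw [norm_mul, RCLike.norm_conj]
    gcongr

/-- The unimodular factor turning a complex number into its absolute value. -/
noncomputable def unimod (z : ℂ) : ℂ := conj z / ‖z‖

theorem mul_unimod (z : ℂ) : z * unimod z = ‖z‖ := by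
  rcases eq_or_ne z 0 with rfl | hz
  · simp [unimod]
  · have : (‖z‖ : ℂ) ≠ 0 := by simpa using hz
    rw [unimod, mul_div_assoc', Complex.mul_conj, Complex.normSq_eq_norm_sq, div_eq_iff this]
    push_cast
    ring

theorem enorm_unimod_le (z : ℂ) : ‖unimod z‖ₑ ≤ (1 : ℝ≥0) := by
  rw [← ofReal_norm, ENNReal.coe_one]
  refine ENNReal.ofReal_le_one.2 ?_
  rw [unimod, norm_div, RCLike.norm_conj, Complex.norm_real, norm_norm]
  exact div_self_le_one _

theorem measurable_unimod : Measurable unimod :=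
  Complex.continuous_conj.measurable.div (Complex.continuous_ofReal.measurable.comp measurable_norm)

theorem ae_of_forall_cell {s : ℝ} {q : ℝ → Prop} (h : ∀ J : ℤ, ∀ᵐ t : ℝ, ⌈t / s⌉ = J → q t) :
    ∀ᵐ t : ℝ, q t := by
  filter_upwards [ae_all_iff.2 h] with t ht using ht _ rfl

theorem measurableSet_cell (s : ℝ) (J : ℤ) : MeasurableSet {t : ℝ | ⌈t / s⌉ = J} :=
  (Int.measurable_ceil.comp (measurable_id.div_const s)) (measurableSet_singleton J)

/-- Testing on a function of sup norm at most one that carries the phases of `G_k(t)`, `k ∈ F`,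
along the fibre turns the kernel sum into `∑ |G_k(t)|`. Pairing with indicators of arbitrary sets
localizes the bound. -/
theorem ae_sum_norm_autoCorr_le (ha : 0 < a) (hb : 0 < b)
    {T : LInftyZero →L[ℂ] Lp ℂ ∞ (volume : Measure ℝ)} (hT : ExtendsFrameOp a b g Subtype.val T)
    (F : Finset ℤ) : ∀ᵐ t : ℝ, ∑ k ∈ F, ‖autoCorr a b g k t‖ₑ ≤ ENNReal.ofReal (b * ‖T‖) := by
  have hs : 0 < b⁻¹ := inv_pos.2 hb
  have hG := measurable_autoCorr (a := a) (b := b) (measurable_coeFn g)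
  -- Within a single cell the phases for different `k` are placed on disjoint cells and do not
  -- interfere.
  refine ae_of_forall_cell (s := b⁻¹) fun J => ?_
  refine (ae_restrict_iff' (measurableSet_cell b⁻¹ J)).1 ?_
  refine ae_le_of_forall_setLIntegral_le_of_sigmaFinite
    (Finset.measurable_fun_sum _ fun k _ => (hG k).enorm) fun E hE _ => ?_
  rw [Measure.restrict_restrict hE, setLIntegral_const]
  set E' := E ∩ {t : ℝ | ⌈t / b⁻¹⌉ = J} with hE'
  have hE'm : MeasurableSet E' := hE.inter (measurableSet_cell b⁻¹ J)
  obtain ⟨R, hf⟩ := bddSupp_spread hs J (M := 1)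
    (ψ := fun k t => if k ∈ F then unimod (autoCorr a b g k t) else 0)
    (fun k => by split_ifs; exacts [measurable_unimod.comp (hG k), measurable_const])
    (fun k t => by split_ifs; exacts [enorm_unimod_le _, by simp]) F
    (fun k hk t => by simp [hk])
  -- Keeping only the index `0` makes this spread the indicator of the part of `E` in the cell.
  obtain ⟨R', hh⟩ := bddSupp_spread hs J (M := 1)
    (ψ := fun k t => if k = 0 then E.indicator (fun _ => (1 : ℂ)) t else 0)
    (fun k => by split_ifs; exacts [measurable_const.indicator hE, measurable_const])
    (fun k t => by
      split_ifs
      · by_cases ht : t ∈ E <;> simp [ht]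
      · simp) {0}
    (fun k hk t => by simp [Finset.mem_singleton.not.1 hk])
  have hheq : spread b⁻¹ J (fun k t => if k = 0 then E.indicator (fun _ => (1 : ℂ)) t else 0)
      = E'.indicator fun _ => 1 := by
    ext t
    by_cases ht : ⌈t / b⁻¹⌉ = J
    · have := spread_sub hs (fun k t => if k = 0 then E.indicator (fun _ => (1 : ℂ)) t else 0) ht 0
      simp only [Int.cast_zero, zero_mul, sub_zero, if_true] at this
      rw [this]
      by_cases htE : t ∈ E
      · rw [Set.indicator_of_mem htE, Set.indicator_of_mem (show t ∈ E' from ⟨htE, ht⟩)]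
      · rw [Set.indicator_of_notMem htE, Set.indicator_of_notMem fun h => htE h.1]
    · have : J - ⌈t / b⁻¹⌉ ≠ 0 := fun h => ht (by omega)
      rw [spread, if_neg this, Set.indicator_of_notMem fun h => ht h.2]
  rw [hheq] at hh
  set f := spread b⁻¹ J (fun k t => if k ∈ F then unimod (autoCorr a b g k t) else 0) with hfdef
  have hker : ∀ t, kerSum b⁻¹ (autoCorr a b g) f t * conj (E'.indicator (fun _ => (1 : ℂ)) t)
      = ((E'.indicator (fun t => ∑ k ∈ F, ‖autoCorr a b g k t‖) t : ℝ) : ℂ) := by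
    intro t
    by_cases ht : t ∈ E'
    · rw [Set.indicator_of_mem ht, Set.indicator_of_mem ht, map_one, mul_one, kerSum,
        tsum_eq_sum (s := F)]
      · push_cast
        refine Finset.sum_congr rfl fun k hk => ?_
        rw [hfdef, spread_sub hs _ ht.2, if_pos hk, mul_unimod]
      · intro k hk
        rw [hfdef, spread_sub hs _ ht.2, if_neg hk, mul_zero]
    · simp [ht]
  have hint := integrable_kerSum_mul_conj ha hb (Lp.memLp g) (measurable_coeFn g) hf hh
  have hle := norm_integral_kerSum_le ha hb hT hf hh
  simp only [hker] at hint hle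
  rw [integral_complex_ofReal, Complex.norm_real, integral_indicator hE'm] at hle
  have hint' : IntegrableOn (fun t => ∑ k ∈ F, ‖autoCorr a b g k t‖) E' := by
    rw [← integrable_indicator_iff hE'm]
    exact hint.re.congr (ae_of_all _ fun t => Complex.ofReal_re _)
  have hvol : volume E' ≠ ∞ := by
    have := (hh.memLp 1).2.ne
    rw [eLpNorm_indicator_const hE'm one_ne_zero ENNReal.one_ne_top] at this
    simpa using this
  have e1 : ∫⁻ t in E', ∑ k ∈ F, ‖autoCorr a b g k t‖ₑ
      = ENNReal.ofReal (∫ t in E', ∑ k ∈ F, ‖autoCorr a b g k t‖) := by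
    rw [ofReal_integral_eq_lintegral_ofReal hint'
      (ae_of_all _ fun t => Finset.sum_nonneg fun _ _ => norm_nonneg _)]
    refine lintegral_congr fun t => ?_
    rw [ENNReal.ofReal_sum_of_nonneg fun _ _ => norm_nonneg _]
    simp
  have e2 : ∫ t, ‖E'.indicator (fun _ => (1 : ℂ)) t‖ = volume.real E' := by
    simp_rw [norm_indicator_eq_indicator_norm]
    rw [integral_indicator hE'm]
    simp
  rw [e1, ← ENNReal.ofReal_toReal hvol, ← ENNReal.ofReal_mul (by positivity)]
  refine ENNReal.ofReal_le_ofReal ?_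
  calc _ ≤ _ := Real.le_norm_self _
    _ ≤ _ := hle
    _ = _ := by rw [e2]; simp [Measure.real]

/-- Boundedness of the frame operator from `L_0^∞` to `L^∞` implies the CC-condition. -/
theorem ccCondition_of_extends (ha : 0 < a) (hb : 0 < b)
    {T : LInftyZero →L[ℂ] Lp ℂ ∞ (volume : Measure ℝ)}
    (hT : ExtendsFrameOp a b g Subtype.val T) : CCCondition a b g := by
  -- The summand `1` only ensures that the constant is positive when `T = 0`.
  refine ⟨b * ‖T‖ + 1, by positivity, ?_⟩
  filter_upwards [ae_all_iff.2 (ae_sum_norm_autoCorr_le ha hb hT)] with t ht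
  rw [ENNReal.tsum_eq_iSup_sum]
  exact iSup_le fun F => (ht F).trans (ENNReal.ofReal_le_ofReal (by linarith))

end Necessity

/-! ### Frame bounds on the fibre matrices -/

/-- The sesquilinear form of the matrix `(Γ (i - j) (t - j s))_{j, i}`, restricted to `F`. -/
noncomputable def gramForm (s : ℝ) (Γ : ℤ → ℝ → ℂ) (t : ℝ) (F : Finset ℤ) (c : ℤ → ℂ) : ℂ :=
  ∑ j ∈ F, ∑ i ∈ F, conj (c j) * Γ (i - j) (t - j * s) * c i

/-- Moving `t` along its fibre only relabels rows and columns, so bounds proved for one cell hold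
for every `t`. -/
theorem gramForm_shift (s : ℝ) (Γ : ℤ → ℝ → ℂ) (t : ℝ) (F : Finset ℤ) (c : ℤ → ℂ) (m : ℤ) :
    gramForm s Γ (t - m * s) (F.map (Equiv.subRight m).toEmbedding) (fun k => c (k + m))
      = gramForm s Γ t F c := by
  simp only [gramForm, Finset.sum_map, Equiv.coe_toEmbedding, Equiv.subRight_apply,
    sub_add_cancel, sub_sub_sub_cancel_right, Int.cast_sub]
  refine Finset.sum_congr rfl fun j _ => Finset.sum_congr rfl fun i _ => ?_
  rw [show t - m * s - (j - m) * s = t - j * s by ring]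

section Fiber

variable {s : ℝ}

theorem ceil_div_eq_one_iff (hs : 0 < s) (t : ℝ) : ⌈t / s⌉ = 1 ↔ t ∈ Set.Ioc 0 s := by
  rw [Int.ceil_eq_iff, Set.mem_Ioc]
  simp [hs, div_pos_iff_of_pos_right, div_le_one hs]

theorem integral_eq_sum_of_cell (hs : 0 < s) {Φ : ℝ → ℂ} (hΦ : Integrable Φ) {Ψ : ℤ → ℝ → ℂ}
    (F : Finset ℤ) (h1 : ∀ k : ℤ, ∀ t ∈ Set.Ioc 0 s, Φ (t - k * s) = if k ∈ F then Ψ k t else 0) :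
    ∫ t, Φ t = ∑ k ∈ F, ∫ t in Set.Ioc 0 s, Ψ k t := by
  rw [← (hasSum_integral_Ioc_sub hs hΦ).tsum_eq, tsum_eq_sum (s := F)]
  · refine Finset.sum_congr rfl fun k hk => setIntegral_congr_fun measurableSet_Ioc fun t ht => ?_
    simp only [h1 k t ht, if_pos hk]
  · intro k hk
    rw [← integral_zero (μ := volume.restrict (Set.Ioc 0 s)) (α := ℝ) (G := ℂ)]
    refine setIntegral_congr_fun measurableSet_Ioc fun t ht => ?_
    simp only [h1 k t ht, if_neg hk]

/-- The step function on `E ⊆ (0, s]` repeated with the coefficients `c`. -/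
noncomputable def stepFun (s : ℝ) (F : Finset ℤ) (c : ℤ → ℂ) (E : Set ℝ) : ℝ → ℂ :=
  spread s 1 fun k t => if k ∈ F then E.indicator (fun _ => c k) t else 0

theorem stepFun_sub (hs : 0 < s) (F : Finset ℤ) (c : ℤ → ℂ) (E : Set ℝ) {t : ℝ}
    (ht : t ∈ Set.Ioc 0 s) (k : ℤ) :
    stepFun s F c E (t - k * s) = if k ∈ F then E.indicator (fun _ => c k) t else 0 :=
  spread_sub hs _ ((ceil_div_eq_one_iff hs t).2 ht) k

theorem bddSupp_stepFun (hs : 0 < s) (F : Finset ℤ) (c : ℤ → ℂ) {E : Set ℝ}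
    (hE : MeasurableSet E) : ∃ M R, BddSupp (stepFun s F c E) M R := by
  refine ⟨∑ k ∈ F, ‖c k‖₊, bddSupp_spread hs 1 (fun k => ?_) (fun k t => ?_) F
    (fun k hk t => by simp [hk])⟩
  · split_ifs
    exacts [measurable_const.indicator hE, measurable_const]
  · split_ifs with hk
    · refine (enorm_indicator_le_enorm_self _ _).trans ?_
      rw [enorm_eq_nnnorm]
      exact_mod_cast Finset.single_le_sum (f := fun k => ‖c k‖₊) (fun _ _ => zero_le) hk
    · simp

theorem integral_stepFun_mul_conj (hs : 0 < s) (F : Finset ℤ) (c : ℤ → ℂ) {E : Set ℝ}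
    (hE : MeasurableSet E) (hE' : E ⊆ Set.Ioc 0 s) :
    ∫ t, stepFun s F c E t * conj (stepFun s F c E t)
      = ((volume.real E * ∑ k ∈ F, ‖c k‖ ^ 2 : ℝ) : ℂ) := by
  obtain ⟨M, R, hf⟩ := bddSupp_stepFun hs F c hE
  have hint : Integrable fun t => stepFun s F c E t * conj (stepFun s F c E t) :=
    (hf.memLp 2).integrable_mul (q := 2) (hf.memLp 2).star
  rw [integral_eq_sum_of_cell hs (Ψ := fun k t => E.indicator (fun _ => c k * conj (c k)) t) hint F]
  · push_cast
    rw [Finset.mul_sum]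
    refine Finset.sum_congr rfl fun k _ => ?_
    rw [setIntegral_indicator hE, Set.inter_eq_self_of_subset_right hE', setIntegral_const,
      Complex.mul_conj, Complex.normSq_eq_norm_sq]
    simp
  · intro k t ht
    rw [stepFun_sub hs F c E ht]
    by_cases hk : k ∈ F <;> by_cases h : t ∈ E <;> simp [hk, h]

variable {a b : ℝ} {g : LTwo}

/-- Along a fibre through `E` the step function is the finite vector `c`, on which the kernel acts
as the matrix with entries `Γ (i - j) (t - j s)`. -/
theorem kerSum_stepFun_sub (hs : 0 < s) (Γ : ℤ → ℝ → ℂ) (F : Finset ℤ) (c : ℤ → ℂ) {E : Set ℝ}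
    {t : ℝ} (ht : t ∈ Set.Ioc 0 s) (j : ℤ) :
    kerSum s Γ (stepFun s F c E) (t - j * s)
      = E.indicator (fun t => ∑ i ∈ F, Γ (i - j) (t - j * s) * c i) t := by
  rw [kerSum, ← (Equiv.subRight j).tsum_eq, tsum_eq_sum (s := F)]
  · by_cases h : t ∈ E
    · rw [Set.indicator_of_mem h]
      refine Finset.sum_congr rfl fun i hi => ?_
      rw [Equiv.subRight_apply, show t - j * s - ((i - j : ℤ) : ℝ) * s = t - i * s by push_cast; ring,
        stepFun_sub hs F c E ht, if_pos hi, Set.indicator_of_mem h]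
    · rw [Set.indicator_of_notMem h]
      refine Finset.sum_eq_zero fun i hi => ?_
      rw [Equiv.subRight_apply, show t - j * s - ((i - j : ℤ) : ℝ) * s = t - i * s by push_cast; ring,
        stepFun_sub hs F c E ht, if_pos hi, Set.indicator_of_notMem h, mul_zero]
  · intro i hi
    rw [Equiv.subRight_apply, show t - j * s - ((i - j : ℤ) : ℝ) * s = t - i * s by push_cast; ring,
      stepFun_sub hs F c E ht, if_neg hi, mul_zero]

theorem kerSum_stepFun_mul_conj (hs : 0 < s) (Γ : ℤ → ℝ → ℂ) (F : Finset ℤ) (c : ℤ → ℂ) {E : Set ℝ}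
    {t : ℝ} (ht : t ∈ Set.Ioc 0 s) (j : ℤ) :
    kerSum s Γ (stepFun s F c E) (t - j * s) * conj (stepFun s F c E (t - j * s))
      = if j ∈ F then E.indicator
        (fun t => ∑ i ∈ F, conj (c j) * Γ (i - j) (t - j * s) * c i) t else 0 := by
  rw [kerSum_stepFun_sub hs Γ F c ht, stepFun_sub hs F c E ht]
  by_cases hj : j ∈ F <;> by_cases h : t ∈ E <;> simp only [hj, h, if_true, if_false,
    Set.indicator_of_mem, Set.indicator_of_notMem, not_false_eq_true, map_zero, mul_zero]
  rw [Finset.sum_mul]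
  exact Finset.sum_congr rfl fun i _ => by ring

theorem integrableOn_gram_row (ha : 0 < a) (hb : 0 < b) (F : Finset ℤ) (c : ℤ → ℂ) {E : Set ℝ}
    (hE : MeasurableSet E) (hE' : E ⊆ Set.Ioc 0 b⁻¹) {j : ℤ} (hj : j ∈ F) :
    IntegrableOn (fun t => ∑ i ∈ F, conj (c j) * autoCorr a b g (i - j) (t - j * b⁻¹) * c i) E := by
  have hs : 0 < b⁻¹ := inv_pos.2 hb
  obtain ⟨M, R, hf⟩ := bddSupp_stepFun hs F c hE
  have h1 := integrable_kerSum_mul_conj ha hb (Lp.memLp g) (measurable_coeFn g) hf hf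
  have h2 := (h1.comp_sub_right (j * b⁻¹)).integrableOn (s := E)
  refine h2.congr_fun (fun t ht => ?_) hE
  simp only [kerSum_stepFun_mul_conj hs _ F c (hE' ht), if_pos hj, Set.indicator_of_mem ht]

theorem integral_kerSum_stepFun (ha : 0 < a) (hb : 0 < b) (F : Finset ℤ) (c : ℤ → ℂ) {E : Set ℝ}
    (hE : MeasurableSet E) (hE' : E ⊆ Set.Ioc 0 b⁻¹) :
    ∫ t, kerSum b⁻¹ (autoCorr a b g) (stepFun b⁻¹ F c E) t * conj (stepFun b⁻¹ F c E t)
      = ∫ t in E, gramForm b⁻¹ (autoCorr a b g) t F c := by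
  have hs : 0 < b⁻¹ := inv_pos.2 hb
  obtain ⟨M, R, hf⟩ := bddSupp_stepFun hs F c hE
  have hint := integrable_kerSum_mul_conj ha hb (Lp.memLp g) (measurable_coeFn g) hf hf
  rw [integral_eq_sum_of_cell hs hint F
    fun k t ht => kerSum_stepFun_mul_conj hs (autoCorr a b g) F c ht k]
  unfold gramForm
  rw [integral_finsetSum]
  · refine Finset.sum_congr rfl fun k _ => ?_
    rw [setIntegral_indicator hE, Set.inter_eq_self_of_subset_right hE']
  · exact fun j hj => integrableOn_gram_row ha hb F c hE hE' hj

theorem norm_sq_eq_of_ae {u : LTwo} {f : ℝ → ℂ} (hu : u =ᵐ[volume] f) :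
    ((‖u‖ ^ 2 : ℝ) : ℂ) = ∫ t, f t * conj (f t) := by
  have h1 := inner_self_eq_norm_sq_to_K (𝕜 := ℂ) u
  rw [inner_eq_integral] at h1
  push_cast
  rw [← show ((RCLike.ofReal ‖u‖ : ℂ)) = (‖u‖ : ℂ) from rfl, ← h1]
  refine integral_congr_ae ?_
  filter_upwards [hu] with t ht
  rw [ht]

/-- The frame bounds pass to almost every fibre. -/
theorem ae_gramForm_bounds_single (ha : 0 < a) (hb : 0 < b) {A B : ℝ}
    (hfr : ∀ f : LTwo, Summable (fun i => ‖inner ℂ (whSystem a b g i) f‖ ^ 2) ∧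
    A * ‖f‖ ^ 2 ≤ ∑' i, ‖inner ℂ (whSystem a b g i) f‖ ^ 2 ∧
    ∑' i, ‖inner ℂ (whSystem a b g i) f‖ ^ 2 ≤ B * ‖f‖ ^ 2) (F : Finset ℤ) (c : ℤ → ℂ) :
    ∀ᵐ t : ℝ, t ∈ Set.Ioc 0 b⁻¹ →
      b * A * ∑ k ∈ F, ‖c k‖ ^ 2 ≤ (gramForm b⁻¹ (autoCorr a b g) t F c).re ∧
      (gramForm b⁻¹ (autoCorr a b g) t F c).re ≤ b * B * ∑ k ∈ F, ‖c k‖ ^ 2 := by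
  have hs : 0 < b⁻¹ := inv_pos.2 hb
  set Q := ∑ k ∈ F, ‖c k‖ ^ 2 with hQ
  have hint : IntegrableOn (fun t => gramForm b⁻¹ (autoCorr a b g) t F c) (Set.Ioc 0 b⁻¹) :=
    integrable_finsetSum _ fun j hj =>
      integrableOn_gram_row ha hb F c measurableSet_Ioc subset_rfl hj
  -- The frame inequalities at the step function on `E` are integrated forms of the desired bounds,
  -- since its squared norm is the measure of `E` times `Q`. As `E` is arbitrary, they hold
  -- pointwise.
  have key : ∀ E : Set ℝ, MeasurableSet E → E ⊆ Set.Ioc 0 b⁻¹ →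
      b * A * Q * volume.real E ≤ ∫ t in E, (gramForm b⁻¹ (autoCorr a b g) t F c).re ∧
      ∫ t in E, (gramForm b⁻¹ (autoCorr a b g) t F c).re ≤ b * B * Q * volume.real E := by
    intro E hE hE'
    obtain ⟨M, R, hf⟩ := bddSupp_stepFun hs F c hE
    have hu := (hf.memLp 2).coeFn_toLp
    obtain ⟨-, h2, h3⟩ := hfr (hf.memLp 2).toLp
    have h4 := Complex.hasSum_re (hasSum_inner_whSystem (g := g) ha hb hf hf hu hu)
    have h5 : ∀ i, (inner ℂ (whSystem a b g i) (hf.memLp 2).toLp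
        * inner ℂ (hf.memLp 2).toLp (whSystem a b g i)).re
        = ‖inner ℂ (whSystem a b g i) (hf.memLp 2).toLp‖ ^ 2 := by
      intro i
      rw [← inner_conj_symm (hf.memLp 2).toLp, Complex.mul_conj, Complex.normSq_eq_norm_sq,
        Complex.ofReal_re]
    simp only [h5] at h4
    have h6 : ‖(hf.memLp 2).toLp‖ ^ 2 = volume.real E * Q := by
      have := norm_sq_eq_of_ae hu
      rw [integral_stepFun_mul_conj hs F c hE hE'] at this
      exact_mod_cast this
    have h7 : ((b : ℂ)⁻¹ * ∫ t, kerSum b⁻¹ (autoCorr a b g) (stepFun b⁻¹ F c E) t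
        * conj (stepFun b⁻¹ F c E t)).re
        = b⁻¹ * ∫ t in E, (gramForm b⁻¹ (autoCorr a b g) t F c).re := by
      rw [integral_kerSum_stepFun ha hb F c hE hE', ← Complex.ofReal_inv, Complex.re_ofReal_mul]
      congr 1
      exact (integral_re (hint.mono_set hE')).symm
    rw [h4.tsum_eq, h7, h6] at h2 h3
    rw [inv_mul_eq_div, le_div_iff₀ hb] at h2
    rw [inv_mul_eq_div, div_le_iff₀ hb] at h3
    constructor <;> nlinarith
  have hfin : volume (Set.Ioc 0 b⁻¹) ≠ ∞ := by simp
  have hc : ∀ r : ℝ, IntegrableOn (fun _ => r) (Set.Ioc 0 b⁻¹) :=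
    fun r => integrableOn_const hfin
  have hre : IntegrableOn (fun t => (gramForm b⁻¹ (autoCorr a b g) t F c).re) (Set.Ioc 0 b⁻¹) :=
    hint.re
  have hlow := ae_le_of_forall_setIntegral_le (hc (b * A * Q)) hre fun E hE _ => by
    rw [Measure.restrict_restrict hE, setIntegral_const, smul_eq_mul, mul_comm]
    exact (key _ (hE.inter measurableSet_Ioc) Set.inter_subset_right).1
  have hupp := ae_le_of_forall_setIntegral_le hre (hc (b * B * Q)) fun E hE _ => by
    rw [Measure.restrict_restrict hE, setIntegral_const, smul_eq_mul, mul_comm (volume.real _)]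
    exact (key _ (hE.inter measurableSet_Ioc) Set.inter_subset_right).2
  filter_upwards [ae_imp_of_ae_restrict hlow, ae_imp_of_ae_restrict hupp] with t h1 h2 ht
    using ⟨h1 ht, h2 ht⟩

/-- The exceptional null set must not depend on `F` and `c`. There are countably many `F`, a
countable dense set of `c` suffices because the inequalities are closed conditions, and the shift
identity leaves the first cell. -/
theorem ae_gramForm_bounds (ha : 0 < a) (hb : 0 < b) {A B : ℝ}
    (hfr : ∀ f : LTwo, Summable (fun i => ‖inner ℂ (whSystem a b g i) f‖ ^ 2) ∧
    A * ‖f‖ ^ 2 ≤ ∑' i, ‖inner ℂ (whSystem a b g i) f‖ ^ 2 ∧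
    ∑' i, ‖inner ℂ (whSystem a b g i) f‖ ^ 2 ≤ B * ‖f‖ ^ 2) :
    ∀ᵐ t : ℝ, ∀ (F : Finset ℤ) (c : ℤ → ℂ),
      b * A * ∑ k ∈ F, ‖c k‖ ^ 2 ≤ (gramForm b⁻¹ (autoCorr a b g) t F c).re ∧
      (gramForm b⁻¹ (autoCorr a b g) t F c).re ≤ b * B * ∑ k ∈ F, ‖c k‖ ^ 2 := by
  have hs : 0 < b⁻¹ := inv_pos.2 hb
  have h1 : ∀ᵐ t : ℝ, t ∈ Set.Ioc 0 b⁻¹ → ∀ (F : Finset ℤ) (c : ℤ → ℂ),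
      b * A * ∑ k ∈ F, ‖c k‖ ^ 2 ≤ (gramForm b⁻¹ (autoCorr a b g) t F c).re ∧
      (gramForm b⁻¹ (autoCorr a b g) t F c).re ≤ b * B * ∑ k ∈ F, ‖c k‖ ^ 2 := by
    have h2 := ae_all_iff.2 fun F : Finset ℤ => ae_all_iff.2 fun n : ℕ =>
      ae_gramForm_bounds_single ha hb hfr F (TopologicalSpace.denseSeq (ℤ → ℂ) n)
    filter_upwards [h2] with t ht hmem F c
    refine (TopologicalSpace.denseRange_denseSeq (ℤ → ℂ)).induction_on
      (p := fun c : ℤ → ℂ => b * A * ∑ k ∈ F, ‖c k‖ ^ 2 ≤ (gramForm b⁻¹ (autoCorr a b g) t F c).re ∧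
      (gramForm b⁻¹ (autoCorr a b g) t F c).re ≤ b * B * ∑ k ∈ F, ‖c k‖ ^ 2) c ?_
      fun n => ht F n hmem
    have hcont : Continuous fun c : ℤ → ℂ => (gramForm b⁻¹ (autoCorr a b g) t F c).re := by
      unfold gramForm; fun_prop
    exact (isClosed_le (by fun_prop) hcont).inter (isClosed_le hcont (by fun_prop))
  filter_upwards [ae_forall_sub h1 b⁻¹] with t ht F c
  -- Cells are indexed by the ceiling, and `(0, s]` has index `1`; hence the shift by `⌈t / s⌉ - 1`.
  have hmem : t - (⌈t / b⁻¹⌉ - 1 : ℤ) * b⁻¹ ∈ Set.Ioc 0 b⁻¹ := by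
    rw [← ceil_div_eq_one_iff hs, ceil_sub_mul_div hs]
    ring
  have h3 := ht _ hmem (F.map (Equiv.subRight (⌈t / b⁻¹⌉ - 1 : ℤ)).toEmbedding)
    (fun k => c (k + (⌈t / b⁻¹⌉ - 1)))
  rw [gramForm_shift] at h3
  simpa only [Finset.sum_map, Equiv.coe_toEmbedding, Equiv.subRight_apply, sub_add_cancel] using h3

/-- The upper bound at a single basis vector reads `∑ₙ |g(t - na)|² ≤ bB`; the arithmetic–geometric
mean inequality then controls every `G_k` by the values of this sum at `t` and `t - k/b`. -/
theorem ae_norm_autoCorr_zero_le (ha : 0 < a) (hb : 0 < b) {A B : ℝ}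
    (hfr : ∀ f : LTwo, Summable (fun i => ‖inner ℂ (whSystem a b g i) f‖ ^ 2) ∧
    A * ‖f‖ ^ 2 ≤ ∑' i, ‖inner ℂ (whSystem a b g i) f‖ ^ 2 ∧
    ∑' i, ‖inner ℂ (whSystem a b g i) f‖ ^ 2 ≤ B * ‖f‖ ^ 2) :
    ∀ᵐ t : ℝ, ∀ k, ‖autoCorr a b g k t‖ ≤ b * B := by
  have h0 : ∀ᵐ t : ℝ, Summable (fun n : ℤ => ‖g (t - n * a)‖ ^ 2) ∧
      ∑' n : ℤ, ‖g (t - n * a)‖ ^ 2 ≤ b * B := by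
    filter_upwards [ae_gramForm_bounds ha hb hfr,
      ae_summable_autoCorr ha (Lp.memLp g) (measurable_coeFn g) b] with t h1 h2
    have h3 := h2 0
    have e : ∀ n : ℤ, g (t - n * a) * conj (g (t - n * a - (0 : ℤ) / b))
        = ((‖g (t - n * a)‖ ^ 2 : ℝ) : ℂ) := fun n => by
      rw [Int.cast_zero, zero_div, sub_zero, Complex.mul_conj, Complex.normSq_eq_norm_sq]
    simp only [e] at h3
    refine ⟨Complex.summable_ofReal.1 h3, ?_⟩
    have h4 := (h1 {0} (fun _ => 1)).2
    simp only [gramForm, autoCorr, Finset.sum_singleton, map_one, one_mul, mul_one, sub_self,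
      Int.cast_zero, zero_mul, sub_zero, norm_one, one_pow, zero_div] at h4
    have e' : ∀ n : ℤ, g (t - n * a) * conj (g (t - n * a))
        = ((‖g (t - n * a)‖ ^ 2 : ℝ) : ℂ) := fun n => by
      rw [Complex.mul_conj, Complex.normSq_eq_norm_sq]
    simp only [e'] at h4
    rwa [← Complex.ofReal_tsum, Complex.ofReal_re] at h4
  filter_upwards [h0, ae_forall_sub h0 b⁻¹] with t h1 h2 k
  obtain ⟨h3, h4⟩ := h2 k
  have e : ∀ n : ℤ, t - k * b⁻¹ - n * a = t - n * a - k / b := fun n => by ring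
  simp only [e] at h3 h4
  have hs : HasSum (fun n : ℤ => (‖g (t - n * a)‖ ^ 2 + ‖g (t - n * a - k / b)‖ ^ 2) / 2)
      ((∑' n : ℤ, ‖g (t - n * a)‖ ^ 2 + ∑' n : ℤ, ‖g (t - n * a - k / b)‖ ^ 2) / 2) :=
    (h1.1.hasSum.add h3.hasSum).div_const 2
  refine (tsum_of_norm_bounded hs fun n => ?_).trans (by linarith [h1.2])
  rw [norm_mul, RCLike.norm_conj]
  nlinarith [sq_nonneg (‖g (t - n * a)‖ - ‖g (t - n * a - k / b)‖)]

/-- The uniform condition with `ε = 1` bounds the tail; the finitely many remaining terms are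
bounded through the upper frame bound. -/
theorem UniformCCCondition.ccCondition (ha : 0 < a) (hb : 0 < b)
    (hfr : IsFrame (whSystem a b g)) (hU : UniformCCCondition a b g) : CCCondition a b g := by
  obtain ⟨A, B, -, hfr⟩ := hfr
  obtain ⟨K, -, hK⟩ := hU 1 one_pos
  set F : Finset ℤ := Finset.Icc (-(K : ℤ)) K with hF
  refine ⟨F.card * |b * B| + 1, by positivity, ?_⟩
  filter_upwards [hK, ae_norm_autoCorr_zero_le ha hb hfr] with t h1 h2
  have h3 : ∑' k : ℤ, ‖autoCorr a b g k t‖ₑ ≤ ∑ k ∈ F, ‖autoCorr a b g k t‖ₑ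
      + ∑' k : {k : ℤ // (K : ℤ) ≤ |k|}, ‖autoCorr a b g k t‖ₑ := by
    rw [show (∑' k : {k : ℤ // (K : ℤ) ≤ |k|}, ‖autoCorr a b g k t‖ₑ)
      = ∑' k : ℤ, Set.indicator {k : ℤ | (K : ℤ) ≤ |k|} (fun k => ‖autoCorr a b g k t‖ₑ) k from
      tsum_subtype {k : ℤ | (K : ℤ) ≤ |k|} fun k => ‖autoCorr a b g k t‖ₑ, sum_eq_tsum_indicator, ← ENNReal.tsum_add]
    refine ENNReal.tsum_le_tsum fun k => ?_
    by_cases hk : (K : ℤ) ≤ |k|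
    · rw [Set.indicator_of_mem (s := {k : ℤ | (K : ℤ) ≤ |k|}) hk]
      exact le_add_self
    · rw [Set.indicator_of_mem (s := (F : Set ℤ))]
      · exact le_self_add
      · rw [not_le, abs_lt] at hk
        simp only [hF, Finset.coe_Icc, Set.mem_Icc]
        omega
  refine h3.trans ?_
  rw [ENNReal.ofReal_add (by positivity) zero_le_one]
  gcongr
  · refine (Finset.sum_le_card_nsmul _ _ (ENNReal.ofReal |b * B|) fun k _ => ?_).trans (le_of_eq ?_)
    · rw [← ofReal_norm]
      exact ENNReal.ofReal_le_ofReal ((h2 k).trans (le_abs_self _))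
    · rw [nsmul_eq_mul, ENNReal.ofReal_mul (by positivity), ENNReal.ofReal_natCast]

end Fiber

/-! ### Recovering coefficients of absolutely convergent series -/

section Coefficients

/-- Integration against a character picks out a coefficient of an absolutely convergent
trigonometric series. -/
theorem integral_tsum_fourier {e : ℤ → ℂ} (he : Summable fun k => ‖e k‖) (k : ℤ) :
    ∫ t : AddCircle (1 : ℝ), (∑' d : ℤ, e d * fourier d t) * fourier (-k) t
      ∂AddCircle.haarAddCircle = e k := by
  have h0 : ∀ d : ℤ, ∫ t : AddCircle (1 : ℝ), e d * fourier (d - k) t ∂AddCircle.haarAddCircle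
      = if d = k then e d else 0 := by
    intro d
    rw [integral_const_mul]
    have h1 := congr_fun (fourierCoeff_fourier (T := 1) d) k
    rw [fourierCoeff] at h1
    simp only [smul_eq_mul, ← fourier_add] at h1
    rw [sub_eq_neg_add, h1, Pi.single_apply]
    split_ifs with h2 h3 h3
    · simp
    · exact absurd h2.symm h3
    · exact absurd h3.symm h2
    · simp
  have h1 : ∀ t : AddCircle (1 : ℝ), (∑' d : ℤ, e d * fourier d t) * fourier (-k) t
      = ∑' d : ℤ, e d * fourier (d - k) t := by
    intro t
    rw [← tsum_mul_right]
    refine tsum_congr fun d => ?_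
    rw [mul_assoc, ← fourier_add, sub_eq_add_neg]
  simp only [h1]
  have h2 : ∀ d : ℤ, Integrable (fun t : AddCircle (1 : ℝ) => e d * fourier (d - k) t)
      AddCircle.haarAddCircle := fun d =>
    ((fourier (d - k)).continuous.const_mul (e d)).integrable_of_hasCompactSupport
      (HasCompactSupport.of_compactSpace _)
  have h3 : ∀ (d : ℤ) (t : AddCircle (1 : ℝ)), ‖e d * fourier (d - k) t‖ = ‖e d‖ := fun d t => by
    rw [norm_mul, fourier_apply, Circle.norm_coe, mul_one]
  have h4 : Summable fun d : ℤ => ∫ t : AddCircle (1 : ℝ), ‖e d * fourier (d - k) t‖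
      ∂AddCircle.haarAddCircle := by
    simp only [h3, integral_const]
    simpa using he
  rw [← (hasSum_integral_of_summable_integral_norm h2 h4).tsum_eq]
  simp only [h0]
  simp

theorem norm_coeff_le {e : ℤ → ℂ} (he : Summable fun k => ‖e k‖) {ρ : ℝ}
    (h : ∀ z : Circle, ‖∑' k : ℤ, e k * (z : ℂ) ^ k‖ ≤ ρ) (k : ℤ) : ‖e k‖ ≤ ρ := by
  rw [← integral_tsum_fourier he k]
  refine (norm_integral_le_of_norm_le_const (C := ρ) (ae_of_all _ fun t => ?_)).trans ?_
  · rw [norm_mul, fourier_apply, Circle.norm_coe, mul_one]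
    simpa only [fourier_apply, AddCircle.toCircle_zsmul, Circle.coe_zpow] using
      h (AddCircle.toCircle t)
  · simp

theorem coeff_unique {e e' : ℤ → ℂ} (he : Summable fun k => ‖e k‖) (he' : Summable fun k => ‖e' k‖)
    (h : ∀ z : Circle, ∑' k : ℤ, e k * (z : ℂ) ^ k = ∑' k : ℤ, e' k * (z : ℂ) ^ k) : e = e' := by
  ext k
  rw [← integral_tsum_fourier he k, ← integral_tsum_fourier he' k]
  congr 1
  ext t
  have := h (AddCircle.toCircle t)
  simp only [← Circle.coe_zpow, ← AddCircle.toCircle_zsmul, ← fourier_apply] at this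
  rw [this]

end Coefficients

/-! ### The algebra of absolutely convergent series, uniformly in a parameter -/

section Wiener

/-- The function with Fourier coefficients `c`. -/
noncomputable def symb {X : Type*} (c : ℤ → X → ℂ) (x : X) (z : Circle) : ℂ := ∑' k : ℤ, c k x * (z : ℂ) ^ k

theorem symb_single {X : Type*} (φ : X → ℂ) (m : ℤ) :
    symb (fun k x => if k = m then φ x else 0) = fun x (z : Circle) => φ x * (z : ℂ) ^ m := by
  ext x z
  simp only [symb, ite_mul, zero_mul]
  rw [tsum_eq_single m fun k hk => if_neg hk, if_pos rfl]

variable {X : Type*} [MeasurableSpace X]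

/-- Measurable coefficient functions with absolute sums bounded by `C`. -/
structure IsCoeff (c : ℤ → X → ℂ) (C : ℝ) : Prop where
  meas : ∀ k, Measurable (c k)
  summable : ∀ x, Summable fun k => ‖c k x‖
  bdd : ∀ x, ∑' k, ‖c k x‖ ≤ C

theorem norm_mul_zpow (w : ℂ) (z : Circle) (k : ℤ) : ‖w * (z : ℂ) ^ k‖ = ‖w‖ := by
  rw [norm_mul, norm_zpow, Circle.norm_coe, one_zpow, mul_one]

variable {c d : ℤ → X → ℂ} {C D : ℝ}

theorem IsCoeff.summable_symb (hc : IsCoeff c C) (x : X) (z : Circle) :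
    Summable fun k : ℤ => c k x * (z : ℂ) ^ k :=
  Summable.of_norm (by simpa only [norm_mul_zpow] using hc.summable x)

theorem IsCoeff.norm_symb_le (hc : IsCoeff c C) (x : X) (z : Circle) : ‖symb c x z‖ ≤ C := by
  refine (norm_tsum_le_tsum_norm (by simpa only [norm_mul_zpow] using hc.summable x)).trans ?_
  simpa only [norm_mul_zpow] using hc.bdd x

theorem IsCoeff.mono (hc : IsCoeff c C) (h : C ≤ D) : IsCoeff c D :=
  ⟨hc.meas, hc.summable, fun x => (hc.bdd x).trans h⟩

theorem IsCoeff.add (hc : IsCoeff c C) (hd : IsCoeff d D) : IsCoeff (c + d) (C + D) := by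
  have h : ∀ x, Summable fun k => ‖(c + d) k x‖ := fun x =>
    Summable.of_nonneg_of_le (fun _ => norm_nonneg _) (fun k => norm_add_le _ _)
      ((hc.summable x).add (hd.summable x))
  refine ⟨fun k => (hc.meas k).add (hd.meas k), h, fun x => ?_⟩
  calc ∑' k, ‖(c + d) k x‖ ≤ ∑' k, (‖c k x‖ + ‖d k x‖) :=
        (h x).tsum_le_tsum (fun k => norm_add_le _ _) ((hc.summable x).add (hd.summable x))
    _ = _ := (hc.summable x).tsum_add (hd.summable x)
    _ ≤ _ := add_le_add (hc.bdd x) (hd.bdd x)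

theorem IsCoeff.symb_add (hc : IsCoeff c C) (hd : IsCoeff d D) : symb (c + d) = symb c + symb d := by
  ext x z
  simp only [symb, Pi.add_apply, add_mul]
  exact (hc.summable_symb x z).tsum_add (hd.summable_symb x z)

/-- Convolution of coefficients. -/
noncomputable def conv (c d : ℤ → X → ℂ) (k : ℤ) (x : X) : ℂ := ∑' j : ℤ, c j x * d (k - j) x

/-- The shear `(j, k) ↦ (j, k - j)` carries the family to a product of two summable families. -/
theorem IsCoeff.summable_prod (hc : IsCoeff c C) (hd : IsCoeff d D) (x : X) :
    Summable fun q : ℤ × ℤ => ‖c q.1 x * d (q.2 - q.1) x‖ := by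
  have h1 := (hc.summable x).mul_of_nonneg (hd.summable x) (fun _ => norm_nonneg _)
    fun _ => norm_nonneg _
  let e : ℤ × ℤ ≃ ℤ × ℤ :=
    ⟨fun q => (q.1, q.2 - q.1), fun q => (q.1, q.2 + q.1), fun q => by simp, fun q => by simp⟩
  rw [← e.summable_iff] at h1
  refine h1.congr fun q => ?_
  simp [e]

theorem IsCoeff.tsum_prod (hc : IsCoeff c C) (hd : IsCoeff d D) (x : X) :
    ∑' k : ℤ, ∑' j : ℤ, ‖c j x * d (k - j) x‖ = (∑' k, ‖c k x‖) * ∑' k, ‖d k x‖ := by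
  rw [Summable.tsum_comm (f := fun j k : ℤ => ‖c j x * d (k - j) x‖) (hc.summable_prod hd x),
    ← tsum_mul_right]
  refine tsum_congr fun j => ?_
  simp only [norm_mul]
  rw [tsum_mul_left, ← (Equiv.subRight j).tsum_eq fun k => ‖d k x‖]
  rfl

theorem IsCoeff.conv (hc : IsCoeff c C) (hd : IsCoeff d D) : IsCoeff (conv c d) (C * D) := by
  have h0 := fun x => hc.summable_prod hd x
  have h1 : ∀ x k, Summable fun j : ℤ => ‖c j x * d (k - j) x‖ := fun x k =>
    (h0 x).prod_symm.prod_factor k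
  have h2 : ∀ x, Summable fun k : ℤ => ∑' j : ℤ, ‖c j x * d (k - j) x‖ := fun x =>
    (h0 x).prod_symm.prod
  have h3 : ∀ x, Summable fun k => ‖WeylHeisenberg.conv c d k x‖ := fun x =>
    Summable.of_nonneg_of_le (fun _ => norm_nonneg _) (fun k => norm_tsum_le_tsum_norm (h1 x k)) (h2 x)
  refine ⟨fun k => Measurable.tsum fun j => (hc.meas j).mul (hd.meas _), h3, fun x => ?_⟩
  calc ∑' k, ‖WeylHeisenberg.conv c d k x‖ ≤ ∑' k : ℤ, ∑' j : ℤ, ‖c j x * d (k - j) x‖ :=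
        (h3 x).tsum_le_tsum (fun k => norm_tsum_le_tsum_norm (h1 x k)) (h2 x)
    _ = (∑' k, ‖c k x‖) * ∑' k, ‖d k x‖ := hc.tsum_prod hd x
    _ ≤ C * D := mul_le_mul (hc.bdd x) (hd.bdd x) (tsum_nonneg fun _ => norm_nonneg _)
        ((tsum_nonneg fun _ => norm_nonneg _).trans (hc.bdd x))

theorem IsCoeff.symb_conv (hc : IsCoeff c C) (hd : IsCoeff d D) :
    symb (WeylHeisenberg.conv c d) = symb c * symb d := by
  ext x z
  have h0 : Summable fun q : ℤ × ℤ => c q.1 x * d (q.2 - q.1) x * (z : ℂ) ^ q.2 :=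
    Summable.of_norm (by simpa only [norm_mul_zpow] using hc.summable_prod hd x)
  have hz : (z : ℂ) ≠ 0 := Circle.coe_ne_zero z
  simp only [symb, WeylHeisenberg.conv, Pi.mul_apply, ← tsum_mul_right]
  rw [Summable.tsum_comm (f := fun j k : ℤ => c j x * d (k - j) x * (z : ℂ) ^ k) h0]
  refine tsum_congr fun j => ?_
  rw [← tsum_mul_left, ← (Equiv.subRight j).tsum_eq fun k => c j x * (z : ℂ) ^ j * (d k x * (z : ℂ) ^ k)]
  refine tsum_congr fun k => ?_
  rw [Equiv.subRight_apply, zpow_sub₀ hz]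
  field_simp

/-- `F` has absolutely convergent Fourier series with norms bounded by `C`. -/
def HasW (F : X → Circle → ℂ) (C : ℝ) : Prop := ∃ c : ℤ → X → ℂ, IsCoeff c C ∧ F = symb c

variable {F G : X → Circle → ℂ}

theorem HasW.mono (hF : HasW F C) (h : C ≤ D) : HasW F D := by
  obtain ⟨c, hc, rfl⟩ := hF
  exact ⟨c, hc.mono h, rfl⟩

theorem HasW.norm_le (hF : HasW F C) (x : X) (z : Circle) : ‖F x z‖ ≤ C := by
  obtain ⟨c, hc, rfl⟩ := hF
  exact hc.norm_symb_le x z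

theorem HasW.add (hF : HasW F C) (hG : HasW G D) : HasW (F + G) (C + D) := by
  obtain ⟨c, hc, rfl⟩ := hF
  obtain ⟨d, hd, rfl⟩ := hG
  exact ⟨_, hc.add hd, (hc.symb_add hd).symm⟩

/-- Convolution is submultiplicative for absolute sums. With the closure properties around it,
`HasW` plays the part of a Banach algebra norm that is uniform in `x`. -/
theorem HasW.mul (hF : HasW F C) (hG : HasW G D) : HasW (F * G) (C * D) := by
  obtain ⟨c, hc, rfl⟩ := hF
  obtain ⟨d, hd, rfl⟩ := hG
  exact ⟨_, hc.conv hd, (hc.symb_conv hd).symm⟩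

theorem isCoeff_single {φ : X → ℂ} (hφ : Measurable φ) (hC : ∀ x, ‖φ x‖ ≤ C) (m : ℤ) :
    IsCoeff (fun k x => if k = m then φ x else 0) C := by
  have h : ∀ x : X, (fun k : ℤ => ‖if k = m then φ x else 0‖) = fun k => if k = m then ‖φ x‖ else 0 :=
    fun x => by ext k; split_ifs <;> simp
  refine ⟨fun k => ?_, fun x => ?_, fun x => ?_⟩
  · split_ifs
    exacts [hφ, measurable_const]
  · rw [h]
    exact (hasSum_ite_eq m ‖φ x‖).summable
  · rw [h, tsum_ite_eq]
    exact hC x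

theorem HasW.const {φ : X → ℂ} (hφ : Measurable φ) (hC : ∀ x, ‖φ x‖ ≤ C) :
    HasW (fun x _ => φ x) C :=
  ⟨_, isCoeff_single hφ hC 0, by rw [symb_single]; simp⟩

theorem HasW.pow (hF : HasW F C) (n : ℕ) : HasW (F ^ n) (C ^ n) := by
  induction n with
  | zero => simpa using! HasW.const (X := X) (φ := fun _ => 1) (C := 1) measurable_const (by simp)
  | succ n ih => rw [pow_succ, pow_succ]; exact ih.mul hF

theorem HasW.zero : HasW (0 : X → Circle → ℂ) 0 :=
  HasW.const (φ := fun _ => 0) measurable_const (by simp)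

theorem HasW.sum {ι : Type*} (s : Finset ι) {F : ι → X → Circle → ℂ} {C : ι → ℝ}
    (h : ∀ i ∈ s, HasW (F i) (C i)) : HasW (∑ i ∈ s, F i) (∑ i ∈ s, C i) := by
  classical
  induction s using Finset.induction_on with
  | empty => simpa using HasW.zero
  | insert i s hi ih =>
    rw [Finset.sum_insert hi, Finset.sum_insert hi]
    exact (h i (Finset.mem_insert_self i s)).add
      (ih fun j hj => h j (Finset.mem_insert_of_mem hj))

theorem IsCoeff.conj_symb (hc : IsCoeff c C) :
    IsCoeff (fun k x => conj (c (-k) x)) C ∧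
      symb (fun k x => conj (c (-k) x)) = fun x z => conj (symb c x z) := by
  refine ⟨⟨fun k => Complex.continuous_conj.measurable.comp (hc.meas _), fun x => ?_, fun x => ?_⟩, ?_⟩
  · simp only [RCLike.norm_conj]
    exact (Equiv.neg ℤ).summable_iff.2 (hc.summable x)
  · simp only [RCLike.norm_conj]
    exact ((Equiv.neg ℤ).tsum_eq fun k => ‖c k x‖).trans_le (hc.bdd x)
  · ext x z
    simp only [symb]
    rw [Complex.conj_tsum, ← (Equiv.neg ℤ).tsum_eq]
    refine tsum_congr fun k => ?_
    rw [Equiv.neg_apply, neg_neg, map_mul, map_zpow₀, ← Circle.coe_inv_eq_conj, Circle.coe_inv,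
      inv_zpow, zpow_neg]

theorem HasW.conj (hF : HasW F C) : HasW (fun x z => conj (F x z)) C := by
  obtain ⟨c, hc, rfl⟩ := hF
  exact ⟨_, hc.conj_symb.1, hc.conj_symb.2.symm⟩

/-- This is completeness of the algebra: the coefficients are summed over `n`, and summability of
the bounds justifies the exchange of sums. -/
theorem HasW.tsum {F : ℕ → X → Circle → ℂ} {C : ℕ → ℝ} (h : ∀ n, HasW (F n) (C n))
    (hC : Summable C) : HasW (fun x z => ∑' n, F n x z) (∑' n, C n) := by
  choose c hc hF using h
  have h0 : ∀ x, Summable fun q : ℕ × ℤ => ‖c q.1 q.2 x‖ := fun x => by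
    rw [summable_prod_of_nonneg fun _ => norm_nonneg _]
    exact ⟨fun n => (hc n).summable x,
      Summable.of_nonneg_of_le (fun n => tsum_nonneg fun _ => norm_nonneg _) (fun n => (hc n).bdd x) hC⟩
  have h1 : ∀ x k, Summable fun n => ‖c n k x‖ := fun x k => (h0 x).prod_symm.prod_factor k
  have h2 : ∀ x, Summable fun k : ℤ => ∑' n, ‖c n k x‖ := fun x => (h0 x).prod_symm.prod
  have h3 : ∀ x, Summable fun k : ℤ => ‖∑' n, c n k x‖ := fun x =>
    Summable.of_nonneg_of_le (fun _ => norm_nonneg _) (fun k => norm_tsum_le_tsum_norm (h1 x k)) (h2 x)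
  refine ⟨fun k x => ∑' n, c n k x, ⟨fun k => Measurable.tsum fun n => (hc n).meas k, h3, fun x => ?_⟩, ?_⟩
  · calc ∑' k : ℤ, ‖∑' n, c n k x‖ ≤ ∑' k : ℤ, ∑' n, ‖c n k x‖ :=
          (h3 x).tsum_le_tsum (fun k => norm_tsum_le_tsum_norm (h1 x k)) (h2 x)
      _ = ∑' n, ∑' k : ℤ, ‖c n k x‖ :=
          Summable.tsum_comm (f := fun n (k : ℤ) => ‖c n k x‖) (h0 x)
      _ ≤ _ := (h0 x).prod.tsum_le_tsum (fun n => (hc n).bdd x) hC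
  · ext x z
    simp only [hF, symb, ← tsum_mul_right]
    refine (Summable.tsum_comm (f := fun n (k : ℤ) => c n k x * (z : ℂ) ^ k) ?_).symm
    exact Summable.of_norm ((h0 x).congr fun q => (norm_mul_zpow _ _ _).symm)

/-- `P` is a trigonometric polynomial of degree at most `w`. -/
def HasP (P : X → Circle → ℂ) (w : ℕ) : Prop :=
  ∃ (c : ℤ → X → ℂ) (C : ℝ), IsCoeff c C ∧ (∀ k x, (w : ℤ) < |k| → c k x = 0) ∧ P = symb c

theorem HasP.mul {P Q : X → Circle → ℂ} {w v : ℕ} (hP : HasP P w) (hQ : HasP Q v) :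
    HasP (P * Q) (w + v) := by
  obtain ⟨c, C, hc, hcw, rfl⟩ := hP
  obtain ⟨d, D, hd, hdv, rfl⟩ := hQ
  refine ⟨_, _, hc.conv hd, fun k x hk => ?_, (hc.symb_conv hd).symm⟩
  rw [conv]
  convert tsum_zero with j
  by_cases hj : (w : ℤ) < |j|
  · rw [hcw j x hj, zero_mul]
  · rw [hdv (k - j) x, mul_zero]
    have := abs_sub_abs_le_abs_sub k j
    push_cast at hk
    linarith

theorem HasP.pow {P : X → Circle → ℂ} {w : ℕ} (hP : HasP P w) (n : ℕ) : HasP (P ^ n) (n * w) := by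
  induction n with
  | zero =>
    refine ⟨_, 1, isCoeff_single (X := X) (φ := fun _ => 1) measurable_const (by simp) 0, fun k x hk => ?_, ?_⟩
    · refine if_neg ?_
      rintro rfl
      simp at hk
    · rw [symb_single]
      ext
      simp
  | succ n ih =>
    rw [pow_succ, Nat.succ_mul]
    exact ih.mul hP

theorem HasP.add {P Q : X → Circle → ℂ} {w v : ℕ} (hP : HasP P w) (hQ : HasP Q v) :
    HasP (P + Q) (max w v) := by
  obtain ⟨c, C, hc, hcw, rfl⟩ := hP
  obtain ⟨d, D, hd, hdv, rfl⟩ := hQ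
  refine ⟨_, _, hc.add hd, fun k x hk => ?_, (hc.symb_add hd).symm⟩
  rw [Pi.add_apply, Pi.add_apply, hcw k x, hdv k x, add_zero]
  · exact lt_of_le_of_lt (by exact_mod_cast le_max_right w v) hk
  · exact lt_of_le_of_lt (by exact_mod_cast le_max_left w v) hk

/-- The coefficient norm of a trigonometric polynomial is controlled by its supremum. -/
theorem HasP.hasW {P : X → Circle → ℂ} {w : ℕ} (hP : HasP P w) {ρ : ℝ}
    (hρ : ∀ x z, ‖P x z‖ ≤ ρ) : HasW P ((2 * w + 1) * ρ) := by
  obtain ⟨c, C, hc, hcw, rfl⟩ := hP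
  refine ⟨c, ⟨hc.meas, hc.summable, fun x => ?_⟩, rfl⟩
  rw [tsum_eq_sum (s := Finset.Icc (-(w : ℤ)) w)]
  · refine (Finset.sum_le_card_nsmul _ _ ρ fun k _ => norm_coeff_le (hc.summable x) (hρ x) k).trans
      (le_of_eq ?_)
    rw [Int.card_Icc, nsmul_eq_mul]
    congr 1
    rw [show (w : ℤ) + 1 - -w = ((2 * w + 1 : ℕ) : ℤ) by push_cast; ring, Int.toNat_natCast]
    push_cast
    ring
  · intro k hk
    rw [hcw k x, norm_zero]
    by_contra hcon
    rw [not_lt, abs_le] at hcon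
    exact hk (Finset.mem_Icc.2 hcon)

/-- `F` can be approximated by trigonometric polynomials in the norm of absolute coefficient sums,
uniformly in the parameter. -/
def IsTight (F : X → Circle → ℂ) : Prop :=
  ∀ ε : ℝ, 0 < ε → ∃ w P, HasP P w ∧ HasW (F - P) ε

end Wiener

/-! ### A Wiener lemma uniform in the parameter -/

section WienerInverse

variable {X : Type*} [MeasurableSpace X] {F G P : X → Circle → ℂ} {C D : ℝ}

theorem HasP.single {φ : X → ℂ} (hφ : Measurable φ) (hC : ∀ x, ‖φ x‖ ≤ C) (m : ℤ) :
    HasP (fun x (z : Circle) => φ x * (z : ℂ) ^ m) m.natAbs := by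
  refine ⟨_, C, isCoeff_single hφ hC m, fun k x hk => if_neg ?_, (symb_single φ m).symm⟩
  rintro rfl
  simp at hk

theorem HasP.conj {w : ℕ} (hP : HasP P w) : HasP (fun x z => conj (P x z)) w := by
  obtain ⟨c, C, hc, hcw, rfl⟩ := hP
  refine ⟨_, C, hc.conj_symb.1, fun k x hk => ?_, hc.conj_symb.2.symm⟩
  simp only [hcw (-k) x (by rwa [abs_neg]), map_zero]

theorem HasP.exists_hasW {w : ℕ} (hP : HasP P w) : ∃ C, 0 < C ∧ HasW P C := by
  obtain ⟨c, C, hc, -, rfl⟩ := hP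
  exact ⟨max C 1, by positivity, c, hc.mono (le_max_left _ _), rfl⟩

theorem HasP.isTight {w : ℕ} (hP : HasP P w) : IsTight P := fun ε hε =>
  ⟨w, P, hP, by rw [sub_self]; exact HasW.zero.mono hε.le⟩

theorem IsTight.exists_hasW (hF : IsTight F) : ∃ C, 0 < C ∧ HasW F C := by
  obtain ⟨w, P, hP, h⟩ := hF 1 one_pos
  obtain ⟨C, hC, hPC⟩ := hP.exists_hasW
  exact ⟨1 + C, by positivity, by simpa using h.add hPC⟩

theorem IsTight.add (hF : IsTight F) (hG : IsTight G) : IsTight (F + G) := by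
  intro ε hε
  obtain ⟨w, P, hP, h⟩ := hF (ε / 2) (by positivity)
  obtain ⟨v, Q, hQ, h'⟩ := hG (ε / 2) (by positivity)
  refine ⟨_, _, hP.add hQ, ?_⟩
  rw [add_sub_add_comm, ← add_halves ε]
  exact h.add h'

/-- `FG - PQ = (F - P) G + P (G - Q)`. Since the second tolerance depends on the size of `P`, the
approximation of `G` is chosen after `P`. -/
theorem IsTight.mul (hF : IsTight F) (hG : IsTight G) : IsTight (F * G) := by
  intro ε hε
  obtain ⟨C, hC, hGC⟩ := hG.exists_hasW
  obtain ⟨w, P, hP, h⟩ := hF (ε / 2 / C) (by positivity)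
  obtain ⟨D, hD, hPD⟩ := hP.exists_hasW
  obtain ⟨v, Q, hQ, h'⟩ := hG (ε / 2 / D) (by positivity)
  refine ⟨_, _, hP.mul hQ, ?_⟩
  have h1 := (h.mul hGC).add (hPD.mul h')
  rw [div_mul_cancel₀ _ hC.ne', mul_div_cancel₀ _ hD.ne', add_halves] at h1
  convert h1 using 1
  ring

theorem IsTight.of_approx (h : ∀ ε : ℝ, 0 < ε → ∃ G, IsTight G ∧ HasW (F - G) ε) : IsTight F := by
  intro ε hε
  obtain ⟨G, hG, h1⟩ := h (ε / 2) (by positivity)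
  obtain ⟨w, P, hP, h2⟩ := hG (ε / 2) (by positivity)
  refine ⟨w, P, hP, ?_⟩
  rw [← sub_add_sub_cancel F G P, ← add_halves ε]
  exact h1.add h2

theorem IsTight.conj (hF : IsTight F) : IsTight (fun x z => conj (F x z)) := by
  intro ε hε
  obtain ⟨w, P, hP, h⟩ := hF ε hε
  refine ⟨w, _, hP.conj, ?_⟩
  convert h.conj using 1
  ext x z
  simp

theorem isTight_const (c : ℂ) : IsTight (fun (_ : X) _ => c) := by
  simpa using (HasP.single (X := X) (φ := fun _ => c) measurable_const (fun _ => le_rfl) 0).isTight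

variable (X) in
/-- The functions with uniformly absolutely convergent Fourier series form a ring. -/
def tightSubring : Subring (X → Circle → ℂ) where
  carrier := {F | IsTight F}
  mul_mem' := IsTight.mul
  one_mem' := isTight_const 1
  add_mem' := IsTight.add
  zero_mem' := isTight_const 0
  neg_mem' {F} hF := by
    have h : -F = (fun _ _ => -1) * F := by
      ext x z
      simp
    change IsTight (-F)
    rw [h]
    exact (isTight_const (-1)).mul hF

theorem isTight_det {n : ℕ} {M : Matrix (Fin n) (Fin n) (X → Circle → ℂ)}
    (hM : ∀ i j, IsTight (M i j)) : IsTight M.det := by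
  change M.det ∈ tightSubring X
  rw [Matrix.det_apply]
  refine sum_mem fun σ _ => ?_
  rw [Units.smul_def]
  exact zsmul_mem (prod_mem fun i _ => hM _ _) _

theorem isTight_adjugate {n : ℕ} {M : Matrix (Fin n) (Fin n) (X → Circle → ℂ)}
    (hM : ∀ i j, IsTight (M i j)) (i j : Fin n) : IsTight (M.adjugate i j) := by
  rw [Matrix.adjugate_apply]
  refine isTight_det fun k l => ?_
  rw [Matrix.updateRow_apply]
  split_ifs with h
  · rw [Pi.single_apply]
    split_ifs
    exacts [isTight_const 1, isTight_const 0]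
  · exact hM k l

/-- Coefficient norms of powers grow at the rate of the supremum, up to a linear factor. Expand `R =
P + (R - P)` binomially: `P^m` has degree at most `m w`, so its coefficient norm exceeds its
supremum by a factor of at most `2 m w + 1`, while `R - P` is small in coefficient norm. -/
theorem IsTight.hasW_pow {R : X → Circle → ℂ} (hR : IsTight R) {ρ r : ℝ} (hρ : 0 ≤ ρ)
    (hRρ : ∀ x z, ‖R x z‖ ≤ ρ) (hr : ρ < r) :
    ∃ w : ℕ, ∀ n : ℕ, HasW (R ^ n) ((2 * (n * w) + 1) * r ^ n) := by
  -- One `ε` pays for the supremum of `P`, the other for `R - P`, so the binomial sum is exactly `r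
  -- ^ n`.
  set ε := (r - ρ) / 2 with hε
  have hε0 : 0 < ε := by rw [hε]; linarith
  obtain ⟨w, P, hP, h⟩ := hR ε hε0
  refine ⟨w, fun n => ?_⟩
  have hPρ : ∀ x z, ‖P x z‖ ≤ ρ + ε := fun x z => by
    have h1 : P x z = R x z - (R - P) x z := by simp
    rw [h1]
    exact (norm_sub_le _ _).trans (add_le_add (hRρ x z) (h.norm_le x z))
  have h1 : R ^ n = ∑ m ∈ Finset.range (n + 1),
      P ^ m * (R - P) ^ (n - m) * fun _ _ => (n.choose m : ℂ) := by
    conv_lhs => rw [← add_sub_cancel P R, add_pow]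
    rfl
  have h2 : r = (ρ + ε) + ε := by rw [hε]; ring
  rw [h1, h2, add_pow, Finset.mul_sum]
  refine HasW.sum _ fun m hm => ?_
  have hmn : m ≤ n := Nat.lt_succ_iff.1 (Finset.mem_range.1 hm)
  have h3 : HasW (P ^ m) ((2 * (n * w) + 1) * (ρ + ε) ^ m) := by
    refine ((hP.pow m).hasW (ρ := (ρ + ε) ^ m) fun x z => ?_).mono ?_
    · rw [Pi.pow_apply, Pi.pow_apply, norm_pow]
      exact pow_le_pow_left₀ (norm_nonneg _) (hPρ x z) m
    · have : (m : ℝ) ≤ n := by exact_mod_cast hmn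
      push_cast
      gcongr
  have h4 := (h3.mul (h.pow (n - m))).mul (HasW.const (X := X) (φ := fun _ => (n.choose m : ℂ))
    (C := n.choose m) measurable_const (by simp))
  refine h4.mono (le_of_eq ?_)
  ring

/-- The Neumann series converges in coefficient norm because the powers decay like the supremum,
even if the coefficient norm of `R` itself exceeds one. Its partial sums are tight and tight
functions are closed under approximation. -/
theorem IsTight.geometric {R : X → Circle → ℂ} (hR : IsTight R) {ρ : ℝ} (hρ : 0 ≤ ρ) (hρ1 : ρ < 1)
    (hRρ : ∀ x z, ‖R x z‖ ≤ ρ) : IsTight fun x z => (1 - R x z)⁻¹ := by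
  obtain ⟨r, hr, hr1⟩ := exists_between hρ1
  have hr0 : 0 ≤ r := hρ.trans hr.le
  obtain ⟨w, hw⟩ := hR.hasW_pow hρ hRρ hr
  set β : ℕ → ℝ := fun n => (2 * (n * w) + 1) * r ^ n with hβ
  have hs : Summable β := by
    have h1 := summable_pow_mul_geometric_of_norm_lt_one 1
      (show ‖r‖ < 1 by rwa [Real.norm_of_nonneg hr0])
    have h2 := (h1.mul_left (2 * (w : ℝ))).add (summable_geometric_of_lt_one hr0 hr1)
    refine h2.congr fun n => ?_
    rw [hβ]
    ring
  refine IsTight.of_approx fun ε hε => ?_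
  obtain ⟨N, hN⟩ := ((tendsto_sum_nat_add β).eventually (gt_mem_nhds hε)).exists
  refine ⟨∑ n ∈ Finset.range N, R ^ n,
    (tightSubring X).sum_mem fun n _ => (tightSubring X).pow_mem hR n, ?_⟩
  have h3 := HasW.tsum (fun n => hw (n + N)) ((summable_nat_add_iff N).2 hs)
  convert h3.mono hN.le using 1
  ext x z
  have h4 : ‖R x z‖ < 1 := (hRρ x z).trans_lt hρ1
  have h5 := (summable_geometric_of_norm_lt_one h4).sum_add_tsum_nat_add N
  rw [tsum_geometric_of_norm_lt_one h4] at h5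
  simp [← h5, Finset.sum_apply]

/-- Uniform Wiener lemma: pointwise inverses, bounded away from zero, of functions with uniformly
absolutely convergent Fourier series are of the same kind. -/
theorem IsTight.inv (hF : IsTight F) {δ : ℝ} (hδ : 0 < δ) (h : ∀ x z, δ ≤ ‖F x z‖) :
    IsTight fun x z => (F x z)⁻¹ := by
  obtain ⟨C, hC, hFC⟩ := hF.exists_hasW
  -- With this `c` the function `R = 1 - |F|²/c` takes values in `[0, 1 - δ²/c]`: the bound `|F| ≤
  -- C` gives the lower end and `|F| ≥ δ` the upper. Then `1/F` is `conj F / c` times `1/(1 - R)`.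
  set c : ℝ := C ^ 2 + δ ^ 2 with hc
  have hc0 : 0 < c := by positivity
  set R : X → Circle → ℂ := fun x z => 1 - (c⁻¹ : ℝ) * (F x z * conj (F x z)) with hRdef
  have hR1 : ∀ x z, R x z = ((1 - c⁻¹ * ‖F x z‖ ^ 2 : ℝ) : ℂ) := fun x z => by
    rw [hRdef]
    push_cast
    rw [Complex.mul_conj, Complex.normSq_eq_norm_sq]
    push_cast
    rfl
  have hR : IsTight R := by
    refine (tightSubring X).sub_mem (isTight_const 1 : _ ∈ tightSubring X) ?_
    exact (isTight_const _).mul (hF.mul hF.conj)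
  have hle : ∀ x z, c⁻¹ * ‖F x z‖ ^ 2 ≤ 1 := fun x z => by
    rw [inv_mul_le_iff₀ hc0, mul_one, hc]
    have := pow_le_pow_left₀ (norm_nonneg _) (hFC.norm_le x z) 2
    nlinarith
  have hδc : c⁻¹ * δ ^ 2 ≤ 1 := by
    rw [inv_mul_le_iff₀ hc0, mul_one, hc]
    nlinarith
  have hg := hR.geometric (ρ := 1 - c⁻¹ * δ ^ 2) (by linarith)
    (by have : 0 < c⁻¹ * δ ^ 2 := by positivity
        linarith) fun x z => by
      rw [hR1, Complex.norm_real, Real.norm_of_nonneg (by linarith [hle x z])]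
      have := pow_le_pow_left₀ hδ.le (h x z) 2
      gcongr
  convert (isTight_const (c⁻¹ : ℝ)).mul (hF.conj.mul hg) using 1
  ext x z
  have hF0 : F x z ≠ 0 := norm_pos_iff.1 (hδ.trans_le (h x z))
  have hF1 : conj (F x z) ≠ 0 := by simpa using hF0
  have hc1 : (c : ℂ) ≠ 0 := by exact_mod_cast hc0.ne'
  simp only [Pi.mul_apply, hRdef, sub_sub_cancel, Complex.ofReal_inv]
  field_simp

variable {c : ℤ → X → ℂ}

theorem IsCoeff.of_le (hc : IsCoeff c C) {d : ℤ → X → ℂ} (hd : ∀ k, Measurable (d k))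
    (h : ∀ k x, ‖d k x‖ ≤ ‖c k x‖) : IsCoeff d C := by
  have hs : ∀ x, Summable fun k => ‖d k x‖ := fun x =>
    Summable.of_nonneg_of_le (fun _ => norm_nonneg _) (fun k => h k x) (hc.summable x)
  exact ⟨hd, hs, fun x => ((hs x).tsum_le_tsum (fun k => h k x) (hc.summable x)).trans (hc.bdd x)⟩

theorem IsCoeff.isTight_symb (hc : IsCoeff c C)
    (h : ∀ ε : ℝ, 0 < ε → ∃ K : ℕ, ∀ x, ∑' k : ℤ, (if (K : ℤ) ≤ |k| then ‖c k x‖ else 0) ≤ ε) :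
    IsTight (symb c) := by
  intro ε hε
  obtain ⟨K, hK⟩ := h ε hε
  set p : ℤ → X → ℂ := fun k => if (K : ℤ) ≤ |k| then 0 else c k with hp
  set e : ℤ → X → ℂ := fun k => if (K : ℤ) ≤ |k| then c k else 0 with he
  have hpc : IsCoeff p C := hc.of_le (fun k => by rw [hp]; dsimp only; split_ifs; exacts [measurable_zero, hc.meas k])
    fun k x => by rw [hp]; dsimp only; split_ifs <;> simp
  have hec : IsCoeff e C := hc.of_le (fun k => by rw [he]; dsimp only; split_ifs; exacts [hc.meas k, measurable_zero])
    fun k x => by rw [he]; dsimp only; split_ifs <;> simp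
  refine ⟨K, symb p, ⟨p, C, hpc, fun k x hk => by simp [hp, hk.le], rfl⟩, e, ⟨hec.meas, hec.summable, fun x => ?_⟩, ?_⟩
  · refine (tsum_congr fun k => ?_).trans_le (hK x)
    rw [he]
    dsimp only
    split_ifs <;> simp
  · rw [sub_eq_iff_eq_add, ← hec.symb_add hpc]
    congr 1
    ext k x
    rw [hp, he]
    dsimp only [Pi.add_apply]
    split_ifs <;> simp

/-- By uniqueness of coefficients, beyond the degree of the approximating polynomial the
coefficients of the symbol are those of the small remainder. -/
theorem IsTight.tail_le (hc : IsCoeff c C) (ht : IsTight (symb c)) {ε : ℝ} (hε : 0 < ε) :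
    ∃ K : ℕ, ∀ x, ∑' k : ℤ, (if (K : ℤ) ≤ |k| then ‖c k x‖ else 0) ≤ ε := by
  obtain ⟨w, P, ⟨p, D, hp, hpw, rfl⟩, e, he, heq⟩ := ht ε hε
  rw [sub_eq_iff_eq_add, ← he.symb_add hp] at heq
  refine ⟨w + 1, fun x => ?_⟩
  have h1 : (fun k => c k x) = fun k => (e + p) k x :=
    coeff_unique (hc.summable x) ((he.add hp).summable x) fun z => congr_fun (congr_fun heq x) z
  have h2 : ∀ k : ℤ, (if ((w + 1 : ℕ) : ℤ) ≤ |k| then ‖c k x‖ else 0) ≤ ‖e k x‖ := fun k => by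
    split_ifs with hk
    · rw [congr_fun h1 k, Pi.add_apply, Pi.add_apply, hpw k x (by push_cast at hk; linarith), add_zero]
    · exact norm_nonneg _
  refine (Summable.tsum_le_tsum h2 (Summable.of_nonneg_of_le (fun k => ?_) h2 (he.summable x))
    (he.summable x)).trans (he.bdd x)
  split_ifs
  exacts [norm_nonneg _, le_rfl]

end WienerInverse

/-! ### Averages of Toeplitz sums -/

section Fejer

/-- Fejér means: averages of the Toeplitz sums of a summable sequence converge to its sum. -/
theorem tendsto_average_toeplitz {h : ℤ → ℂ} (hh : Summable h) :
    Tendsto (fun N : ℕ => (N : ℝ)⁻¹ • ∑ l ∈ Finset.range N, ∑ m ∈ Finset.range N, h (m - l))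
      atTop (𝓝 (∑' k, h k)) := by
  set T : ℕ → ℂ := fun N => ∑ l ∈ Finset.range N, ∑ m ∈ Finset.range N, h (m - l) with hT
  -- Enlarging the square by one row and one column adds the symmetric partial sum of `h` over `[-N,
  -- N]`. These increments converge to the full sum, and dividing `T N` by `N` is their Cesàro mean.
  have h1 : ∀ N, T (N + 1) - T N
      = ∑ i ∈ Finset.range (N + 1), h i + ∑ i ∈ Finset.range N, h (-((i : ℤ) + 1)) := by
    intro N
    rw [← Finset.sum_range_reflect (fun i => h (i : ℤ)) (N + 1),
      ← Finset.sum_range_reflect (fun i => h (-((i : ℤ) + 1))) N]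
    have h2 : ∑ i ∈ Finset.range (N + 1), h (((N + 1 - 1 - i : ℕ) : ℕ) : ℤ)
        = ∑ i ∈ Finset.range (N + 1), h (N - i) := by
      refine Finset.sum_congr rfl fun i hi => ?_
      have := Finset.mem_range.1 hi
      congr 1
      omega
    have h3 : ∑ i ∈ Finset.range N, h (-(((N - 1 - i : ℕ) : ℤ) + 1))
        = ∑ i ∈ Finset.range N, h (i - N) := by
      refine Finset.sum_congr rfl fun i hi => ?_
      have := Finset.mem_range.1 hi
      congr 1
      omega
    rw [h2, h3, hT]
    dsimp only
    rw [Finset.sum_range_succ _ N, Finset.sum_range_succ _ N]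
    simp only [Finset.sum_range_succ, Finset.sum_add_distrib]
    ring
  have h4 : Tendsto (fun N => T (N + 1) - T N) atTop (𝓝 (∑' k, h k)) := by
    have ha : Summable fun i : ℕ => h i := hh.comp_injective Nat.cast_injective
    have hb : Summable fun i : ℕ => h (-((i : ℤ) + 1)) :=
      hh.comp_injective (i := fun i : ℕ => -((i : ℤ) + 1)) fun i j hij => by
        simpa using hij
    rw [(ha.hasSum.of_nat_of_neg_add_one hb.hasSum).tsum_eq]
    simp only [h1]
    exact (ha.hasSum.tendsto_sum_nat.comp (tendsto_add_atTop_nat 1)).add hb.hasSum.tendsto_sum_nat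
  have h5 := h4.cesaro_smul
  simp only [Finset.sum_range_sub] at h5
  simpa [hT] using h5

end Fejer

/-! ### The block symbol and its positivity -/

section Blocks

theorem hasSum_of_residues {E : Type*} [AddCommMonoid E] [TopologicalSpace E] [ContinuousAdd E]
    {n : ℕ} [NeZero n] {f : ℤ → E} {g : Fin n → E}
    (h : ∀ r : Fin n, HasSum (fun l : ℤ => f (l * n + (r : ℕ))) (g r)) : HasSum f (∑ r, g r) := by
  set e := Int.divModEquiv n with he
  have h1 : ∀ r, HasSum (fun k => if (e k).2 = r then f k else 0) (g r) := by
    intro r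
    have hinj : Function.Injective fun l : ℤ => e.symm (l, r) := fun l m hlm => by
      simpa using hlm
    rw [← hinj.hasSum_iff]
    · have h2 : (fun k => if (e k).2 = r then f k else 0) ∘ (fun l : ℤ => e.symm (l, r))
          = fun l : ℤ => f (l * n + (r : ℕ)) := by
        ext l
        rw [Function.comp_apply, Equiv.apply_symm_apply, if_pos rfl]
        rfl
      rw [h2]
      exact h r
    · intro k hk
      refine if_neg fun hkr => hk ⟨(e k).1, ?_⟩
      rw [← hkr]
      simp
  convert! hasSum_sum (s := Finset.univ) fun r _ => h1 r with k
  simp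

variable {s : ℝ} {n : ℕ} {A C : ℝ} {Γ : ℤ → ℝ → ℂ}

/-- The coefficients of the block symbol of the matrix `Γ (i - j) (t - j s)`. -/
def blockCoeff (s : ℝ) (n : ℕ) (Γ : ℤ → ℝ → ℂ) (r q : Fin n) (l : ℤ) (t : ℝ) : ℂ :=
  Γ (l * n + (q : ℕ) - (r : ℕ)) (t - (r : ℕ) * s)

/-- The block symbol of the matrix `Γ (i - j) (t - j s)`. -/
noncomputable def blockSymb (s : ℝ) (n : ℕ) (Γ : ℤ → ℝ → ℂ) :
    Matrix (Fin n) (Fin n) (ℝ → Circle → ℂ) :=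
  fun r q => symb (blockCoeff s n Γ r q)

/-- Kernels whose matrices `Γ (i - j) (t - j s)` are hermitian, `n`-periodic along the diagonal,
uniformly summable along the rows, and uniformly positive. -/
structure IsPosKernel (s : ℝ) (n : ℕ) (A C : ℝ) (Γ : ℤ → ℝ → ℂ) : Prop where
  coeff : IsCoeff Γ C
  tail : ∀ ε : ℝ, 0 < ε → ∃ K : ℕ, ∀ t, ∑' k : ℤ, (if (K : ℤ) ≤ |k| then ‖Γ k t‖ else 0) ≤ ε
  periodic : ∀ k t, Γ k (t + n * s) = Γ k t
  herm : ∀ k t, Γ (-k) t = conj (Γ k (t + k * s))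
  lower : ∀ t (F : Finset ℤ) (c : ℤ → ℂ), A * ∑ k ∈ F, ‖c k‖ ^ 2 ≤ (gramForm s Γ t F c).re

/-- Periodicity absorbs the shift by `l n s`, so the `(l, m)` block depends only on `m - l`: the
fibre matrix is block Laurent. -/
theorem kernel_eq_blockCoeff (hper : ∀ k t, Γ k (t + n * s) = Γ k t) (r q : Fin n) (l m : ℤ)
    (t : ℝ) : Γ ((m * n + (q : ℕ)) - (l * n + (r : ℕ))) (t - ((l * n + (r : ℕ) : ℤ) : ℝ) * s)
      = blockCoeff s n Γ r q (m - l) t := by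
  have h1 : Function.Periodic (Γ ((m - l) * n + (q : ℕ) - (r : ℕ))) (n * s) := hper _
  rw [blockCoeff, ← (h1.int_mul l).sub_eq]
  congr 1 <;> push_cast <;> ring

theorem blockIndex_injective [NeZero n] (r q : Fin n) :
    Function.Injective fun l : ℤ => l * n + (q : ℕ) - (r : ℕ) := fun l m h => by
  have hn : (n : ℤ) ≠ 0 := by exact_mod_cast NeZero.ne n
  simp only [sub_left_inj, add_left_inj] at h
  exact mul_right_cancel₀ hn h

theorem le_abs_blockIndex (r q : Fin n) {K : ℕ} {l : ℤ} (h : ((K + 1 : ℕ) : ℤ) ≤ |l|) :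
    (K : ℤ) ≤ |l * n + (q : ℕ) - (r : ℕ)| := by
  have hr := r.2
  have hq := q.2
  have h1 : |l| * n = |l * n| := by rw [abs_mul, Nat.abs_cast]
  have h2 : |(r : ℤ) - q| ≤ n - 1 := by
    rw [abs_le]
    constructor <;> omega
  have h3 : |l * n| ≤ |l * n + (q : ℕ) - (r : ℕ)| + |(r : ℤ) - q| := by
    refine le_trans (le_of_eq ?_) (abs_add_le _ _)
    congr 1
    ring
  have h4 : (1 : ℤ) ≤ n := by omega
  push_cast at h
  nlinarith

theorem IsPosKernel.isCoeff_block [NeZero n] (h : IsPosKernel s n A C Γ) (r q : Fin n) :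
    IsCoeff (blockCoeff s n Γ r q) C := by
  have hi := blockIndex_injective r q
  refine ⟨fun l => (h.coeff.meas _).comp (measurable_id.sub_const _),
    fun t => (h.coeff.summable (t - (r : ℕ) * s)).comp_injective hi, fun t => ?_⟩
  exact (tsum_comp_le_tsum_of_inj (h.coeff.summable (t - (r : ℕ) * s)) (fun _ => norm_nonneg _)
    hi).trans (h.coeff.bdd _)

theorem summable_ite_le {f : ℤ → ℝ} (hf : Summable f) (h0 : ∀ k, 0 ≤ f k) (K : ℤ) :
    Summable fun k : ℤ => if K ≤ |k| then f k else 0 :=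
  Summable.of_nonneg_of_le (fun k => by split_ifs; exacts [h0 k, le_rfl])
    (fun k => by split_ifs; exacts [le_rfl, h0 k]) hf

/-- The coefficients of an entry are a subfamily of a row of `Γ`, and the residues displace indices
by less than `n`; enlarging the tail threshold by one therefore suffices. -/
theorem IsPosKernel.isTight_block [NeZero n] (h : IsPosKernel s n A C Γ) (r q : Fin n) :
    IsTight (blockSymb s n Γ r q) := by
  refine (h.isCoeff_block r q).isTight_symb fun ε hε => ?_
  obtain ⟨K, hK⟩ := h.tail ε hε
  refine ⟨K + 1, fun t => le_trans ?_ (hK (t - (r : ℕ) * s))⟩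
  refine Summable.tsum_le_tsum_of_inj _ (blockIndex_injective r q) (fun k _ => ?_) (fun l => ?_)
    (summable_ite_le ((h.isCoeff_block r q).summable t) (fun _ => norm_nonneg _) _)
    (summable_ite_le (h.coeff.summable _) (fun _ => norm_nonneg _) _)
  · split_ifs
    exacts [norm_nonneg _, le_rfl]
  · by_cases hl : ((K + 1 : ℕ) : ℤ) ≤ |l|
    · rw [if_pos hl, if_pos (le_abs_blockIndex r q hl)]
      rfl
    · rw [if_neg hl]
      split_ifs
      exacts [norm_nonneg _, le_rfl]

theorem IsPosKernel.herm_entry (h : IsPosKernel s n A C Γ) (i j : ℤ) (t : ℝ) :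
    Γ (j - i) (t - i * s) = conj (Γ (i - j) (t - j * s)) := by
  rw [← neg_sub i j, h.herm]
  congr 2
  push_cast
  ring

theorem IsPosKernel.blockCoeff_conj (h : IsPosKernel s n A C Γ) (r q : Fin n) (l : ℤ) (t : ℝ) :
    conj (blockCoeff s n Γ r q (-l) t) = blockCoeff s n Γ q r l t := by
  have h1 := h.herm_entry (0 * n + (q : ℕ)) (l * n + (r : ℕ)) t
  rw [kernel_eq_blockCoeff h.periodic, kernel_eq_blockCoeff h.periodic] at h1
  rw [sub_zero, zero_sub] at h1
  exact h1.symm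

theorem IsPosKernel.isHermitian_block [NeZero n] (h : IsPosKernel s n A C Γ) (t : ℝ) (z : Circle) :
    (Matrix.of fun r q => blockSymb s n Γ r q t z).IsHermitian := by
  ext r q
  simp only [Matrix.conjTranspose_apply, Matrix.of_apply, blockSymb, RCLike.star_def]
  rw [← congr_fun (congr_fun (h.isCoeff_block q r).conj_symb.2 t) z]
  simp only [h.blockCoeff_conj]

/-- Apply the lower bound to the truncated plane waves with entry `z^l v_r` at index `l n + r`, for
`0 ≤ l < N`. The form becomes a Toeplitz sum, the squared norm is `N ‖v‖²`, and division by `N`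
converges to the form of the symbol at `z`. -/
theorem IsPosKernel.lower_block [NeZero n] (h : IsPosKernel s n A C Γ) (t : ℝ) (z : Circle)
    (v : Fin n → ℂ) :
    A * ∑ r, ‖v r‖ ^ 2 ≤ (∑ r, ∑ q, conj (v r) * blockSymb s n Γ r q t z * v q).re := by
  set H : ℤ → ℂ := fun d => ∑ r, ∑ q, conj (v r) * (blockCoeff s n Γ r q d t * (z : ℂ) ^ d) * v q
    with hH
  have hH1 : HasSum H (∑ r, ∑ q, conj (v r) * blockSymb s n Γ r q t z * v q) :=
    hasSum_sum fun r _ => hasSum_sum fun q _ =>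
      (((h.isCoeff_block r q).summable_symb t z).hasSum.mul_left _).mul_right _
  have hlim := tendsto_average_toeplitz hH1.summable
  rw [hH1.tsum_eq] at hlim
  have hre := (Complex.continuous_re.tendsto _).comp hlim
  refine ge_of_tendsto hre ?_
  filter_upwards [eventually_gt_atTop 0] with N hN
  have hN' : (0 : ℝ) < N := by exact_mod_cast hN
  have hz : (z : ℂ) ≠ 0 := Circle.coe_ne_zero z
  rw [Function.comp_apply, Complex.smul_re, smul_eq_mul, le_inv_mul_iff₀ hN']
  set e := Int.divModEquiv n with he
  have hes : ∀ l r, e.symm (l, r) = l * n + (r : ℕ) := fun l r => rfl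
  obtain ⟨ι, hι⟩ : ∃ ι : ℕ × Fin n ↪ ℤ, ∀ x, ι x = e.symm ((x.1 : ℤ), x.2) :=
    ⟨⟨fun x => e.symm ((x.1 : ℤ), x.2), fun x y hxy => by
      have := e.symm.injective hxy
      simpa [Prod.ext_iff] using this⟩, fun _ => rfl⟩
  obtain ⟨c, hc⟩ : ∃ c : ℤ → ℂ, ∀ x, c (ι x) = v x.2 * (z : ℂ) ^ (x.1 : ℤ) :=
    ⟨fun k => v (e k).2 * (z : ℂ) ^ (e k).1, fun x => by
      simp only [hι, Equiv.apply_symm_apply]⟩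
  have key := h.lower t ((Finset.range N ×ˢ Finset.univ).map ι) c
  have h1 : ∑ k ∈ (Finset.range N ×ˢ Finset.univ).map ι, ‖c k‖ ^ 2 = N * ∑ r, ‖v r‖ ^ 2 := by
    rw [Finset.sum_map, Finset.sum_product]
    simp only [hc, norm_mul_zpow, Finset.sum_const, Finset.card_range, nsmul_eq_mul]
  have h2 : gramForm s Γ t ((Finset.range N ×ˢ Finset.univ).map ι) c
      = ∑ l ∈ Finset.range N, ∑ m ∈ Finset.range N, H ((m : ℤ) - l) := by
    rw [gramForm]
    simp only [Finset.sum_map, Finset.sum_product, hc]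
    refine Finset.sum_congr rfl fun l _ => ?_
    rw [Finset.sum_comm]
    refine Finset.sum_congr rfl fun m _ => ?_
    rw [hH]
    refine Finset.sum_congr rfl fun r _ => Finset.sum_congr rfl fun q _ => ?_
    have h3 := kernel_eq_blockCoeff h.periodic r q l m t
    rw [hι, hι, hes, hes, h3, map_mul, map_zpow₀, ← Circle.coe_inv_eq_conj, Circle.coe_inv,
      zpow_sub₀ hz, inv_zpow]
    field_simp
  rw [h1, h2] at key
  linarith

/-- The symbol is hermitian and each eigenvalue, being the form at a unit eigenvector, is at least
`A`; the determinant is their product. -/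
theorem IsPosKernel.le_norm_det [NeZero n] (h : IsPosKernel s n A C Γ) (hA : 0 < A) (t : ℝ)
    (z : Circle) : A ^ n ≤ ‖(blockSymb s n Γ).det t z‖ := by
  set M : Matrix (Fin n) (Fin n) ℂ := Matrix.of fun r q => blockSymb s n Γ r q t z with hM
  have hdet : (blockSymb s n Γ).det t z = M.det := by
    have := RingHom.map_det
      ((Pi.evalRingHom (fun _ : Circle => ℂ) z).comp (Pi.evalRingHom (fun _ : ℝ => Circle → ℂ) t))
      (blockSymb s n Γ)
    exact this
  have hMh : M.IsHermitian := h.isHermitian_block t z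
  have hev : ∀ i, A ≤ hMh.eigenvalues i := by
    intro i
    rw [hMh.eigenvalues_eq]
    set u := hMh.eigenvectorBasis i with hu
    have h1 := h.lower_block t z u
    have h2 : ∑ r, ‖u r‖ ^ 2 = 1 := by
      rw [← EuclideanSpace.norm_sq_eq, hMh.eigenvectorBasis.orthonormal.1 i, one_pow]
    rw [h2, mul_one] at h1
    refine h1.trans (le_of_eq ?_)
    simp only [dotProduct, Matrix.mulVec, Finset.mul_sum, Pi.star_apply, RCLike.star_def,
      RCLike.re_eq_complex_re, hM, Matrix.of_apply, mul_assoc]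
  rw [hdet, hMh.det_eq_prod_eigenvalues, norm_prod]
  calc A ^ n = ∏ _i : Fin n, A := by simp
    _ ≤ _ := Finset.prod_le_prod (fun _ _ => hA.le) fun i _ => by
      rw [RCLike.norm_ofReal]
      exact (hev i).trans (le_abs_self _)

end Blocks

/-! ### Inverting the kernel -/

section Inverse

/-- A left inverse, with uniformly summable rows, of a hermitian matrix with uniformly summable rows
is hermitian and a right inverse. -/
theorem hermitian_of_mul_eq_one {L M : ℤ → ℤ → ℂ} {C D : ℝ}
    (hM : ∀ i j, M j i = conj (M i j)) (sL : ∀ i, Summable fun j => ‖L i j‖)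
    (bL : ∀ i, ∑' j, ‖L i j‖ ≤ D) (sM : ∀ i, Summable fun j => ‖M i j‖)
    (bM : ∀ i, ∑' j, ‖M i j‖ ≤ C) (h : ∀ i k, ∑' j, L i j * M j k = if i = k then 1 else 0) :
    (∀ i k, L i k = conj (L k i)) ∧ ∀ i k, ∑' j, M i j * L j k = if i = k then 1 else 0 := by
  -- The adjoint of `L M = 1` is `M L* = 1`. Associativity then gives `L = L (M L*) = (L M) L* =
  -- L*`; the summability of the triple products proved next is what justifies it for infinite
  -- matrices.
  have h1 : ∀ j k, ∑' l, M j l * conj (L k l) = if j = k then 1 else 0 := by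
    intro j k
    have h2 := congrArg conj (h k j)
    rw [Complex.conj_tsum] at h2
    calc ∑' l, M j l * conj (L k l) = ∑' l, conj (L k l * M l j) :=
          tsum_congr fun l => by rw [map_mul, ← hM l j, mul_comm]
      _ = if j = k then 1 else 0 := by
          rw [h2]
          split_ifs with h3 h4 h4
          exacts [map_one _, absurd h3.symm h4, absurd h4.symm h3, map_zero _]
  have hD : ∀ k l, ‖L k l‖ ≤ D := fun k l =>
    ((sL k).le_tsum l fun _ _ => norm_nonneg _).trans (bL k)
  have hD0 : 0 ≤ D := (norm_nonneg _).trans (hD 0 0)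
  have hL : ∀ i k, L i k = conj (L k i) := by
    intro i k
    have hle : ∀ j l, ‖L i j * M j l * conj (L k l)‖ ≤ ‖L i j‖ * D * ‖M j l‖ := fun j l => by
      rw [norm_mul, norm_mul, RCLike.norm_conj, mul_right_comm]
      gcongr
      exact hD k l
    have hs1 : ∀ j, Summable fun l => ‖L i j * M j l * conj (L k l)‖ := fun j =>
      Summable.of_nonneg_of_le (fun _ => norm_nonneg _) (hle j) ((sM j).mul_left _)
    have hs : Summable fun q : ℤ × ℤ => ‖L i q.1 * M q.1 q.2 * conj (L k q.2)‖ := by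
      rw [summable_prod_of_nonneg fun _ => norm_nonneg _]
      refine ⟨hs1, Summable.of_nonneg_of_le (fun _ => tsum_nonneg fun _ => norm_nonneg _)
        (fun j => ?_) ((sL i).mul_right (D * C))⟩
      refine ((hs1 j).tsum_le_tsum (hle j) ((sM j).mul_left _)).trans ?_
      rw [tsum_mul_left, ← mul_assoc]
      gcongr
      exact bM j
    have h3 := Summable.tsum_comm (f := fun j l => L i j * M j l * conj (L k l)) hs.of_norm
    simp only [mul_assoc, tsum_mul_left, h1] at h3
    simp only [← mul_assoc, tsum_mul_right, h, ite_mul, mul_ite, mul_one, mul_zero, one_mul,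
      zero_mul] at h3
    rw [tsum_ite_eq] at h3
    rw [← h3]
    exact (tsum_eq_single i fun l hl => if_neg hl.symm).trans (if_pos rfl)
  refine ⟨hL, fun i k => ?_⟩
  rw [← h1 i k]
  exact tsum_congr fun j => by rw [hL j k]

variable {s : ℝ} {n : ℕ} {A C : ℝ} {Γ : ℤ → ℝ → ℂ}

theorem IsCoeff.summable_conv {X : Type*} [MeasurableSpace X] {c d : ℤ → X → ℂ} {C D : ℝ}
    (hc : IsCoeff c C) (hd : IsCoeff d D) (x : X) (k : ℤ) :
    Summable fun j : ℤ => c j x * d (k - j) x :=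
  Summable.of_norm ((hc.summable_prod hd x).prod_symm.prod_factor k)

theorem IsCoeff.summable_sub {X : Type*} [MeasurableSpace X] {c : ℤ → X → ℂ} {C : ℝ}
    (hc : IsCoeff c C) (x : X) (i : ℤ) : Summable fun j => ‖c (j - i) x‖ :=
  (hc.summable x).comp_injective (i := fun j => j - i) (sub_left_injective)

theorem IsCoeff.tsum_sub_le {X : Type*} [MeasurableSpace X] {c : ℤ → X → ℂ} {C : ℝ}
    (hc : IsCoeff c C) (x : X) (i : ℤ) : ∑' j, ‖c (j - i) x‖ ≤ C := by
  rw [← (Equiv.addRight i).tsum_eq]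
  simpa using hc.bdd x

theorem le_abs_of_residue {n K : ℕ} (q : Fin n) {l : ℤ} (h : ((n * (K + 1) : ℕ) : ℤ) ≤ |l * n + (q : ℕ)|) :
    (K : ℤ) ≤ |l| := by
  by_contra! hl
  have hq := q.2
  have h1 : |l * n + (q : ℕ)| ≤ |l| * n + (q : ℕ) := by
    refine (abs_add_le _ _).trans (le_of_eq ?_)
    rw [abs_mul, Nat.abs_cast, Nat.abs_cast]
  push_cast at h
  nlinarith

theorem tsum_tail_le_of_residues [NeZero n] {f : ℤ → ℂ}
    (K : Fin n → ℕ) {δ : ℝ}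
    (h : ∀ q : Fin n, (Summable fun l : ℤ => ‖f (l * n + (q : ℕ))‖) ∧
      ∑' l : ℤ, (if (K q : ℤ) ≤ |l| then ‖f (l * n + (q : ℕ))‖ else 0) ≤ δ) :
    ∑' k : ℤ, (if ((n * (∑ q, K q + 1) : ℕ) : ℤ) ≤ |k| then ‖f k‖ else 0) ≤ n * δ := by
  generalize hN : ((n * (∑ q, K q + 1) : ℕ) : ℤ) = N
  have hle : ∀ (q : Fin n) (l : ℤ), (if N ≤ |l * n + (q : ℕ)| then ‖f (l * n + (q : ℕ))‖ else 0)
      ≤ if (K q : ℤ) ≤ |l| then ‖f (l * n + (q : ℕ))‖ else 0 := by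
    intro q l
    by_cases hl : N ≤ |l * n + (q : ℕ)|
    · have h1 : (∑ q, K q : ℕ) ≤ |l| := le_abs_of_residue q (hN ▸ hl)
      have h2 : K q ≤ ∑ q, K q :=
        Finset.single_le_sum (fun _ _ => Nat.zero_le _) (Finset.mem_univ q)
      rw [if_pos hl, if_pos (by omega)]
    · rw [if_neg hl]
      split_ifs
      exacts [norm_nonneg _, le_rfl]
  have hs1 := fun q => summable_ite_le (h q).1 (fun _ => norm_nonneg _) (K q)
  have hs2 : ∀ q : Fin n, Summable fun l : ℤ =>
      if N ≤ |l * n + (q : ℕ)| then ‖f (l * n + (q : ℕ))‖ else 0 := fun q =>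
    Summable.of_nonneg_of_le (fun l => by split_ifs; exacts [norm_nonneg _, le_rfl]) (hle q) (hs1 q)
  rw [(hasSum_of_residues (f := fun k => if N ≤ |k| then ‖f k‖ else 0)
    fun q => (hs2 q).hasSum).tsum_eq]
  refine (Finset.sum_le_sum (g := fun _ => δ) fun q _ =>
    ((hs2 q).tsum_le_tsum (hle q) (hs1 q)).trans (h q).2).trans (le_of_eq ?_)
  simp

/-- The first row of the inverse of the block symbol. -/
theorem IsPosKernel.exists_block_inverse [NeZero n] (h : IsPosKernel s n A C Γ) (hA : 0 < A) :
    ∃ (d : Fin n → ℤ → ℝ → ℂ) (D : Fin n → ℝ), (∀ q, IsCoeff (d q) (D q)) ∧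
      (∀ q, IsTight (symb (d q))) ∧
      ∀ r t z, ∑ q, symb (d q) t z * blockSymb s n Γ q r t z = if r = 0 then 1 else 0 := by
  set M := blockSymb s n Γ with hM
  have hdet : ∀ t z, A ^ n ≤ ‖M.det t z‖ := fun t z => h.le_norm_det hA t z
  -- Cramer's rule: the entries of the inverse are cofactors over a determinant bounded below by `A
  -- ^ n`, so the uniform Wiener lemma applies.
  have ht : ∀ q, IsTight ((fun t z => (M.det t z)⁻¹) * M.adjugate 0 q) := fun q =>
    ((isTight_det h.isTight_block).inv (by positivity) hdet).mul (isTight_adjugate h.isTight_block 0 q)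
  choose D _ d hd hN using fun q => (ht q).exists_hasW
  refine ⟨d, D, hd, fun q => hN q ▸ ht q, fun r t z => ?_⟩
  have h1 := congr_fun (congr_fun (congr_fun (congr_fun M.adjugate_mul 0) r) t) z
  have h0 : M.det t z ≠ 0 := norm_pos_iff.1 ((by positivity : 0 < A ^ n).trans_le (hdet t z))
  simp only [← hN, Pi.mul_apply, mul_assoc, ← Finset.mul_sum]
  rw [Matrix.mul_apply, Finset.sum_apply, Finset.sum_apply] at h1
  simp only [Pi.mul_apply] at h1
  rw [h1, Matrix.smul_apply, Matrix.one_apply]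
  simp only [eq_comm (a := (0 : Fin n))]
  split_ifs
  · simp [h0]
  · simp

/-- Only row `0` of the inverse symbol is needed, because the other rows at `t` are row `0` at
translated points. Its entries, interleaved over the residues modulo `n`, form one kernel. -/
theorem IsPosKernel.exists_left_inverse [NeZero n] (h : IsPosKernel s n A C Γ) (hA : 0 < A) :
    ∃ (Δ : ℤ → ℝ → ℂ) (D : ℝ), IsCoeff Δ D ∧
      (∀ ε : ℝ, 0 < ε → ∃ K : ℕ, ∀ t, ∑' k : ℤ, (if (K : ℤ) ≤ |k| then ‖Δ k t‖ else 0) ≤ ε) ∧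
      ∀ t k, ∑' j, Δ j t * Γ (k - j) (t - j * s) = if k = 0 then 1 else 0 := by
  obtain ⟨d, D, hd, htd, hinv⟩ := h.exists_block_inverse hA
  have hn : (0 : ℝ) < n := by exact_mod_cast NeZero.pos n
  obtain ⟨Δ, hΔ⟩ : ∃ Δ : ℤ → ℝ → ℂ, ∀ l (q : Fin n), Δ (l * n + (q : ℕ)) = d q l := by
    refine ⟨fun k => d (Int.divModEquiv n k).2 (Int.divModEquiv n k).1, fun l q => ?_⟩
    change d (Int.divModEquiv n ((Int.divModEquiv n).symm (l, q))).2
      (Int.divModEquiv n ((Int.divModEquiv n).symm (l, q))).1 = _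
    rw [Equiv.apply_symm_apply]
  have hidx : ∀ k : ℤ, ∃ (l : ℤ) (q : Fin n), k = l * n + (q : ℕ) := fun k =>
    ⟨_, _, ((Int.divModEquiv n).symm_apply_apply k).symm⟩
  have hsum : ∀ t, HasSum (fun k => ‖Δ k t‖) (∑ q, ∑' l, ‖d q l t‖) := fun t =>
    hasSum_of_residues fun q => by
      simp only [hΔ]
      exact ((hd q).summable t).hasSum
  have hcoeff : IsCoeff Δ (∑ q, D q) := by
    refine ⟨fun k => ?_, fun t => (hsum t).summable, fun t => ?_⟩
    · obtain ⟨l, q, rfl⟩ := hidx k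
      rw [hΔ]
      exact (hd q).meas l
    · rw [(hsum t).tsum_eq]
      exact Finset.sum_le_sum fun q _ => (hd q).bdd t
  -- Equality of the symbols at every `z` is converted into equality of coefficients.
  have hconv : ∀ t r m, ∑ q, conv (d q) (blockCoeff s n Γ q r) m t
      = if m = 0 then (if r = 0 then 1 else 0) else 0 := by
    intro t r m
    have hc := fun q => (hd q).conv (h.isCoeff_block q r)
    refine congr_fun (coeff_unique (e := fun m => ∑ q, conv (d q) (blockCoeff s n Γ q r) m t)
      (e' := fun m : ℤ => if m = 0 then (if r = 0 then 1 else 0) else 0)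
      (summable_norm_iff.2 (summable_sum fun q _ => ((hc q).summable t).of_norm)) ?_
      fun z => ?_) m
    · refine summable_of_hasFiniteSupport ((Set.finite_singleton (0 : ℤ)).subset fun k hk => ?_)
      by_contra hk0
      exact hk (by simp [show k ≠ 0 from hk0])
    · simp only [Finset.sum_mul]
      rw [(hasSum_sum fun q _ => ((hc q).summable_symb t z).hasSum).tsum_eq,
        tsum_eq_single 0 fun k hk => by rw [if_neg hk, zero_mul], if_pos rfl, zpow_zero, mul_one,
        ← hinv r t z]
      refine Finset.sum_congr rfl fun q _ => ?_
      exact congr_fun (congr_fun ((hd q).symb_conv (h.isCoeff_block q r)) t) z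
  have hleft : ∀ t k, ∑' j, Δ j t * Γ (k - j) (t - j * s) = if k = 0 then 1 else 0 := by
    intro t k
    obtain ⟨m, r, rfl⟩ := hidx k
    rw [(hasSum_of_residues (g := fun q => conv (d q) (blockCoeff s n Γ q r) m t)
      fun q => ?_).tsum_eq, hconv]
    · have hr := r.2
      have hn' : (0 : ℤ) < n := by exact_mod_cast NeZero.pos n
      by_cases hm : m = 0
      · have h0 : (m * n + (r : ℕ) = 0) = (r = 0) := by
          rw [hm, zero_mul, zero_add, Nat.cast_eq_zero, Fin.ext_iff, Fin.val_zero]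
        rw [if_pos hm]
        simp only [h0]
      · rw [if_neg hm, if_neg]
        intro h0
        rcases lt_or_gt_of_ne hm with hm | hm <;> nlinarith
    · simp only [hΔ, kernel_eq_blockCoeff h.periodic]
      exact ((hd q).summable_conv (h.isCoeff_block q r) t m).hasSum
  refine ⟨Δ, ∑ q, D q, hcoeff, fun ε hε => ?_, hleft⟩
  choose K hK using fun q => (htd q).tail_le (hd q) (ε := ε / n) (by positivity)
  exact ⟨_, fun t => (tsum_tail_le_of_residues K (δ := ε / n)
    fun q => ⟨by simpa only [hΔ] using (hd q).summable t, by simpa only [hΔ] using hK q t⟩).trans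
    (le_of_eq (by field_simp))⟩

/-- The left inverse identity at every point of a fibre says that two infinite matrices multiply to
the identity. Hermitian symmetry of one of them then yields both the symmetry of `Δ`, needed for its
column bounds, and the right inverse identity. -/
theorem IsPosKernel.exists_inverse [NeZero n] (h : IsPosKernel s n A C Γ) (hA : 0 < A) :
    ∃ (Δ : ℤ → ℝ → ℂ) (D : ℝ), IsCoeff Δ D ∧
      (∀ ε : ℝ, 0 < ε → ∃ K : ℕ, ∀ t, ∑' k : ℤ, (if (K : ℤ) ≤ |k| then ‖Δ k t‖ else 0) ≤ ε) ∧
      (∀ k t, Δ (-k) t = conj (Δ k (t + k * s))) ∧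
      (∀ t k, ∑' j, Δ j t * Γ (k - j) (t - j * s) = if k = 0 then 1 else 0) ∧
      ∀ t k, ∑' j, Γ j t * Δ (k - j) (t - j * s) = if k = 0 then 1 else 0 := by
  obtain ⟨Δ, D, hcoeff, htail, hleft⟩ := h.exists_left_inverse hA
  have hboth := fun t => hermitian_of_mul_eq_one (L := fun i j => Δ (j - i) (t - i * s))
    (M := fun i j => Γ (j - i) (t - i * s)) (C := C) (D := D)
    (fun i j => h.herm_entry j i t)
    (fun i => hcoeff.summable_sub _ i) (fun i => hcoeff.tsum_sub_le _ i)
    (fun i => h.coeff.summable_sub _ i) (fun i => h.coeff.tsum_sub_le _ i)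
    fun i k => by
      have h1 := hleft (t - i * s) (k - i)
      rw [← (Equiv.subRight i).tsum_eq] at h1
      have h2 : (if i = k then (1 : ℂ) else 0) = if k - i = 0 then 1 else 0 := by
        split_ifs <;> first | rfl | omega
      rw [h2, ← h1]
      refine tsum_congr fun j => ?_
      simp only [Equiv.subRight_apply]
      congr 2
      · ring
      · push_cast
        ring
  refine ⟨Δ, D, hcoeff, htail, fun k t => ?_, hleft, fun t k => ?_⟩
  · have h1 := (hboth (t + k * s)).1 k 0
    simpa using h1
  · have h1 := (hboth t).2 0 k
    simpa [eq_comm (a := (0 : ℤ))] using h1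

end Inverse

/-! ### From almost everywhere bounds to a kernel good everywhere, and conclusion -/

section Kernel

variable {a b s : ℝ} {C : ℝ} {Γ : ℤ → ℝ → ℂ}

theorem tsum_enorm_eq {ι : Type*} {f : ι → ℂ} (hf : Summable fun k => ‖f k‖) :
    ∑' k, ‖f k‖ₑ = ENNReal.ofReal (∑' k, ‖f k‖) := by
  rw [ENNReal.ofReal_tsum_of_nonneg (fun _ => norm_nonneg _) hf]
  simp only [ofReal_norm]

theorem tsum_norm_le_of_enorm {ι : Type*} {f : ι → ℂ} {C : ℝ} (hC : 0 ≤ C)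
    (h : ∑' k, ‖f k‖ₑ ≤ ENNReal.ofReal C) : (Summable fun k => ‖f k‖) ∧ ∑' k, ‖f k‖ ≤ C := by
  have hs : Summable fun k => ‖f k‖ :=
    tsum_enorm_ne_top_iff_summable_norm.1 (ne_top_of_le_ne_top ENNReal.ofReal_ne_top h)
  exact ⟨hs, by rwa [tsum_enorm_eq hs, ENNReal.ofReal_le_ofReal_iff hC] at h⟩

theorem tsum_subtype_enorm_eq {f : ℤ → ℂ} (K : ℤ) :
    ∑' k : {k : ℤ // K ≤ |k|}, ‖f k‖ₑ = ∑' k : ℤ, ‖if K ≤ |k| then f k else 0‖ₑ := by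
  rw [show (∑' k : {k : ℤ // K ≤ |k|}, ‖f k‖ₑ)
    = ∑' k : ℤ, Set.indicator {k : ℤ | K ≤ |k|} (fun k => ‖f k‖ₑ) k from
    tsum_subtype {k : ℤ | K ≤ |k|} fun k => ‖f k‖ₑ]
  refine tsum_congr fun k => ?_
  by_cases hk : K ≤ |k|
  · rw [if_pos hk, Set.indicator_of_mem (s := {k : ℤ | K ≤ |k|}) hk]
  · rw [if_neg hk, Set.indicator_of_notMem (s := {k : ℤ | K ≤ |k|}) hk, enorm_zero]

theorem norm_ite_zero (p : Prop) [Decidable p] (w : ℂ) :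
    ‖if p then w else 0‖ = if p then ‖w‖ else 0 := by
  split_ifs <;> simp

theorem IsCoeff.isSchurKernel (hc : IsCoeff Γ C) (hh : ∀ k t, Γ (-k) t = conj (Γ k (t + k * s))) :
    IsSchurKernel s Γ C.toNNReal := by
  have h1 : ∀ t, ∑' k, ‖Γ k t‖ₑ ≤ C.toNNReal := fun t => by
    rw [tsum_enorm_eq (hc.summable t)]
    exact ENNReal.ofReal_le_ofReal (hc.bdd t)
  refine ⟨hc.meas, ae_of_all _ h1, ae_of_all _ fun t => ?_⟩
  refine le_trans (le_of_eq ?_) (h1 t)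
  rw [← (Equiv.neg ℤ).tsum_eq fun k => ‖Γ k t‖ₑ]
  refine tsum_congr fun k => ?_
  rw [Equiv.neg_apply, hh, RCLike.enorm_conj]

theorem IsCoeff.tightRows (hc : IsCoeff Γ C)
    (ht : ∀ ε : ℝ, 0 < ε → ∃ K : ℕ, ∀ t, ∑' k : ℤ, (if (K : ℤ) ≤ |k| then ‖Γ k t‖ else 0) ≤ ε) :
    TightRows Γ := by
  intro ε hε
  obtain ⟨K, hK⟩ := ht ε hε
  refine ⟨K, ae_of_all _ fun t => ?_⟩
  have hs := summable_ite_le (hc.summable t) (fun _ => norm_nonneg _) K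
  rw [tsum_subtype_enorm_eq (f := fun k => Γ k t), tsum_enorm_eq (by simpa only [norm_ite_zero] using hs)]
  simp only [norm_ite_zero]
  exact ENNReal.ofReal_le_ofReal (hK t)

theorem IsSchurKernel.toCLM_toCLM {Δ : ℤ → ℝ → ℂ} {D E : ℝ≥0} (hΔ : IsSchurKernel s Δ D)
    (hΓ : IsSchurKernel s Γ E) {p : ℝ≥0∞} [hp : Fact (1 ≤ p)]
    (h : ∀ t k, ∑' j, Δ j t * Γ (k - j) (t - j * s) = if k = 0 then 1 else 0)
    (f : Lp ℂ p (volume : Measure ℝ)) : hΔ.toCLM p (hΓ.toCLM p f) = f :=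
  Lp.ext ((hΔ.toCLM_ae _).trans ((kerSum_congr_ae (hΓ.toCLM_ae f)).trans
    (kerSum_kerSum_ae hΔ hΓ hp.out (Lp.memLp f) (ae_of_all _ h))))

/-- Discarding all translates of a null set costs nothing. Invariance is needed because symmetry,
periodicity and the form compare the kernel at different points of one fibre. -/
theorem exists_invariant_good_set {p : ℝ → Prop} (h : ∀ᵐ t : ℝ, p t) (s : ℝ) :
    ∃ Ω : Set ℝ, MeasurableSet Ω ∧ (∀ᵐ t : ℝ, t ∈ Ω) ∧ (∀ t ∈ Ω, p t) ∧
      ∀ (k : ℤ) (t : ℝ), t + k * s ∈ Ω ↔ t ∈ Ω := by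
  set N := toMeasurable volume {t | ¬ p t} with hN
  have hN0 : ∀ᵐ t : ℝ, t ∉ N := by
    rw [ae_iff]
    simp only [not_not, Set.ofPred_mem_eq]
    rw [hN, measure_toMeasurable]
    exact h
  refine ⟨⋂ k : ℤ, (fun t => t - k * s) ⁻¹' Nᶜ, MeasurableSet.iInter fun k =>
    (measurable_sub_const _) (measurableSet_toMeasurable _ _).compl, ?_, fun t ht => ?_, fun k t => ?_⟩
  · filter_upwards [ae_forall_sub hN0 s] with t ht
    exact Set.mem_iInter.2 ht
  · by_contra hpt
    have h0 := Set.mem_iInter.1 ht 0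
    simp only [Int.cast_zero, zero_mul, sub_zero] at h0
    exact h0 (subset_toMeasurable _ _ hpt)
  · simp only [Set.mem_iInter, Set.mem_preimage]
    constructor
    · intro h1 j
      have := h1 (j + k)
      rwa [show t + k * s - ((j + k : ℤ) : ℝ) * s = t - j * s by push_cast; ring] at this
    · intro h1 j
      have := h1 (j - k)
      rwa [show t - ((j - k : ℤ) : ℝ) * s = t + k * s - j * s by push_cast; ring] at this

/-- A shift by a multiple of `a` reindexes the defining sum over `n`. Rationality of `ab` makes some
positive multiple of `1/b` such a shift. -/
theorem autoCorr_add_period (g : ℝ → ℂ) {c : ℝ} {m : ℤ} (hc : c = m * a) (k : ℤ) (t : ℝ) :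
    autoCorr a b g k (t + c) = autoCorr a b g k t := by
  unfold autoCorr
  rw [← (Equiv.addRight m).tsum_eq]
  refine tsum_congr fun n => ?_
  have h1 : t + c - ((Equiv.addRight m n : ℤ) : ℝ) * a = t - n * a := by
    rw [hc, Equiv.coe_addRight]
    push_cast
    ring
  rw [h1]

/-- A version of the kernel of the frame operator which satisfies all required bounds everywhere. -/
theorem exists_isPosKernel (ha : 0 < a) (hb : 0 < b) {g : LTwo} {A B : ℝ} (hA : 0 < A)
    (hfr : ∀ f : LTwo, Summable (fun i => ‖inner ℂ (whSystem a b g i) f‖ ^ 2) ∧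
    A * ‖f‖ ^ 2 ≤ ∑' i, ‖inner ℂ (whSystem a b g i) f‖ ^ 2 ∧
    ∑' i, ‖inner ℂ (whSystem a b g i) f‖ ^ 2 ≤ B * ‖f‖ ^ 2)
    (hCC : CCCondition a b g) (hU : UniformCCCondition a b g) {n : ℕ} {m : ℤ}
    (hnm : n * b⁻¹ = m * a) :
    ∃ (Γ : ℤ → ℝ → ℂ) (C : ℝ), IsPosKernel b⁻¹ n A C Γ ∧
      ∀ᵐ t : ℝ, ∀ k, Γ k t = (b : ℂ)⁻¹ * autoCorr a b g k t := by
  obtain ⟨B', hB', hB⟩ := hCC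
  choose K hK0 hK using hU
  have hgood : ∀ᵐ t : ℝ, (∀ (F : Finset ℤ) (c : ℤ → ℂ),
      b * A * ∑ k ∈ F, ‖c k‖ ^ 2 ≤ (gramForm b⁻¹ (autoCorr a b g) t F c).re) ∧
      ∑' k : ℤ, ‖autoCorr a b g k t‖ₑ ≤ ENNReal.ofReal B' ∧
      ∀ j : ℕ, ∑' k : {k : ℤ // (K (1 / ((j : ℝ) + 1)) Nat.one_div_pos_of_nat : ℤ) ≤ |k|},
        ‖autoCorr a b g k t‖ₑ < ENNReal.ofReal (1 / ((j : ℝ) + 1)) := by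
    filter_upwards [ae_gramForm_bounds ha hb hfr, hB,
      ae_all_iff.2 fun j : ℕ => hK (1 / ((j : ℝ) + 1)) Nat.one_div_pos_of_nat] with t h1 h2 h3
    exact ⟨fun F c => (h1 F c).1, h2, h3⟩
  obtain ⟨Ω, hΩ, hΩae, hΩp, hΩinv⟩ := exists_invariant_good_set hgood b⁻¹
  classical
  -- Off the good set the kernel is replaced by `A` times the identity, which is hermitian, periodic
  -- and banded, and attains the lower bound `A`.
  obtain ⟨Γ, hΓ, hΓ'⟩ : ∃ Γ : ℤ → ℝ → ℂ,
      (∀ t ∈ Ω, ∀ k, Γ k t = (b : ℂ)⁻¹ * autoCorr a b g k t) ∧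
      (∀ t ∉ Ω, ∀ k, Γ k t = if k = 0 then (A : ℂ) else 0) :=
    ⟨fun k t => if t ∈ Ω then (b : ℂ)⁻¹ * autoCorr a b g k t else if k = 0 then (A : ℂ) else 0,
      fun t ht k => if_pos ht, fun t ht k => if_neg ht⟩
  have hbn : ‖(b : ℂ)⁻¹‖ = b⁻¹ := by
    rw [norm_inv, Complex.norm_real, Real.norm_of_nonneg hb.le]
  have hsub : ∀ (k : ℤ) (t : ℝ), t - k * b⁻¹ ∈ Ω ↔ t ∈ Ω := fun k t => by
    rw [← hΩinv (-k) t]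
    push_cast
    rw [neg_mul, sub_eq_add_neg]
  have hrow : ∀ t, (Summable fun k => ‖Γ k t‖) ∧ ∑' k, ‖Γ k t‖ ≤ b⁻¹ * B' + A := by
    intro t
    by_cases ht : t ∈ Ω
    · obtain ⟨h1, h2⟩ := tsum_norm_le_of_enorm hB'.le (hΩp t ht).2.1
      simp only [hΓ t ht, norm_mul, hbn]
      refine ⟨h1.mul_left _, ?_⟩
      rw [tsum_mul_left]
      have : b⁻¹ * ∑' k, ‖autoCorr a b g k t‖ ≤ b⁻¹ * B' := by gcongr
      linarith
    · simp only [hΓ' t ht, norm_ite_zero, Complex.norm_real, Real.norm_of_nonneg hA.le]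
      refine ⟨(hasSum_ite_eq (0 : ℤ) A).summable, ?_⟩
      rw [tsum_ite_eq]
      have : 0 < b⁻¹ * B' := by positivity
      linarith
  refine ⟨Γ, b⁻¹ * B' + A, ⟨⟨fun k => ?_, fun t => (hrow t).1, fun t => (hrow t).2⟩, fun ε hε => ?_,
    fun k t => ?_, fun k t => ?_, fun t F c => ?_⟩, ?_⟩
  · have h1 : Γ k = Ω.piecewise (fun t => (b : ℂ)⁻¹ * autoCorr a b g k t)
        (fun _ => if k = 0 then (A : ℂ) else 0) := by
      ext t
      by_cases ht : t ∈ Ω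
      · rw [Set.piecewise_eq_of_mem _ _ _ ht, hΓ t ht]
      · rw [Set.piecewise_eq_of_notMem _ _ _ ht, hΓ' t ht]
    rw [h1]
    exact ((measurable_autoCorr (measurable_coeFn g) k).const_mul _).piecewise hΩ measurable_const
  -- Only the countable family of tolerances `1/(j + 1)` survives the passage to one null set; the
  -- target is `b ε` because `Γ` carries the factor `1/b`.
  · obtain ⟨j, hj⟩ := exists_nat_one_div_lt (mul_pos hb hε)
    refine ⟨K (1 / ((j : ℝ) + 1)) Nat.one_div_pos_of_nat, fun t => ?_⟩
    have hKj := hK0 (1 / ((j : ℝ) + 1)) Nat.one_div_pos_of_nat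
    by_cases ht : t ∈ Ω
    · have h1 := ((hΩp t ht).2.2 j).le
      rw [tsum_subtype_enorm_eq (f := fun k => autoCorr a b g k t)] at h1
      have h2 := (tsum_norm_le_of_enorm Nat.one_div_pos_of_nat.le h1).2
      simp only [norm_ite_zero] at h2
      calc _ = b⁻¹ * ∑' k : ℤ, (if (K (1 / ((j : ℝ) + 1)) Nat.one_div_pos_of_nat : ℤ) ≤ |k|
              then ‖autoCorr a b g k t‖ else 0) := by
            rw [← tsum_mul_left]
            refine tsum_congr fun k => ?_
            rw [hΓ t ht, norm_mul, hbn, mul_ite, mul_zero]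
        _ ≤ b⁻¹ * (b * ε) := by
            gcongr
            exact h2.trans hj.le
        _ = ε := by field_simp
    -- The only nonzero entry here is at `k = 0`, and `K > 0` keeps it out of the tail.
    · rw [show (fun k : ℤ => if (K (1 / ((j : ℝ) + 1)) Nat.one_div_pos_of_nat : ℤ) ≤ |k|
          then ‖Γ k t‖ else 0) = fun _ => 0 from ?_, tsum_zero]
      · exact hε.le
      · ext k
        rw [hΓ' t ht]
        split_ifs with h1 h2
        · rw [h2, abs_zero] at h1
          omega
        · exact norm_zero
        · rfl
  · have h1 : t + n * b⁻¹ ∈ Ω ↔ t ∈ Ω := by simpa using hΩinv n t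
    by_cases ht : t ∈ Ω
    · rw [hΓ t ht, hΓ _ (h1.2 ht), autoCorr_add_period _ hnm]
    · rw [hΓ' t ht, hΓ' _ (mt h1.1 ht)]
  · by_cases ht : t ∈ Ω
    · rw [hΓ t ht, hΓ _ ((hΩinv k t).2 ht), autoCorr_neg, map_mul, map_inv₀, Complex.conj_ofReal,
        div_eq_mul_inv]
    · rw [hΓ' t ht, hΓ' _ (mt (hΩinv k t).1 ht)]
      simp only [neg_eq_zero]
      split_ifs <;> simp
  · by_cases ht : t ∈ Ω
    · have h1 : gramForm b⁻¹ Γ t F c = (b : ℂ)⁻¹ * gramForm b⁻¹ (autoCorr a b g) t F c := by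
        simp only [gramForm, Finset.mul_sum]
        refine Finset.sum_congr rfl fun j _ => Finset.sum_congr rfl fun i _ => ?_
        rw [hΓ _ ((hsub j t).2 ht)]
        ring
      rw [h1, ← Complex.ofReal_inv, Complex.re_ofReal_mul, le_inv_mul_iff₀ hb, ← mul_assoc]
      exact (hΩp t ht).1 F c
    · have h1 : gramForm b⁻¹ Γ t F c = ((A * ∑ k ∈ F, ‖c k‖ ^ 2 : ℝ) : ℂ) := by
        simp only [gramForm]
        push_cast
        rw [Finset.mul_sum]
        refine Finset.sum_congr rfl fun j hj => ?_
        simp only [hΓ' _ (mt (hsub j t).1 ht), sub_eq_zero, mul_ite, mul_zero, ite_mul, zero_mul]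
        rw [Finset.sum_ite_eq' F j, if_pos hj, ← Complex.conj_mul']
        ring
      rw [h1, Complex.ofReal_re]
  · filter_upwards [hΩae] with t ht using hΓ t ht

theorem IsSchurKernel.extendsFrameOp_of_ae (ha : 0 < a) (hb : 0 < b) {g : LTwo} {D E : ℝ≥0}
    (hΓ : IsSchurKernel b⁻¹ Γ D) (hG : IsSchurKernel b⁻¹ (autoCorr a b g) E)
    (h : ∀ᵐ t : ℝ, ∀ k, Γ k t = (b : ℂ)⁻¹ * autoCorr a b g k t) (p : ℝ≥0∞) [Fact (1 ≤ p)] :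
    ExtendsFrameOp a b g id (hΓ.toCLM p) := by
  intro f u hfu
  obtain ⟨v, hv, hfv⟩ := hG.extendsFrameOp ha hb p (f := f) hfu
  refine ⟨v, hv, ?_⟩
  filter_upwards [hΓ.toCLM_ae f, hG.toCLM_ae f, hfv, h,
    Lp.coeFn_smul (b : ℂ)⁻¹ (hG.toCLM p f)] with t h1 h2 h3 h4 h5
  rw [h1, ← h3, h5, Pi.smul_apply, h2, smul_eq_mul, kerSum, kerSum, ← tsum_mul_left]
  simp only [h4, mul_assoc]

theorem ccCondition_iff (ha : 0 < a) (hb : 0 < b) (g : LTwo) :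
    CCCondition a b g ↔
      (∀ (p : ℝ≥0∞) [Fact (1 ≤ p)], p ≠ ∞ →
        ∃ T : Lp ℂ p (volume : Measure ℝ) →L[ℂ] Lp ℂ p (volume : Measure ℝ),
          ExtendsFrameOp a b g id T) ∧
      (∃ T : LInftyZero →L[ℂ] Lp ℂ ∞ (volume : Measure ℝ),
        ExtendsFrameOp a b g Subtype.val T) := by
  refine ⟨fun ⟨B, _, hB⟩ => ?_, fun ⟨_, T, hT⟩ => ccCondition_of_extends ha hb hT⟩
  have hG := CCCondition.isSchurKernel (measurable_coeFn g) hB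
  exact ⟨fun p _ _ => ⟨(b : ℂ)⁻¹ • hG.toCLM p, fun f u hfu => hG.extendsFrameOp ha hb p hfu⟩,
    ((b : ℂ)⁻¹ • hG.toCLM ∞).comp LInftyZero.subtypeL,
    fun f u hfu => hG.extendsFrameOp ha hb ∞ hfu⟩

theorem exists_equiv_extendsFrameOp (ha : 0 < a) (hb : 0 < b) {g : LTwo}
    (hab : ∃ q : ℚ, a * b = q) (hfr : IsFrame (whSystem a b g)) (hU : UniformCCCondition a b g) :
    (∀ (p : ℝ≥0∞) [Fact (1 ≤ p)], p ≠ ∞ →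
      ∃ T : Lp ℂ p (volume : Measure ℝ) ≃L[ℂ] Lp ℂ p (volume : Measure ℝ),
        ExtendsFrameOp a b g id T) ∧
    (∃ T : LInftyZero ≃L[ℂ] LInftyZero,
      ExtendsFrameOp a b g Subtype.val (fun f => (T f).val)) := by
  obtain ⟨q, hq⟩ := hab
  have hCC := hU.ccCondition ha hb hfr
  obtain ⟨A, B, hA, hfr⟩ := hfr
  have hq0 : 0 < q := by
    have : (0 : ℝ) < q := hq ▸ mul_pos ha hb
    exact_mod_cast this
  have hnum : ((q.num.toNat : ℤ) : ℤ) = q.num := Int.toNat_of_nonneg (Rat.num_nonneg.2 hq0.le)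
  have : NeZero q.num.toNat := ⟨by have := Rat.num_pos.2 hq0; omega⟩
  -- From `ab = num/den`: the numerator, which is positive, is the block size, and the denominator
  -- counts the periods `a`.
  have hnm : (q.num.toNat : ℝ) * b⁻¹ = ((q.den : ℤ) : ℝ) * a := by
    have h1 : ((q.num.toNat : ℕ) : ℝ) = ((q.num : ℤ) : ℝ) := by exact_mod_cast congrArg (Int.cast (R := ℝ)) hnum
    have h2 : (q.num : ℝ) = q * q.den := by exact_mod_cast (Rat.mul_den_eq_num q).symm
    rw [h1, h2, ← hq]
    push_cast
    field_simp
  obtain ⟨Γ, C, hpos, hΓG⟩ := exists_isPosKernel ha hb hA hfr hCC hU hnm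
  obtain ⟨Δ, D, hΔ, hΔt, hΔh, hΔΓ, hΓΔ⟩ := hpos.exists_inverse hA
  obtain ⟨B', -, hB'⟩ := hCC
  have hG := CCCondition.isSchurKernel (measurable_coeFn g) hB'
  have kΓ := hpos.coeff.isSchurKernel hpos.herm
  have kΔ := hΔ.isSchurKernel hΔh
  refine ⟨fun p _ _ => ⟨ContinuousLinearEquiv.equivOfInverse (kΓ.toCLM p) (kΔ.toCLM p)
    (kΔ.toCLM_toCLM kΓ hΔΓ) (kΓ.toCLM_toCLM kΔ hΓΔ), kΓ.extendsFrameOp_of_ae ha hb hG hΓG p⟩, ?_⟩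
  have mΓ : ∀ f : LInftyZero, kΓ.toCLM ∞ f ∈ LInftyZero := fun f =>
    kΓ.toCLM_mem_LInftyZero (hpos.coeff.tightRows hpos.tail) f.2
  have mΔ : ∀ f : LInftyZero, kΔ.toCLM ∞ f ∈ LInftyZero := fun f =>
    kΔ.toCLM_mem_LInftyZero (hΔ.tightRows hΔt) f.2
  exact ⟨ContinuousLinearEquiv.equivOfInverse
    (((kΓ.toCLM ∞).comp LInftyZero.subtypeL).codRestrict LInftyZero mΓ)
    (((kΔ.toCLM ∞).comp LInftyZero.subtypeL).codRestrict LInftyZero mΔ)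
    (fun f => Subtype.ext (kΔ.toCLM_toCLM kΓ hΔΓ f.1))
    (fun f => Subtype.ext (kΓ.toCLM_toCLM kΔ hΓΔ f.1)),
    fun f u hfu => kΓ.extendsFrameOp_of_ae ha hb hG hΓG ∞ f.1 u hfu⟩

end Kernel

end WeylHeisenberg

theorem theorem7p1 (a b : ℝ) (ha : 0 < a) (hb : 0 < b) (hab : a * b ≤ 1)
    (g : Lp ℂ 2 (volume : Measure ℝ)) :
    (WeylHeisenberg.CCCondition a b g ↔
      (∀ (p : ℝ≥0∞) [Fact (1 ≤ p)], p ≠ ∞ →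
        ∃ T : Lp ℂ p (volume : Measure ℝ) →L[ℂ] Lp ℂ p (volume : Measure ℝ),
          WeylHeisenberg.ExtendsFrameOp a b g id T) ∧
      (∃ T : WeylHeisenberg.LInftyZero →L[ℂ] Lp ℂ ∞ (volume : Measure ℝ),
        WeylHeisenberg.ExtendsFrameOp a b g Subtype.val T)) ∧
    ((∃ q : ℚ, a * b = q) → WeylHeisenberg.IsFrame (WeylHeisenberg.whSystem a b g) →
      WeylHeisenberg.UniformCCCondition a b g →
      (∀ (p : ℝ≥0∞) [Fact (1 ≤ p)], p ≠ ∞ →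
        ∃ T : Lp ℂ p (volume : Measure ℝ) ≃L[ℂ] Lp ℂ p (volume : Measure ℝ),
          WeylHeisenberg.ExtendsFrameOp a b g id T) ∧
      (∃ T : WeylHeisenberg.LInftyZero ≃L[ℂ] WeylHeisenberg.LInftyZero,
        WeylHeisenberg.ExtendsFrameOp a b g Subtype.val (fun f => (T f).val))) :=
  ⟨WeylHeisenberg.ccCondition_iff ha hb g,
    fun hq hfr hU => WeylHeisenberg.exists_equiv_extendsFrameOp ha hb hq hfr hU⟩
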